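/- **Notation.** Identify $\mathbb R^2$ with $\mathbb C$; let $B(p,r)$ be the open ball, $B_R=B(0,R)$, $|B_R|=\pi R^2$. For a discrete set $\Lambda\subset\mathbb R^2$ and $m\in\mathbb R$, let $\mathscr F_\Lambda$ be the set of vector fields $j\in L^1_{\rm loc}(\mathbb R^2,\mathbb R^2)\cap L^2_{\rm loc}(\mathbb R^2\setminus\Lambda,\mathbb R^2)$ such that $$-\operatorname{div} j=2\pi\Big(\sum_{p\in\Lambda}\delta_p-m\Big)$$ in the sense of distributions on $\mathbb R^2$, and let $\mathscr P_\Lambda\subset\mathscr F_\Lambda$ be the subset of those $j$ with $\operatorname{curl} j=0$ in the sense of distributions on $\mathbb R^2$ (equivalently, the gradients in $\mathscr F_\Lambda$). Fix any family $(\chi_R)_{R>1}$ of smooth functions on $\mathbb R^2$ with $\chi_R\ge 0$, $\chi_R=1$ on $B_{R-1}$, $\chi_R=0$ outside $B_R$, and $\|\nabla\chi_R\|_\infty\le C$ with $C$ independent of $R$. Put $$W(j,\chi_R)=\limsup_{\eta\to0^+}\Big(\frac12\int_{\mathbb R^2\setminus\bigcup_{p\in\Lambda}B(p,\eta)}\chi_R|j|^2+\pi\log\eta\sum_{p\in\Lambda}\chi_R(p)\Big),\qquad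 W(j)=\limsup_{R\to\infty}\frac{W(j,\chi_R)}{|B_R|},$$ $$W(\Lambda)=\inf_{j\in\mathscr P_\Lambda}W(j),\qquad \tilde W(\Lambda)=\inf_{j\in\mathscr F_\Lambda}W(j),$$ with values in $[-\infty,+\infty]$ and $\inf\varnothing=+\infty$. Regard $\mathbb Z$ and $\mathbb N=\{1,2,3,\dots\}$ as subsets of the horizontal axis, and $\mathbb Z^2=\mathbb Z+i\mathbb Z$. The background is $m=0$ for $\Lambda=\mathbb Z,\mathbb N$, and $m=1$ for $\Lambda=\mathbb Z^2,\ \mathbb Z^2\setminus\mathbb Z,\ \mathbb Z^2\setminus\mathbb N$. **Theorem.** For every such family $(\chi_R)$: 1. $\tilde W(\mathbb Z)<+\infty$, $\tilde W(\mathbb N)<+\infty$, $\tilde W(\mathbb Z^2\setminus\mathbb Z)<+\infty$, $\tilde W(\mathbb Z^2\setminus\mathbb N)<+\infty$; 2. $W(\mathbb Z)<+\infty$, $W(\mathbb Z^2)<+\infty$, $W(\mathbb Z^2\setminus\mathbb Z)<+\infty$; 3. $W(\mathbb N)=+\infty$ and $W(\mathbb Z^2\setminus\mathbb N)=+\infty$.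 In particular $\tilde W(\mathbb N)\ne W(\mathbb N)$, so $W$ and $\tilde W$ are different. -/

import Mathlib

open Filter Topology MeasureTheory

/-! The plane is `ℂ`, regarded as a two-dimensional real Euclidean space with Lebesgue measure
`volume`; a vector field on the plane is a map `j : ℂ → ℂ`, and the pairing of `j` with the gradient
of a scalar function `φ` at `x` is the directional derivative `fderiv ℝ φ x (j x)`. -/

noncomputable section

namespace RenormalizedEnergy

/-- Smooth compactly supported real test functions on the plane. -/
def IsTest (φ : ℂ → ℝ) : Prop :=
  ContDiff ℝ (⊤ : ℕ∞) φ ∧ HasCompactSupport φ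

/-- A family `χ R`, `R > 1`, of smooth cut-off functions: nonnegative, equal to `1` on the ball of
radius `R - 1` about the origin and to `0` outside the ball of radius `R`, with gradients bounded
uniformly in `R`. -/
def IsCutoffFamily (χ : ℝ → ℂ → ℝ) : Prop :=
  ∃ C : ℝ, ∀ R : ℝ, 1 < R →
    ContDiff ℝ (⊤ : ℕ∞) (χ R) ∧
    (∀ x, 0 ≤ χ R x) ∧
    (∀ x, ‖fderiv ℝ (χ R) x‖ ≤ C) ∧
    (∀ x ∈ Metric.ball (0 : ℂ) (R - 1), χ R x = 1) ∧
    (∀ x, x ∉ Metric.ball (0 : ℂ) R → χ R x = 0)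

/-- `j ∈ L²_loc(ℝ² \ Λ)`: square integrability on every compact set that does not meet `Λ`. -/
def L2LocOff (Λ : Set ℂ) (j : ℂ → ℂ) : Prop :=
  ∀ K : Set ℂ, IsCompact K → Disjoint K Λ → MemLp j 2 (volume.restrict K)

/-- `-div j = 2π (∑_{p ∈ Λ} δ_p - m)` in the sense of distributions on the whole plane. -/
def DivEquation (Λ : Set ℂ) (m : ℝ) (j : ℂ → ℂ) : Prop :=
  ∀ φ : ℂ → ℝ, IsTest φ →
    ∫ x, fderiv ℝ φ x (j x) = 2 * Real.pi * ((∑' p : Λ, φ p) - m * ∫ x, φ x)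

/-- `curl j = ∂₁ j₂ - ∂₂ j₁ = 0` in the sense of distributions on the whole plane.
Multiplication by `Complex.I` is the rotation `(j₁, j₂) ↦ (-j₂, j₁)`. -/
def CurlFree (j : ℂ → ℂ) : Prop :=
  ∀ φ : ℂ → ℝ, IsTest φ → ∫ x, fderiv ℝ φ x (Complex.I * j x) = 0

/-- The fields in `L²_loc(ℝ² \ Λ)` that solve the divergence equation with background `m`. Local
integrability on the whole plane makes `j` a distribution there. -/
def fields (Λ : Set ℂ) (m : ℝ) : Set (ℂ → ℂ) :=
  {j | LocallyIntegrable j volume ∧ L2LocOff Λ j ∧ DivEquation Λ m j}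

/-- The curl-free members of `fields Λ m`, that is, those which are gradients. -/
def gradientFields (Λ : Set ℂ) (m : ℝ) : Set (ℂ → ℂ) :=
  {j | j ∈ fields Λ m ∧ CurlFree j}

/-- The energy of `j` truncated at distance `η` from `Λ`, with the divergent part compensated,
localized by `f`. For `f` continuous with compact support, `Λ` locally finite and
`j ∈ L²_loc(ℝ² \ Λ)`, the integrand is integrable and the sum is finite. -/
def truncatedEnergy (Λ : Set ℂ) (j : ℂ → ℂ) (f : ℂ → ℝ) (η : ℝ) : ℝ :=
  (1 / 2) * (∫ x in (⋃ p ∈ Λ, Metric.ball p η)ᶜ, f x * ‖j x‖ ^ 2)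
    + Real.pi * Real.log η * ∑' p : Λ, f p

/-- `W(j, f)`, the upper limit of the truncated energies as `η → 0⁺`. -/
def localizedEnergy (Λ : Set ℂ) (j : ℂ → ℂ) (f : ℂ → ℝ) : EReal :=
  limsup (fun η : ℝ => ((truncatedEnergy Λ j f η : ℝ) : EReal)) (𝓝[>] 0)

/-- `W(j)`, the upper limit as `R → ∞` of `W(j, χ_R) / |B_R|`, where `|B_R| = π R²`. -/
def fieldEnergy (χ : ℝ → ℂ → ℝ) (Λ : Set ℂ) (j : ℂ → ℂ) : EReal :=
  limsup (fun R : ℝ => localizedEnergy Λ j (χ R) / ((Real.pi * R ^ 2 : ℝ) : EReal)) atTop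

/-- `W(Λ)` with background `m`: the infimum over gradient fields. -/
def W (χ : ℝ → ℂ → ℝ) (m : ℝ) (Λ : Set ℂ) : EReal :=
  ⨅ j ∈ gradientFields Λ m, fieldEnergy χ Λ j

/-- `W̃(Λ)` with background `m`: the infimum over all fields. -/
def Wtilde (χ : ℝ → ℂ → ℝ) (m : ℝ) (Λ : Set ℂ) : EReal :=
  ⨅ j ∈ fields Λ m, fieldEnergy χ Λ j

/-- The integers on the horizontal axis. -/
def latticeZ : Set ℂ := {z | ∃ n : ℤ, z = n}

/-- The positive integers `1, 2, 3, …` on the horizontal axis. -/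
def latticeN : Set ℂ := {z | ∃ n : ℕ, 1 ≤ n ∧ z = n}

/-- The square lattice. -/
def latticeZ2 : Set ℂ := {z | ∃ a b : ℤ, z = a + b * Complex.I}

end RenormalizedEnergy

end

noncomputable section

namespace RenormalizedEnergy

/-! ### The square lattice -/

/-! If `f` is meromorphic with simple poles of residue one on `Λ`, then `-conj f` is curl free and
solves the divergence equation with `m = 0`: divergence and curl are the real and imaginary parts of
one pairing with the Cauchy–Riemann operator `dbar`, whose fundamental solution is `1 / z` up to a
constant. For `ℤ` take `π cot (π z)`. For `ℤ²` add up its vertical translates; the sum gains `-2 π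
i` under `z ↦ z + i`, and adding `2 π i Im z` makes it doubly periodic and creates exactly the
background `1`. For `ℕ` keep the cotangent field on `Re z > 1/2` only: by reflection symmetry its
normal component vanishes on `Re z = 1/2`, so the cut creates curl but no divergence. Differences of
these fields serve `ℤ² \ ℤ` and `ℤ² \ ℕ`.

All these functions are uniformly close to `1 / (z - p)` near the poles and bounded elsewhere
(`HasPoleBounds`). Each pole then costs `-π log η` times the cut-off plus a bounded error, and a
disc of radius `R` holds `O(R²)` poles, so the energy is not `+∞`
(`HasPoleBounds.fieldEnergy_lt_top`).

For the infinite values, suppose that a curl-free field `j` has energy below `+∞`. Completing the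
square against a truncated logarithm near each charge shows that the renormalized energy controls
the `L¹` norm: `∫_{B_R} |j| ≤ K R²` for large `R` (`exists_le_truncatedEnergy`,
`eventually_setIntegral_norm_le`). Now test the divergence equation with `Re (1 / z)` and the curl
equation with `Im (1 / z)`, both cut off to `1 ≤ |z| ≤ 2R`. By the Cauchy–Riemann equations only
gradients of the cut-off survive in the difference; the outer ones have size `R⁻²` after
multiplication by `1 / |z|`, so the `L¹` bound makes the total bounded in `R`. The charge side is
about `2 π ∑_{n ≤ R} 1 / n`, which is unbounded (`fieldEnergy_eq_top`). The test function is odd,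
hence blind to `ℤ²` and to the background, so `ℤ² \ ℕ` is covered as well. -/

lemma latticeZ_subset : latticeZ ⊆ latticeZ2 := by
  rintro z ⟨n, rfl⟩
  exact ⟨n, 0, by simp⟩

lemma latticeN_subset : latticeN ⊆ latticeZ := by
  rintro z ⟨n, -, rfl⟩
  exact ⟨n, by simp⟩

lemma one_le_dist_of_mem_lattice {p q : ℂ} (hp : p ∈ latticeZ2) (hq : q ∈ latticeZ2)
    (h : p ≠ q) : 1 ≤ dist p q := by
  obtain ⟨a, b, rfl⟩ := hp
  obtain ⟨c, d, rfl⟩ := hq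
  rw [Complex.dist_eq]
  have key : ∀ k : ℤ, k ≠ 0 → (1 : ℝ) ≤ |(k : ℝ)| := fun k hk => by
    exact_mod_cast Int.one_le_abs hk
  by_cases hac : a = c
  · have hbd : b - d ≠ 0 := fun h0 => h (by rw [hac, sub_eq_zero.mp h0])
    refine (key _ hbd).trans (le_trans (le_of_eq ?_) (Complex.abs_im_le_norm _))
    simp
  · refine (key _ (sub_ne_zero.mpr hac)).trans (le_trans (le_of_eq ?_) (Complex.abs_re_le_norm _))
    simp

/-- Discs around distinct lattice points are disjoint when their radii add up to at most one; this
separates the charges in every localization below. -/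
lemma eq_of_mem_lattice_of_dist_lt {p q z : ℂ} (hp : p ∈ latticeZ2) (hq : q ∈ latticeZ2)
    {r s : ℝ} (hzp : dist z p < r) (hzq : dist z q < s) (hrs : r + s ≤ 1) : p = q := by
  by_contra h
  have h1 := one_le_dist_of_mem_lattice hp hq h
  have h2 := dist_triangle_left p q z
  linarith

lemma countable_latticeZ2 : latticeZ2.Countable := by
  have : latticeZ2 = Set.range (fun x : ℤ × ℤ => (x.1 : ℂ) + x.2 * Complex.I) := by
    ext z
    constructor
    · rintro ⟨a, b, rfl⟩
      exact ⟨(a, b), rfl⟩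
    · rintro ⟨⟨a, b⟩, rfl⟩
      exact ⟨a, b, rfl⟩
  rw [this]
  exact Set.countable_range _

lemma ae_notMem_latticeZ2 : ∀ᵐ z : ℂ, z ∉ latticeZ2 :=
  countable_latticeZ2.ae_notMem volume

/-- The points of a sublattice in a disc, and a bound on their number. -/
lemma exists_finset_points {Λ : Set ℂ} (hΛ : Λ ⊆ latticeZ2) {R : ℝ} (hR : 0 ≤ R) :
    ∃ F : Finset ℂ, (∀ p, p ∈ F ↔ p ∈ Λ ∧ ‖p‖ ≤ R) ∧ (F.card : ℝ) ≤ (2 * R + 1) ^ 2 := by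
  classical
  set I : Finset ℤ := Finset.Icc (-⌊R⌋) ⌊R⌋ with hI
  set G : Finset ℂ := (I ×ˢ I).image (fun x : ℤ × ℤ => (x.1 : ℂ) + x.2 * Complex.I) with hG
  refine ⟨G.filter (fun p => p ∈ Λ ∧ ‖p‖ ≤ R), ?_, ?_⟩
  · intro p
    rw [Finset.mem_filter, and_iff_right_iff_imp]
    rintro ⟨hp, hpR⟩
    obtain ⟨a, b, rfl⟩ := hΛ hp
    have ha := (Complex.abs_re_le_norm _).trans hpR
    have hb := (Complex.abs_im_le_norm _).trans hpR
    simp only [Complex.add_re, Complex.intCast_re, Complex.mul_re, Complex.I_re, mul_zero,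
      Complex.intCast_im, Complex.I_im, mul_one, sub_self, add_zero, Complex.add_im,
      Complex.mul_im, zero_add] at ha hb
    rw [abs_le] at ha hb
    rw [hG, Finset.mem_image]
    refine ⟨(a, b), ?_, rfl⟩
    simp only [hI, Finset.mem_product, Finset.mem_Icc]
    refine ⟨⟨?_, Int.le_floor.mpr ha.2⟩, ?_, Int.le_floor.mpr hb.2⟩
    · rw [neg_le]; exact Int.le_floor.mpr (by push_cast; linarith)
    · rw [neg_le]; exact Int.le_floor.mpr (by push_cast; linarith)
  · have h1 : (G.filter (fun p => p ∈ Λ ∧ ‖p‖ ≤ R)).card ≤ I.card * I.card :=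
      (Finset.card_filter_le _ _).trans
        (Finset.card_image_le.trans (Finset.card_product _ _).le)
    have hfl : 0 ≤ ⌊R⌋ := Int.floor_nonneg.mpr hR
    have h2 : (I.card : ℝ) ≤ 2 * R + 1 := by
      have : (I.card : ℤ) = 2 * ⌊R⌋ + 1 := by
        rw [hI, Int.card_Icc, Int.toNat_of_nonneg (by linarith)]; ring
      have h3 : (I.card : ℝ) = 2 * (⌊R⌋ : ℝ) + 1 := by exact_mod_cast this
      rw [h3]
      linarith [Int.floor_le R]
    calc ((G.filter (fun p => p ∈ Λ ∧ ‖p‖ ≤ R)).card : ℝ) ≤ I.card * I.card := by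
          exact_mod_cast h1
      _ ≤ (2 * R + 1) ^ 2 := by
          rw [sq]; gcongr

lemma tsum_subtype_eq_sum {Λ : Set ℂ} {φ : ℂ → ℝ} {F : Finset ℂ} (hF : ∀ p ∈ F, p ∈ Λ)
    (h : ∀ p ∈ Λ, p ∉ F → φ p = 0) : ∑' p : Λ, φ p = ∑ p ∈ F, φ p := by
  rw [tsum_subtype Λ φ, tsum_eq_sum (s := F)]
  · exact Finset.sum_congr rfl fun p hp => Set.indicator_of_mem (hF p hp) _
  · intro p hp
    by_cases hpΛ : p ∈ Λ
    · rw [Set.indicator_of_mem hpΛ, h p hpΛ hp]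
    · exact Set.indicator_of_notMem hpΛ _

/-- A subset of the square lattice is closed. -/
lemma isClosed_of_subset_lattice {Λ : Set ℂ} (hΛ : Λ ⊆ latticeZ2) : IsClosed Λ :=
  Metric.isClosed_of_pairwise_le_dist one_pos fun _ hp _ hq h =>
    one_le_dist_of_mem_lattice (hΛ hp) (hΛ hq) h

/-! ### Radial integrals -/

lemma integral_radial (p : ℂ) (g : ℝ → ℝ) :
    ∫ z : ℂ, g ‖z - p‖ = 2 * Real.pi * ∫ y in Set.Ioi (0 : ℝ), y * g y := by
  rw [integral_sub_right_eq_self (fun z : ℂ => g ‖z‖) p, integral_fun_norm_addHaar volume g]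
  simp [Complex.finrank_real_complex, Measure.real, Complex.volume_ball]
  ring

lemma integrableOn_inv_norm_ball (p : ℂ) (r : ℝ) :
    IntegrableOn (fun z : ℂ => ‖z - p‖⁻¹) (Metric.ball p r) := by
  have h0 : IntegrableOn (fun z : ℂ => ‖z‖⁻¹) (Metric.ball 0 r) := by
    rw [integrableOn_fun_norm_addHaar volume (f := fun x : ℝ => x⁻¹)]
    refine (integrableOn_const (C := (1 : ℝ)) (s := Set.Ioo 0 r) (by simp)).congr_fun ?_
      measurableSet_Ioo
    intro x hx
    have : x ≠ 0 := hx.1.ne'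
    simp [Complex.finrank_real_complex, this]
  have := (MeasurePreserving.integrableOn_comp_preimage
    (measurePreserving_sub_right (volume : Measure ℂ) p)
    (Homeomorph.subRight p).measurableEmbedding).mpr h0
  have hs : Metric.ball p r = (fun x => x - p) ⁻¹' Metric.ball 0 r := by
    ext z
    simp [dist_eq_norm]
  rw [hs]
  exact this

lemma integral_inv_norm_ball (p : ℂ) {r : ℝ} (hr : 0 ≤ r) :
    ∫ z in Metric.ball p r, ‖z - p‖⁻¹ = 2 * Real.pi * r := by
  have h1 : ∫ z in Metric.ball p r, ‖z - p‖⁻¹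
      = ∫ z : ℂ, (fun y : ℝ => (Set.Iio r).indicator (fun y => y⁻¹) y) ‖z - p‖ := by
    rw [← integral_indicator measurableSet_ball]
    congr 1 with z
    simp [Set.indicator, dist_eq_norm]
  have h2 : ∫ y in Set.Ioi (0 : ℝ), y * (Set.Iio r).indicator (fun y => y⁻¹) y
      = ∫ y in Set.Ioi (0 : ℝ), (Set.Iio r).indicator (fun _ => (1 : ℝ)) y := by
    refine setIntegral_congr_fun measurableSet_Ioi fun y (hy : 0 < y) => ?_
    by_cases h : y < r <;> simp [h, hy.ne']
  rw [h1, integral_radial, h2, setIntegral_indicator measurableSet_Iio, Set.Ioi_inter_Iio]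
  simp [hr]

/-- The source of the logarithm in the renormalization: half of this quantity is what `π log η`
compensates at each charge. -/
lemma integral_inv_norm_sq_annulus (p : ℂ) {η r : ℝ} (hη : 0 < η) (hr : η ≤ r) :
    ∫ z in Metric.ball p r \ Metric.ball p η, (‖z - p‖ ^ 2)⁻¹
      = 2 * Real.pi * Real.log (r / η) := by
  have h1 : ∫ z in Metric.ball p r \ Metric.ball p η, (‖z - p‖ ^ 2)⁻¹
      = ∫ z : ℂ, (fun y : ℝ => (Set.Ico η r).indicator (fun y => (y ^ 2)⁻¹) y) ‖z - p‖ := by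
    rw [← integral_indicator (measurableSet_ball.diff measurableSet_ball)]
    congr 1 with z
    simp [Set.indicator, dist_eq_norm, and_comm]
  have h2 : ∫ y in Set.Ioi (0 : ℝ), y * (Set.Ico η r).indicator (fun y => (y ^ 2)⁻¹) y
      = ∫ y in Set.Ioi (0 : ℝ), (Set.Ico η r).indicator (fun y => y⁻¹) y := by
    refine setIntegral_congr_fun measurableSet_Ioi fun y (hy : 0 < y) => ?_
    by_cases h : y ∈ Set.Ico η r
    · simp only [Set.indicator_of_mem h]; field_simp
    · simp only [Set.indicator_of_notMem h, mul_zero]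
  have h3 : Set.Ioi (0 : ℝ) ∩ Set.Ico η r = Set.Ico η r :=
    Set.inter_eq_right.mpr fun y hy => hη.trans_le hy.1
  rw [h1, integral_radial, h2, setIntegral_indicator measurableSet_Ico, h3,
    integral_Ico_eq_integral_Ioc, ← intervalIntegral.integral_of_le hr,
    integral_inv_of_pos hη (hη.trans_le hr)]

lemma integrableOn_inv_norm_sq_annulus (p : ℂ) {η : ℝ} (r : ℝ) (hη : 0 < η) :
    IntegrableOn (fun z : ℂ => (‖z - p‖ ^ 2)⁻¹) (Metric.ball p r \ Metric.ball p η) := by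
  refine Measure.integrableOn_of_bounded (M := (η ^ 2)⁻¹) ?_ ?_ ?_
  · exact ((measure_mono Set.sdiff_subset).trans_lt measure_ball_lt_top).ne
  · exact Measurable.aestronglyMeasurable (by fun_prop)
  · filter_upwards [ae_restrict_mem (measurableSet_ball.diff measurableSet_ball)] with z hz
    have : η ≤ ‖z - p‖ := by simpa [dist_eq_norm] using hz.2
    rw [Real.norm_of_nonneg (by positivity)]
    gcongr

lemma locallyIntegrable_inv_sub (p : ℂ) :
    LocallyIntegrable (fun z : ℂ => (z - p)⁻¹) volume := by
  rw [locallyIntegrable_iff]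
  intro K hK
  obtain ⟨r, hr⟩ := hK.isBounded.subset_ball p
  refine Integrable.mono ((integrableOn_inv_norm_ball p r).mono_set hr) ?_
    (Eventually.of_forall fun z => by simp)
  exact (measurable_id.sub_const p).inv.aestronglyMeasurable

/-! ### Cut-off functions -/

/-- A cut-off at radius `R` with values in `[0, L]` and Lipschitz constant `L`. -/
structure IsCutoff (L R : ℝ) (f : ℂ → ℝ) : Prop where
  continuous : Continuous f
  nonneg : ∀ x, 0 ≤ f x
  le : ∀ x, f x ≤ L
  sub_le : ∀ x y, f x - f y ≤ L * dist x y
  eq_one : ∀ x ∈ Metric.ball (0 : ℂ) (R - 1), f x = 1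
  eq_zero : ∀ x, x ∉ Metric.ball (0 : ℂ) R → f x = 0

lemma IsCutoffFamily.exists_isCutoff {χ : ℝ → ℂ → ℝ} (hχ : IsCutoffFamily χ) :
    ∃ L : ℝ, 1 ≤ L ∧ ∀ R : ℝ, 1 < R → IsCutoff L R (χ R) := by
  obtain ⟨C, hC⟩ := hχ
  refine ⟨max C 1, le_max_right _ _, fun R hR => ?_⟩
  obtain ⟨hs, hn, hd, h1, h0⟩ := hC R hR
  have hlip : ∀ x y, χ R x - χ R y ≤ max C 1 * dist x y := fun x y => by
    have := convex_univ.norm_image_sub_le_of_norm_fderiv_le (𝕜 := ℝ) (f := χ R) (C := max C 1)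
      (fun z _ => (hs.differentiable (by simp)) z) (fun z _ => (hd z).trans (le_max_left _ _))
      (Set.mem_univ y) (Set.mem_univ x)
    rw [← dist_eq_norm x y] at this
    exact (le_abs_self _).trans this
  refine ⟨hs.continuous, hn, fun x => ?_, hlip, h1, h0⟩
  by_cases hx : x ∈ Metric.ball (0 : ℂ) (R - 1)
  · rw [h1 x hx]; exact le_max_right _ _
  · by_cases hx' : x ∈ Metric.ball (0 : ℂ) R
    · simp only [Metric.mem_ball, dist_zero_right, not_lt] at hx hx'
      have hx0 : 0 < ‖x‖ := by linarith
      -- Between the two spheres, the radial projection to `‖y‖ = R` moves a point by at most one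
      -- and lands where the cut-off vanishes, so the Lipschitz constant also bounds the values.
      set y : ℂ := ((R / ‖x‖ : ℝ) : ℂ) * x with hy
      have hyn : ‖y‖ = R := by
        rw [hy, norm_mul, Complex.norm_real, Real.norm_of_nonneg (by positivity)]
        field_simp
      have hy0 : χ R y = 0 := h0 y (by simp [hyn])
      have hxy : dist x y ≤ 1 := by
        have : y - x = ((R / ‖x‖ - 1 : ℝ) : ℂ) * x := by rw [hy]; push_cast; ring
        rw [dist_comm, dist_eq_norm, this, norm_mul, Complex.norm_real, Real.norm_of_nonneg, sub_mul]
        · rw [div_mul_cancel₀ _ hx0.ne']; linarith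
        · rw [sub_nonneg, one_le_div hx0]; exact hx'.le
      have h2 := hlip x y
      rw [hy0, sub_zero] at h2
      have hm : (0 : ℝ) ≤ max C 1 := zero_le_one.trans (le_max_right _ _)
      nlinarith
    · rw [h0 x hx']; exact zero_le_one.trans (le_max_right _ _)

/-! ### Fields with uniformly controlled simple poles -/

/-- The vector field `-conj f`; it is divergence free and curl free where `f` is holomorphic. -/
def conjField (f : ℂ → ℂ) (z : ℂ) : ℂ := -(starRingEnd ℂ) (f z)

@[simp] lemma norm_conjField (f : ℂ → ℂ) (z : ℂ) : ‖conjField f z‖ = ‖f z‖ := by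
  simp [conjField]

/-- Off the square lattice, `f` is within a bounded distance of `1 / (z - p)` near each `p ∈ Λ`,
and bounded away from `Λ`. -/
def HasPoleBounds (Λ : Set ℂ) (f : ℂ → ℂ) : Prop :=
  AEStronglyMeasurable f volume ∧ ∃ C : ℝ, 0 ≤ C ∧ ∀ z ∉ latticeZ2,
    (∀ p ∈ Λ, dist z p < 1 / 4 → ‖f z - (z - p)⁻¹‖ ≤ C) ∧
    ((∀ p ∈ Λ, 1 / 4 ≤ dist z p) → ‖f z‖ ≤ C)

/-- At a common pole the singular parts cancel; at a pole of `f` alone, `g` is bounded because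
lattice points are separated. -/
lemma HasPoleBounds.sub {Λ Λ' : Set ℂ} {f g : ℂ → ℂ} (hΛ : Λ' ⊆ Λ) (hΛ2 : Λ ⊆ latticeZ2)
    (hf : HasPoleBounds Λ f) (hg : HasPoleBounds Λ' g) :
    HasPoleBounds (Λ \ Λ') (fun z => f z - g z) := by
  obtain ⟨hfm, C, hC, hfb⟩ := hf
  obtain ⟨hgm, D, hD, hgb⟩ := hg
  refine ⟨hfm.sub hgm, C + D, add_nonneg hC hD, fun z hz => ⟨fun p hp hzp => ?_, fun h => ?_⟩⟩
  · have h1 := (hfb z hz).1 p hp.1 hzp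
    have h2 := (hgb z hz).2 fun q hq => by
      by_contra! hlt
      have := eq_of_mem_lattice_of_dist_lt (hΛ2 hp.1) (hΛ2 (hΛ hq)) hzp hlt (by norm_num)
      exact hp.2 (this ▸ hq)
    calc ‖f z - g z - (z - p)⁻¹‖ = ‖(f z - (z - p)⁻¹) - g z‖ := by congr 1; ring
      _ ≤ C + D := (norm_sub_le _ _).trans (add_le_add h1 h2)
  · by_cases hq : ∃ q ∈ Λ', dist z q < 1 / 4
    · obtain ⟨q, hq, hzq⟩ := hq
      calc ‖f z - g z‖ = ‖(f z - (z - q)⁻¹) - (g z - (z - q)⁻¹)‖ := by congr 1; ring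
        _ ≤ C + D := (norm_sub_le _ _).trans
          (add_le_add ((hfb z hz).1 q (hΛ hq) hzq) ((hgb z hz).1 q hq hzq))
    · push Not at hq
      have h1 := (hfb z hz).2 fun p hp => by
        by_cases hp' : p ∈ Λ'
        · exact hq p hp'
        · exact h p ⟨hp, hp'⟩
      exact (norm_sub_le _ _).trans (add_le_add h1 ((hgb z hz).2 hq))

/-- The pole bounds in the form of a single pointwise estimate. -/
lemma HasPoleBounds.exists_norm_le {Λ : Set ℂ} {f : ℂ → ℂ} (hf : HasPoleBounds Λ f) :
    ∃ C : ℝ, 0 ≤ C ∧ ∀ z ∉ latticeZ2, ‖f z‖ ≤ C ∨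
      ∃ p ∈ Λ, dist z p < 1 / 4 ∧ ‖f z‖ ≤ C + ‖z - p‖⁻¹ := by
  obtain ⟨-, C, hC, h⟩ := hf
  refine ⟨C, hC, fun z hz => ?_⟩
  by_cases hp : ∃ p ∈ Λ, dist z p < 1 / 4
  · obtain ⟨p, hp, hzp⟩ := hp
    refine Or.inr ⟨p, hp, hzp, ?_⟩
    have := norm_sub_norm_le (f z) (z - p)⁻¹
    rw [norm_inv] at this
    linarith [(h z hz).1 p hp hzp]
  · push Not at hp
    exact Or.inl ((h z hz).2 hp)

lemma HasPoleBounds.locallyIntegrable {Λ : Set ℂ} (hΛ : Λ ⊆ latticeZ2) {f : ℂ → ℂ}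
    (hf : HasPoleBounds Λ f) : LocallyIntegrable f volume := by
  obtain ⟨C, hC, h⟩ := hf.exists_norm_le
  rw [locallyIntegrable_iff]
  intro K hK
  obtain ⟨R, hR, hKR⟩ := hK.isBounded.subset_closedBall_lt 0 0
  obtain ⟨F, hF, -⟩ := exists_finset_points hΛ (R := R + 1) (by linarith)
  have hint : IntegrableOn (fun z => C + ∑ p ∈ F,
      (Metric.ball p (1 / 4)).indicator (fun z => ‖z - p‖⁻¹) z) K := by
    refine (integrableOn_const hK.measure_lt_top.ne).add (Integrable.integrableOn ?_)
    exact integrable_finsetSum _ fun p _ =>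
      (integrableOn_inv_norm_ball p _).integrable_indicator measurableSet_ball
  refine Integrable.mono' hint hf.1.restrict ?_
  filter_upwards [ae_restrict_of_ae ae_notMem_latticeZ2, ae_restrict_mem hK.measurableSet]
    with z hz hzK
  have hnn : ∀ p ∈ F, 0 ≤ (Metric.ball p (1 / 4)).indicator (fun z => ‖z - p‖⁻¹) z :=
    fun p _ => Set.indicator_nonneg (fun _ _ => by positivity) _
  rcases h z hz with h1 | ⟨p, hp, hzp, h1⟩
  · exact h1.trans (le_add_of_nonneg_right (Finset.sum_nonneg hnn))
  · have hpF : p ∈ F := (hF p).2 ⟨hp, by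
      have := hKR hzK
      rw [mem_closedBall_zero_iff] at this
      have h2 := norm_sub_norm_le p z
      rw [← dist_eq_norm, dist_comm] at h2
      linarith⟩
    refine h1.trans (add_le_add_right ?_ _)
    refine le_trans (le_of_eq ?_) (Finset.single_le_sum hnn hpF)
    rw [Set.indicator_of_mem (Metric.mem_ball.2 hzp)]

lemma HasPoleBounds.l2LocOff {Λ : Set ℂ} (hΛ : Λ ⊆ latticeZ2) {f : ℂ → ℂ}
    (hf : HasPoleBounds Λ f) : L2LocOff Λ f := by
  intro K hK hKΛ
  obtain ⟨C, hC, h⟩ := hf.exists_norm_le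
  -- `K` is compact and `Λ` closed, so they have disjoint thickenings; on `K` this gives `1 / |z -
  -- p| ≤ 1 / δ`.
  obtain ⟨δ, hδ, hd⟩ := hKΛ.exists_cthickenings hK (isClosed_of_subset_lattice hΛ)
  have : IsFiniteMeasure (volume.restrict K) := ⟨by simpa using hK.measure_lt_top⟩
  refine MemLp.of_bound hf.1.restrict (C + δ⁻¹) ?_
  filter_upwards [ae_restrict_of_ae ae_notMem_latticeZ2, ae_restrict_mem hK.measurableSet]
    with z hz hzK
  rcases h z hz with h1 | ⟨p, hp, hzp, h1⟩
  · exact h1.trans (le_add_of_nonneg_right (by positivity))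
  · refine h1.trans (add_le_add_right (inv_anti₀ hδ ?_) _)
    by_contra! hlt
    refine Set.disjoint_left.1 hd (Metric.mem_cthickening_of_dist_le z z δ K hzK (by simp [hδ.le]))
      (Metric.mem_cthickening_of_dist_le z p δ Λ hp ?_)
    rw [dist_eq_norm]; exact hlt.le

lemma L2LocOff.conjField {Λ : Set ℂ} {f : ℂ → ℂ} (hf : L2LocOff Λ f) :
    L2LocOff Λ (conjField f) := by
  intro K hK hKΛ
  have := hf K hK hKΛ
  exact this.of_le (by
    exact (Complex.continuous_conj.comp_aestronglyMeasurable this.1).neg)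
    (Eventually.of_forall fun z => (norm_conjField f z).le)

lemma locallyIntegrable_conjField {f : ℂ → ℂ} (hf : LocallyIntegrable f volume) :
    LocallyIntegrable (conjField f) volume := by
  rw [locallyIntegrable_iff] at hf ⊢
  intro K hK
  exact Integrable.mono (hf K hK) ((Complex.continuous_conj.comp_aestronglyMeasurable (hf K hK).1).neg)
    (Eventually.of_forall fun z => (norm_conjField f z).le)

/-! ### The upper bound for the energy -/

/-- Near a pole `‖f‖² ≤ (C + 1/r)²`. The `1/r²` part integrates to the logarithm that is
compensated; the `1/r` part is integrable and costs a constant per pole. -/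
lemma HasPoleBounds.exists_truncatedEnergy_le {Λ : Set ℂ} (hΛ : Λ ⊆ latticeZ2) {f : ℂ → ℂ}
    (hf : HasPoleBounds Λ f) {L : ℝ} (hL : 1 ≤ L) :
    ∃ K : ℝ, ∀ R : ℝ, 1 < R → ∀ χ : ℂ → ℝ, IsCutoff L R χ → ∀ η : ℝ, 0 < η → η < 1 / 4 →
      truncatedEnergy Λ (conjField f) χ η ≤ K * R ^ 2 := by
  obtain ⟨C, hC, h⟩ := hf.exists_norm_le
  refine ⟨1 / 2 * (L * C ^ 2 * Real.pi) + 25 * ((L + 2 * C * L) * Real.pi / 4), ?_⟩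
  intro R hR χ hχ η hη hη4
  obtain ⟨F, hF, hcard⟩ := exists_finset_points hΛ (R := R + 1) (by linarith)
  -- The count at radius `R + 1` is at most `(2R + 3)²`, and `R > 1`.
  have hcard' : (F.card : ℝ) ≤ 25 * R ^ 2 := hcard.trans (by nlinarith)
  set S : Set ℂ := (⋃ p ∈ Λ, Metric.ball p η)ᶜ with hS
  have hSm : MeasurableSet S :=
    ((isOpen_biUnion fun _ _ => Metric.isOpen_ball).measurableSet).compl
  set A : ℂ → ℂ → ℝ := fun p =>
    (Metric.ball p (1 / 4) \ Metric.ball p η).indicator (fun z => (‖z - p‖ ^ 2)⁻¹) with hA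
  set B : ℂ → ℂ → ℝ := fun p =>
    (Metric.ball p (1 / 4)).indicator (fun z => ‖z - p‖⁻¹) with hB
  set G : ℂ → ℝ := fun z => (Metric.ball (0 : ℂ) R).indicator (fun _ => L * C ^ 2) z
    + ∑ p ∈ F, (χ p * A p z + (L + 2 * C * L) * B p z) with hG
  have hA0 : ∀ p z, 0 ≤ A p z := fun p z => Set.indicator_nonneg (fun _ _ => by positivity) _
  have hB0 : ∀ p z, 0 ≤ B p z := fun p z => Set.indicator_nonneg (fun _ _ => by positivity) _
  have hAi : ∀ p, Integrable (A p) := fun p =>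
    (integrableOn_inv_norm_sq_annulus p _ hη).integrable_indicator
      (measurableSet_ball.diff measurableSet_ball)
  have hBi : ∀ p, Integrable (B p) := fun p =>
    (integrableOn_inv_norm_ball p _).integrable_indicator measurableSet_ball
  have hterm : ∀ z, ∀ p ∈ F, 0 ≤ χ p * A p z + (L + 2 * C * L) * B p z := fun z p _ =>
    add_nonneg (mul_nonneg (hχ.nonneg p) (hA0 p z)) (mul_nonneg (by positivity) (hB0 p z))
  have hI0 : ∀ z, 0 ≤ (Metric.ball (0 : ℂ) R).indicator (fun _ => L * C ^ 2) z :=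
    fun z => Set.indicator_nonneg (fun _ _ => by positivity) _
  have hIi : Integrable ((Metric.ball (0 : ℂ) R).indicator (fun _ => L * C ^ 2)) :=
    (integrableOn_const measure_ball_lt_top.ne).integrable_indicator measurableSet_ball
  have hsi : ∀ p ∈ F, Integrable (fun z => χ p * A p z + (L + 2 * C * L) * B p z) :=
    fun p _ => ((hAi p).const_mul _).add ((hBi p).const_mul _)
  have hGi : Integrable G := hIi.add (integrable_finsetSum _ hsi)
  have hG0 : ∀ z, 0 ≤ G z := fun z => add_nonneg (hI0 z) (Finset.sum_nonneg (hterm z))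
  have hpt : ∀ᵐ z ∂(volume.restrict S), χ z * ‖conjField f z‖ ^ 2 ≤ G z := by
    filter_upwards [ae_restrict_of_ae ae_notMem_latticeZ2, ae_restrict_mem hSm] with z hz hzS
    rw [norm_conjField]
    by_cases hzR : z ∈ Metric.ball (0 : ℂ) R
    swap
    · rw [hχ.eq_zero z hzR, zero_mul]; exact hG0 z
    have hI : (Metric.ball (0 : ℂ) R).indicator (fun _ => L * C ^ 2) z = L * C ^ 2 :=
      Set.indicator_of_mem hzR _
    rcases h z hz with h1 | ⟨p, hp, hzp, h1⟩
    · refine le_trans ?_ (le_add_of_nonneg_right (Finset.sum_nonneg (hterm z)))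
      rw [hI]
      have := hχ.le z
      have := hχ.nonneg z
      gcongr
    · have hpF : p ∈ F := (hF p).2 ⟨hp, by
        rw [mem_ball_zero_iff] at hzR
        have h2 := norm_sub_norm_le p z
        rw [← dist_eq_norm, dist_comm] at h2
        linarith⟩
      have hzη : z ∉ Metric.ball p η := fun hmem => hzS (Set.mem_biUnion hp hmem)
      have hr : 0 < ‖z - p‖ := by
        rw [Metric.mem_ball, not_lt, dist_eq_norm] at hzη
        exact hη.trans_le hzη
      refine le_trans ?_ (add_le_add_right (Finset.single_le_sum (hterm z) hpF) _)
      rw [hI]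
      have hAz : A p z = (‖z - p‖ ^ 2)⁻¹ := Set.indicator_of_mem
        (show z ∈ Metric.ball p (1 / 4) \ Metric.ball p η from ⟨Metric.mem_ball.2 hzp, hzη⟩) _
      have hBz : B p z = ‖z - p‖⁻¹ := Set.indicator_of_mem (Metric.mem_ball.2 hzp) _
      rw [hAz, hBz]
      -- The coefficient of `1/r²` has to be exactly `χ p` for the logarithms to cancel; replacing
      -- `χ z` by `χ p + L r` only produces another `1/r` term.
      have hl := hχ.sub_le z p
      rw [dist_eq_norm] at hl
      have hχ0 := hχ.nonneg z
      have hχL := hχ.le z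
      set r := ‖z - p‖ with hrdef
      have hri : r * r⁻¹ = 1 := mul_inv_cancel₀ hr.ne'
      have hr0 : 0 ≤ r⁻¹ := by positivity
      calc χ z * ‖f z‖ ^ 2 ≤ χ z * (C + r⁻¹) ^ 2 := by gcongr
        _ = χ z * (C ^ 2 + 2 * C * r⁻¹) + χ z * (r ^ 2)⁻¹ := by field_simp; ring
        _ ≤ L * (C ^ 2 + 2 * C * r⁻¹) + (χ p + L * r) * (r ^ 2)⁻¹ := by
            gcongr; linarith
        _ = L * C ^ 2 + (χ p * (r ^ 2)⁻¹ + (L + 2 * C * L) * r⁻¹) := by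
            field_simp; ring
  have hint : ∫ z in S, χ z * ‖conjField f z‖ ^ 2 ≤ ∫ z, G z :=
    (integral_mono_of_nonneg (Eventually.of_forall fun z => mul_nonneg (hχ.nonneg z) (sq_nonneg _))
      hGi.integrableOn hpt).trans
      (setIntegral_le_integral hGi (Eventually.of_forall hG0))
  have hGval : ∫ z, G z = L * C ^ 2 * Real.pi * R ^ 2 + ∑ p ∈ F,
      (χ p * (2 * Real.pi * Real.log (1 / 4 / η))
        + (L + 2 * C * L) * (2 * Real.pi * (1 / 4))) := by
    rw [hG, integral_add hIi (integrable_finsetSum _ hsi), integral_finsetSum _ hsi]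
    congr 1
    · rw [integral_indicator measurableSet_ball, setIntegral_const, Measure.real,
        Complex.volume_ball, smul_eq_mul, ENNReal.toReal_mul, ENNReal.toReal_pow,
        ENNReal.toReal_ofReal (by linarith)]
      simp
      ring
    · refine Finset.sum_congr rfl fun p _ => ?_
      rw [integral_add ((hAi p).const_mul _) ((hBi p).const_mul _), integral_const_mul,
        integral_const_mul, hA, hB,
        integral_indicator (measurableSet_ball.diff measurableSet_ball),
        integral_indicator measurableSet_ball, integral_inv_norm_sq_annulus p hη hη4.le,
        integral_inv_norm_ball p (by norm_num)]
  have htsum : ∑' p : Λ, χ p = ∑ p ∈ F, χ p := by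
    refine tsum_subtype_eq_sum (fun p hp => ((hF p).1 hp).1) fun p hp hpF => hχ.eq_zero p ?_
    intro hpR
    rw [mem_ball_zero_iff] at hpR
    exact hpF ((hF p).2 ⟨hp, by linarith⟩)
  have hlog : Real.log (1 / 4 / η) ≤ -Real.log η := by
    rw [Real.log_div (by norm_num) hη.ne']
    have : Real.log (1 / 4) ≤ 0 := Real.log_nonpos (by norm_num) (by norm_num)
    linarith
  have hpi := Real.pi_pos
  unfold truncatedEnergy
  rw [htsum]
  calc 1 / 2 * (∫ z in S, χ z * ‖conjField f z‖ ^ 2) + Real.pi * Real.log η * ∑ p ∈ F, χ p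
      ≤ 1 / 2 * (L * C ^ 2 * Real.pi * R ^ 2 + ∑ p ∈ F, (χ p * (2 * Real.pi * (-Real.log η))
        + (L + 2 * C * L) * (2 * Real.pi * (1 / 4)))) + Real.pi * Real.log η * ∑ p ∈ F, χ p := by
        refine add_le_add_left (mul_le_mul_of_nonneg_left ((hint.trans_eq hGval).trans ?_)
          (by norm_num)) _
        refine add_le_add_right (Finset.sum_le_sum fun p _ => ?_) _
        have := hχ.nonneg p
        gcongr
    _ = 1 / 2 * (L * C ^ 2 * Real.pi) * R ^ 2
        + F.card * ((L + 2 * C * L) * Real.pi / 4) := by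
        rw [Finset.sum_add_distrib, ← Finset.sum_mul, Finset.sum_const, nsmul_eq_mul]
        ring
    _ ≤ 1 / 2 * (L * C ^ 2 * Real.pi) * R ^ 2
        + 25 * R ^ 2 * ((L + 2 * C * L) * Real.pi / 4) := by gcongr
    _ = _ := by ring

lemma HasPoleBounds.fieldEnergy_lt_top {Λ : Set ℂ} (hΛ : Λ ⊆ latticeZ2) {f : ℂ → ℂ}
    (hf : HasPoleBounds Λ f) {χ : ℝ → ℂ → ℝ} (hχ : IsCutoffFamily χ) :
    fieldEnergy χ Λ (conjField f) < ⊤ := by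
  obtain ⟨L, hL, hcut⟩ := hχ.exists_isCutoff
  obtain ⟨K, hK⟩ := hf.exists_truncatedEnergy_le hΛ hL
  refine lt_of_le_of_lt (b := ((K / Real.pi : ℝ) : EReal)) ?_ (EReal.coe_lt_top _)
  refine limsup_le_of_le (by isBoundedDefault) ?_
  filter_upwards [eventually_gt_atTop 1] with R hR
  have hpos : (0 : ℝ) < Real.pi * R ^ 2 := by positivity
  have h1 : localizedEnergy Λ (conjField f) (χ R) ≤ ((K * R ^ 2 : ℝ) : EReal) := by
    refine limsup_le_of_le (by isBoundedDefault) ?_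
    filter_upwards [Ioo_mem_nhdsGT (show (0 : ℝ) < 1 / 4 by norm_num)] with η hη
    exact_mod_cast hK R hR (χ R) (hcut R hR) η hη.1 hη.2
  rw [EReal.div_le_iff_le_mul (by exact_mod_cast hpos) (EReal.coe_ne_top _), ← EReal.coe_mul]
  refine h1.trans (le_of_eq ?_)
  congr 1
  field_simp

/-! ### The Cauchy–Riemann operator on test functions -/

/-- Twice the derivative of a real function with respect to `conj z`. -/
def dbar (φ : ℂ → ℝ) (z : ℂ) : ℂ :=
  (fderiv ℝ φ z 1 : ℝ) + Complex.I * (fderiv ℝ φ z Complex.I : ℝ)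

lemma fderiv_apply_eq (φ : ℂ → ℝ) (z w : ℂ) :
    fderiv ℝ φ z w = w.re * fderiv ℝ φ z 1 + w.im * fderiv ℝ φ z Complex.I := by
  have hw : w = w.re • (1 : ℂ) + w.im • Complex.I := by simp [Complex.re_add_im]
  conv_lhs => rw [hw]
  simp only [map_add, map_smul, smul_eq_mul]

/-- With `fderiv_I_mul_conjField`, this turns the divergence and curl pairings into the real and
imaginary parts of one complex integrand. -/
lemma fderiv_conjField (φ : ℂ → ℝ) (f : ℂ → ℂ) (z : ℂ) :
    fderiv ℝ φ z (conjField f z) = -(dbar φ z * f z).re := by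
  rw [fderiv_apply_eq]
  simp [conjField, dbar]
  ring

lemma fderiv_I_mul_conjField (φ : ℂ → ℝ) (f : ℂ → ℂ) (z : ℂ) :
    fderiv ℝ φ z (Complex.I * conjField f z) = -(dbar φ z * f z).im := by
  rw [fderiv_apply_eq]
  simp [conjField, dbar]
  ring

lemma IsTest.differentiable {φ : ℂ → ℝ} (hφ : IsTest φ) : Differentiable ℝ φ :=
  hφ.1.differentiable (by simp)

lemma IsTest.continuous_fderiv {φ : ℂ → ℝ} (hφ : IsTest φ) : Continuous (fderiv ℝ φ) :=
  hφ.1.continuous_fderiv (by simp)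

lemma IsTest.continuous_fderiv_apply {φ : ℂ → ℝ} (hφ : IsTest φ) (v : ℂ) :
    Continuous (fun z => fderiv ℝ φ z v) :=
  hφ.continuous_fderiv.clm_apply continuous_const

lemma IsTest.continuous_dbar {φ : ℂ → ℝ} (hφ : IsTest φ) : Continuous (dbar φ) := by
  have h1 := hφ.continuous_fderiv_apply 1
  have h2 := hφ.continuous_fderiv_apply Complex.I
  unfold dbar
  fun_prop

lemma fderiv_eq_zero_of_notMem {φ : ℂ → ℝ} {z : ℂ} (hz : z ∉ tsupport φ) : fderiv ℝ φ z = 0 := by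
  by_contra h
  exact hz (support_fderiv_subset ℝ h)

lemma dbar_eq_zero_of_notMem {φ : ℂ → ℝ} {z : ℂ} (hz : z ∉ tsupport φ) : dbar φ z = 0 := by
  simp [dbar, fderiv_eq_zero_of_notMem hz]

lemma IsTest.hasCompactSupport_dbar {φ : ℂ → ℝ} (hφ : IsTest φ) : HasCompactSupport (dbar φ) :=
  HasCompactSupport.intro hφ.2 fun _ hz => dbar_eq_zero_of_notMem hz

lemma IsTest.integrable_dbar_mul {φ : ℂ → ℝ} (hφ : IsTest φ) {f : ℂ → ℂ}
    (hf : LocallyIntegrable f volume) : Integrable (fun z => dbar φ z * f z) :=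
  hf.integrable_smul_left_of_hasCompactSupport hφ.continuous_dbar hφ.hasCompactSupport_dbar

lemma IsTest.mul {φ θ : ℂ → ℝ} (hφ : IsTest φ) (hθ : ContDiff ℝ (⊤ : ℕ∞) θ) :
    IsTest (fun z => θ z * φ z) :=
  ⟨hθ.mul hφ.1, hφ.2.mul_left⟩

lemma IsTest.sub {φ ψ : ℂ → ℝ} (hφ : IsTest φ) (hψ : IsTest ψ) : IsTest (fun z => φ z - ψ z) :=
  ⟨hφ.1.sub hψ.1, hφ.2.sub hψ.2⟩

lemma IsTest.sum {ι : Type*} {s : Finset ι} {φ : ι → ℂ → ℝ} (hφ : ∀ i ∈ s, IsTest (φ i)) :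
    IsTest (fun z => ∑ i ∈ s, φ i z) := by
  classical
  induction s using Finset.induction_on with
  | empty => exact ⟨by simpa using contDiff_const, HasCompactSupport.zero⟩
  | insert a s ha ih =>
    simp only [Finset.sum_insert ha]
    have h1 := hφ a (Finset.mem_insert_self _ _)
    have h2 := ih fun i hi => hφ i (Finset.mem_insert_of_mem hi)
    exact ⟨h1.1.add h2.1, h1.2.add h2.2⟩

lemma IsTest.dbar_sub {φ ψ : ℂ → ℝ} (hφ : IsTest φ) (hψ : IsTest ψ) (z : ℂ) :
    dbar (fun z => φ z - ψ z) z = dbar φ z - dbar ψ z := by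
  have : fderiv ℝ (fun z => φ z - ψ z) z = fderiv ℝ φ z - fderiv ℝ ψ z :=
    fderiv_fun_sub (hφ.differentiable z) (hψ.differentiable z)
  simp only [dbar, this, _root_.sub_apply]
  push_cast
  ring

lemma IsTest.dbar_sum {ι : Type*} {s : Finset ι} {φ : ι → ℂ → ℝ} (hφ : ∀ i ∈ s, IsTest (φ i))
    (z : ℂ) : dbar (fun z => ∑ i ∈ s, φ i z) z = ∑ i ∈ s, dbar (φ i) z := by
  have : fderiv ℝ (fun z => ∑ i ∈ s, φ i z) z = ∑ i ∈ s, fderiv ℝ (φ i) z :=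
    fderiv_fun_sum fun i hi => (hφ i hi).differentiable z
  simp only [dbar, this, _root_.sum_apply, Finset.sum_add_distrib]
  push_cast
  simp [Finset.mul_sum]

/-- Integration by parts against a function with continuous derivative near the support. -/
lemma IsTest.integral_mul_fderiv {φ : ℂ → ℝ} (hφ : IsTest φ) {F : ℂ → ℂ} (v : ℂ)
    (hF : ∀ z ∈ tsupport φ, DifferentiableAt ℝ F z)
    (hF' : ContinuousOn (fun z => fderiv ℝ F z v) (tsupport φ)) :
    Integrable (fun z => F z * (fderiv ℝ φ z v : ℝ)) ∧
    ∫ z, F z * (fderiv ℝ φ z v : ℝ) = -∫ z, fderiv ℝ F z v * φ z := by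
  have hK : IsCompact (tsupport φ) := hφ.2
  have hFc : ContinuousOn F (tsupport φ) := fun z hz => (hF z hz).continuousAt.continuousWithinAt
  have key : ∀ {g : ℂ → ℂ} {u : ℂ → ℝ}, ContinuousOn g (tsupport φ) → Continuous u →
      (∀ z ∉ tsupport φ, u z = 0) → Integrable (fun z => g z * (u z : ℂ)) := by
    intro g u hg hu h0
    rw [← integrableOn_iff_integrable_of_support_subset (s := tsupport φ)]
    · exact ContinuousOn.integrableOn_compact hK
        (hg.mul (Complex.continuous_ofReal.comp hu).continuousOn)
    · intro z hz
      by_contra h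
      exact hz (by simp [h0 z h])
  have hφd : ∀ z, fderiv ℝ (fun z => (φ z : ℂ)) z v = (fderiv ℝ φ z v : ℝ) := fun z => by
    have h1 : HasFDerivAt (fun z => (φ z : ℂ)) (Complex.ofRealCLM.comp (fderiv ℝ φ z)) z :=
      Complex.ofRealCLM.hasFDerivAt.comp z (hφ.differentiable z).hasFDerivAt
    rw [h1.fderiv]; rfl
  have hz0 : ∀ z ∉ tsupport φ, fderiv ℝ φ z v = 0 := fun z hz => by
    rw [fderiv_eq_zero_of_notMem hz]; rfl
  have hi1 := key hFc (hφ.continuous_fderiv_apply v) hz0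
  refine ⟨hi1, ?_⟩
  have hts : tsupport (fun z => (φ z : ℂ)) ⊆ tsupport φ :=
    closure_mono fun z hz => by simpa using hz
  have := integral_mul_fderiv_eq_neg_fderiv_mul_of_integrable (μ := volume) (f := F)
    (g := fun z => (φ z : ℂ)) (v := v)
    (key hF' hφ.1.continuous fun z hz => image_eq_zero_of_notMem_tsupport hz)
    (by simpa only [hφd] using hi1)
    (key hFc hφ.1.continuous fun z hz => image_eq_zero_of_notMem_tsupport hz)
    (fun z hz => hF z (hts hz))
    (fun z _ => Complex.ofRealCLM.differentiableAt.comp z (hφ.differentiable z))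
  simpa only [hφd] using this

/-- After integration by parts the integrand is `φ` times `-(F' + i · i F') = 0`. -/
lemma IsTest.integral_dbar_mul_eq_zero {φ : ℂ → ℝ} (hφ : IsTest φ) {F : ℂ → ℂ} {U : Set ℂ}
    (hU : IsOpen U) (hφU : tsupport φ ⊆ U) (hF : DifferentiableOn ℂ F U) :
    ∫ z, dbar φ z * F z = 0 := by
  have hd : ∀ z ∈ tsupport φ, HasFDerivAt F
      ((ContinuousLinearMap.toSpanSingleton ℂ (deriv F z)).restrictScalars ℝ) z :=
    fun z hz => ((hF.differentiableAt (hU.mem_nhds (hφU hz))).hasDerivAt.hasFDerivAt).restrictScalars ℝ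
  have hv : ∀ v, ∀ z ∈ tsupport φ, fderiv ℝ F z v = v * deriv F z := fun v z hz => by
    rw [(hd z hz).fderiv]; simp
  have hc : ContinuousOn (deriv F) (tsupport φ) := ((hF.deriv hU).continuousOn).mono hφU
  have h := fun v => hφ.integral_mul_fderiv (F := F) v (fun z hz => (hd z hz).differentiableAt)
    ((continuousOn_const.mul hc).congr (hv v))
  have hcon : ∀ z, dbar φ z * F z = F z * (fderiv ℝ φ z 1 : ℝ)
      + Complex.I * (F z * (fderiv ℝ φ z Complex.I : ℝ)) := fun z => by rw [dbar]; ring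
  simp_rw [hcon]
  rw [integral_add (h 1).1 ((h Complex.I).1.const_mul _), integral_const_mul, (h 1).2,
    (h Complex.I).2, mul_neg, ← integral_const_mul, ← neg_add_rev, neg_eq_zero,
    add_comm, ← sub_neg_eq_add, sub_eq_zero, ← integral_neg]
  congr 1 with z
  by_cases hz : z ∈ tsupport φ
  · rw [hv 1 z hz, hv Complex.I z hz, ← mul_assoc, ← mul_assoc, Complex.I_mul_I]; ring
  · simp [image_eq_zero_of_notMem_tsupport hz]

/-- The Cauchy–Riemann operator sends `2 π i Im z` to the constant `-2 π`: this term produces the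
unit background of the lattice field. -/
lemma IsTest.integral_dbar_mul_im {φ : ℂ → ℝ} (hφ : IsTest φ) :
    ∫ z, dbar φ z * (2 * Real.pi * Complex.I * z.im) = ((2 * Real.pi * ∫ z, φ z : ℝ) : ℂ) := by
  have hd : ∀ z : ℂ, HasFDerivAt (fun z : ℂ => (z.im : ℂ))
      (Complex.ofRealCLM.comp Complex.imCLM) z := fun z =>
    (Complex.ofRealCLM.comp Complex.imCLM).hasFDerivAt
  have hv : ∀ v z, fderiv ℝ (fun z : ℂ => (z.im : ℂ)) z v = v.im := fun v z => by
    rw [(hd z).fderiv]; rfl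
  have h := fun v => hφ.integral_mul_fderiv v (fun z _ => (hd z).differentiableAt)
    (by simp only [hv]; exact continuousOn_const)
  have hcon : ∀ z, dbar φ z * (2 * Real.pi * Complex.I * z.im) =
      (2 * Real.pi * Complex.I) * (z.im * (fderiv ℝ φ z 1 : ℝ)
      + Complex.I * (z.im * (fderiv ℝ φ z Complex.I : ℝ))) := fun z => by rw [dbar]; ring
  simp_rw [hcon]
  rw [integral_const_mul, integral_add (h 1).1 ((h Complex.I).1.const_mul _), integral_const_mul,
    (h 1).2, (h Complex.I).2]
  simp only [hv, Complex.one_im, Complex.I_im, Complex.ofReal_zero, Complex.ofReal_one, zero_mul,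
    one_mul, integral_zero, neg_zero, zero_add, integral_complex_ofReal]
  push_cast
  linear_combination (-2 * Real.pi * (∫ z, φ z : ℝ) : ℂ) * Complex.I_mul_I

/-! ### The fundamental solution of the Cauchy–Riemann operator -/

/-- In polar coordinates `dbar φ = (∂_r φ + (i / r) ∂_θ φ) e^{iθ}`, and the Jacobian cancels the
modulus of `1 / z`. The radial part `A` integrates to `-φ 0` along each ray; the angular part `B`
integrates to zero over each circle. -/
lemma IsTest.integral_dbar_mul_inv_zero {φ : ℂ → ℝ} (hφ : IsTest φ) :
    ∫ z, dbar φ z * z⁻¹ = ((-(2 * Real.pi * φ 0) : ℝ) : ℂ) := by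
  obtain ⟨T, hT, hTs⟩ := hφ.2.isBounded.subset_closedBall_lt 0 0
  set e : ℝ → ℂ := fun θ => Real.cos θ + Real.sin θ * Complex.I with he
  have hen : ∀ θ, ‖e θ‖ = 1 := fun θ => by
    rw [he]; simp only [Complex.ofReal_cos, Complex.ofReal_sin]
    rw [← Complex.exp_mul_I, Complex.norm_exp_ofReal_mul_I]
  have hec : Continuous e := by fun_prop
  have hed : ∀ θ, HasDerivAt e (Complex.I * e θ) θ := fun θ => by
    have h1 : HasDerivAt (fun θ : ℝ => Complex.exp (θ * Complex.I))
        (Complex.exp (θ * Complex.I) * (1 * Complex.I)) θ :=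
      ((Complex.ofRealCLM.hasDerivAt (x := θ)).mul_const Complex.I).cexp
    have h2 : e = fun θ : ℝ => Complex.exp (θ * Complex.I) := by
      funext θ; simp [he, Complex.exp_mul_I]
    rw [h2]
    convert h1 using 1
    ring
  set A : ℝ × ℝ → ℝ := fun q => fderiv ℝ φ (q.1 * e q.2) (e q.2) with hA
  set B : ℝ × ℝ → ℝ := fun q => fderiv ℝ φ (q.1 * e q.2) (Complex.I * e q.2) with hB
  have hpc : Continuous (fun q : ℝ × ℝ => (q.1 : ℂ) * e q.2) := by fun_prop
  have hAc : Continuous A := (hφ.continuous_fderiv.comp hpc).clm_apply (by fun_prop)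
  have hBc : Continuous B := (hφ.continuous_fderiv.comp hpc).clm_apply (by fun_prop)
  have hout : ∀ r θ : ℝ, T < |r| → (r : ℂ) * e θ ∉ tsupport φ := fun r θ hr hmem => by
    have := hTs hmem
    rw [mem_closedBall_zero_iff, norm_mul, hen, mul_one, Complex.norm_real,
      Real.norm_eq_abs] at this
    linarith
  set S : Set (ℝ × ℝ) := Set.Ioi (0 : ℝ) ×ˢ Set.Ioo (-Real.pi) Real.pi with hS
  have hSm : MeasurableSet S := measurableSet_Ioi.prod measurableSet_Ioo
  have hint : ∀ u : ℝ × ℝ → ℝ, Continuous u → (∀ r θ : ℝ, T < |r| → u (r, θ) = 0) →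
      IntegrableOn u S := by
    intro u hu h0
    have h1 : IntegrableOn u (Set.Icc 0 T ×ˢ Set.Icc (-Real.pi) Real.pi) :=
      hu.continuousOn.integrableOn_compact (isCompact_Icc.prod isCompact_Icc)
    refine h1.of_forall_sdiff_eq_zero hSm ?_
    rintro ⟨r, θ⟩ ⟨⟨hr, hθ⟩, hn⟩
    refine h0 r θ ?_
    simp only [Set.mem_Ioi] at hr
    rw [abs_of_pos hr]
    by_contra! hle
    exact hn ⟨⟨hr.le, hle⟩, Set.Ioo_subset_Icc_self hθ⟩
  have hAi := hint A hAc fun r θ hr => by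
    simp [hA, fderiv_eq_zero_of_notMem (hout r θ hr)]
  have hBi := hint B hBc fun r θ hr => by
    simp [hB, fderiv_eq_zero_of_notMem (hout r θ hr)]
  have hvol : (volume : Measure (ℝ × ℝ)).restrict S =
      (volume.restrict (Set.Ioi 0)).prod (volume.restrict (Set.Ioo (-Real.pi) Real.pi)) := by
    rw [hS, Measure.volume_eq_prod, Measure.prod_restrict]
  have hAint : ∫ q in S, A q = -(2 * Real.pi * φ 0) := by
    rw [hvol, integral_prod_symm _ (by rw [← hvol]; exact hAi)]
    have : ∀ θ : ℝ, ∫ r in Set.Ioi (0 : ℝ), A (r, θ) = -φ 0 := fun θ => by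
      have hd : ∀ r : ℝ, HasDerivAt (fun r : ℝ => φ (r * e θ)) (A (r, θ)) r := fun r => by
        have h1 : HasDerivAt (fun r : ℝ => (r : ℂ) * e θ) (e θ) r := by
          simpa using (Complex.ofRealCLM.hasDerivAt (x := r)).mul_const (e θ)
        exact (hφ.differentiable _).hasFDerivAt.comp_hasDerivAt r h1
      have hsm : ContDiff ℝ 1 (fun r : ℝ => φ (r * e θ)) :=
        (hφ.1.of_le (by exact_mod_cast le_top)).comp
          (Complex.ofRealCLM.contDiff.mul contDiff_const)
      have hcs : HasCompactSupport (fun r : ℝ => φ (r * e θ)) :=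
        HasCompactSupport.intro (isCompact_Icc (a := -T) (b := T)) fun r hr => by
          refine image_eq_zero_of_notMem_tsupport (hout r θ ?_)
          by_contra! hle
          exact hr (abs_le.1 hle)
      have := hcs.integral_Ioi_deriv_eq hsm 0
      simp only [fun r => (hd r).deriv] at this
      simpa using this
    simp only [this]
    rw [setIntegral_const, Measure.real, Real.volume_Ioo, ENNReal.toReal_ofReal
      (by linarith [Real.pi_pos]), smul_eq_mul]
    ring
  have hBint : ∫ q in S, B q = 0 := by
    rw [hvol, integral_prod _ (by rw [← hvol]; exact hBi)]
    refine integral_eq_zero_of_ae ?_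
    filter_upwards [ae_restrict_mem measurableSet_Ioi] with r (hr : 0 < r)
    have hd : ∀ θ : ℝ, HasDerivAt (fun θ : ℝ => φ (r * e θ)) (r * B (r, θ)) θ := fun θ => by
      have h1 : HasDerivAt (fun θ : ℝ => (r : ℂ) * e θ) ((r : ℂ) * (Complex.I * e θ)) θ :=
        (hed θ).const_mul _
      have := (hφ.differentiable (r * e θ)).hasFDerivAt.comp_hasDerivAt θ h1
      rw [← Complex.real_smul (x := r) (z := Complex.I * e θ), map_smul, smul_eq_mul] at this
      exact this
    have h2 := intervalIntegral.integral_eq_sub_of_hasDerivAt (a := -Real.pi) (b := Real.pi)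
      (fun θ _ => hd θ) (Continuous.intervalIntegrable (by fun_prop) _ _)
    rw [intervalIntegral.integral_const_mul, intervalIntegral.integral_of_le
      (by linarith [Real.pi_pos]), integral_Ioc_eq_integral_Ioo] at h2
    have h3 : e Real.pi = e (-Real.pi) := by simp [he]
    rw [h3, sub_self] at h2
    exact (mul_eq_zero.1 h2).resolve_left hr.ne'
  rw [← Complex.integral_comp_polarCoord_symm]
  have hcongr : ∀ q ∈ polarCoord.target, q.1 • (dbar φ (Complex.polarCoord.symm q)
      * (Complex.polarCoord.symm q)⁻¹) = (A q : ℂ) + Complex.I * (B q : ℂ) := by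
    rintro ⟨r, θ⟩ ⟨hr, -⟩
    have hr' : (r : ℂ) ≠ 0 := by exact_mod_cast (ne_of_gt hr)
    have he0 : e θ ≠ 0 := fun h => by simpa [h] using hen θ
    have h1 : dbar φ (r * e θ) = ((A (r, θ) : ℂ) + Complex.I * (B (r, θ) : ℂ)) * e θ := by
      simp only [hA, hB, dbar]
      rw [fderiv_apply_eq φ _ (e θ), fderiv_apply_eq φ _ (Complex.I * e θ)]
      have hcs : ((Real.cos θ : ℂ)) ^ 2 + (Real.sin θ : ℂ) ^ 2 = 1 := by
        exact_mod_cast Real.cos_sq_add_sin_sq θ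
      have hre : (e θ).re = Real.cos θ := by simp [he, -Complex.ofReal_cos, -Complex.ofReal_sin]
      have him : (e θ).im = Real.sin θ := by simp [he, -Complex.ofReal_cos, -Complex.ofReal_sin]
      simp only [Complex.mul_re, Complex.mul_im, Complex.I_re, Complex.I_im, zero_mul, one_mul,
        zero_sub, zero_add, hre, him]
      generalize (fderiv ℝ φ (r * e θ)) 1 = a
      generalize (fderiv ℝ φ (r * e θ)) Complex.I = b
      simp only [he]
      push_cast [-Complex.ofReal_cos, -Complex.ofReal_sin]
      generalize (Real.cos θ : ℂ) = c at *
      generalize (Real.sin θ : ℂ) = s at *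
      linear_combination (-(a : ℂ) - b * Complex.I) * hcs
        - (c * b * s - s ^ 2 * a) * Complex.I_mul_I
    rw [Complex.polarCoord_symm_apply]
    simp only
    rw [show (Real.cos θ : ℂ) + Real.sin θ * Complex.I = e θ from rfl, h1, Complex.real_smul]
    field_simp
  rw [setIntegral_congr_fun (μ := volume) (s := polarCoord.target) hSm hcongr,
    integral_add hAi.ofReal (hBi.ofReal.const_mul _), integral_const_mul, integral_complex_ofReal, integral_complex_ofReal]
  change ((∫ q in S, A q : ℝ) : ℂ) + Complex.I * ((∫ q in S, B q : ℝ) : ℂ) = _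
  rw [hAint, hBint]
  simp

lemma IsTest.integral_dbar_mul_inv {φ : ℂ → ℝ} (hφ : IsTest φ) (p : ℂ) :
    ∫ z, dbar φ z * (z - p)⁻¹ = ((-(2 * Real.pi * φ p) : ℝ) : ℂ) := by
  have hψ : IsTest (fun z => φ (z + p)) :=
    ⟨hφ.1.comp (contDiff_id.add contDiff_const),
      hφ.2.comp_homeomorph (Homeomorph.addRight p)⟩
  have h := hψ.integral_dbar_mul_inv_zero
  rw [zero_add] at h
  rw [← h, ← integral_add_right_eq_self _ p]
  simp [dbar, fderiv_comp_add_right]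

/-! ### Meromorphic functions with simple poles on a sublattice -/

/-- `f` is holomorphic off `Λ` and has a simple pole with residue one at each point of `Λ`. -/
def HasSimplePoles (Λ : Set ℂ) (f : ℂ → ℂ) : Prop :=
  DifferentiableOn ℂ f Λᶜ ∧ ∀ p ∈ Λ, ∃ h : ℂ → ℂ, DifferentiableOn ℂ h (Metric.ball p (1 / 2)) ∧
    ∀ z ∈ Metric.ball p (1 / 2), z ≠ p → f z = (z - p)⁻¹ + h z

/-- Bumps split `φ` into pieces around the finitely many relevant poles, where `1 / (z - p)` gives
`-2 π φ p` and the regular part nothing, and a remainder `ψ` supported where `f` is holomorphic. -/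
lemma HasSimplePoles.integral_dbar_mul {Λ : Set ℂ} (hΛ : Λ ⊆ latticeZ2) {f : ℂ → ℂ}
    (hf : HasSimplePoles Λ f) (hloc : LocallyIntegrable f volume) {φ : ℂ → ℝ} (hφ : IsTest φ) :
    ∫ z, dbar φ z * f z = ((-(2 * Real.pi * ∑' p : Λ, φ p) : ℝ) : ℂ) := by
  obtain ⟨T, hT, hTs⟩ := hφ.2.isBounded.subset_closedBall_lt 0 0
  obtain ⟨F, hF, -⟩ := exists_finset_points hΛ hT.le
  have hFΛ : ∀ p ∈ F, p ∈ Λ := fun p hp => ((hF p).1 hp).1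
  have hsum : ∑' p : Λ, φ p = ∑ p ∈ F, φ p :=
    tsum_subtype_eq_sum hFΛ fun p hp hpF => by
      refine image_eq_zero_of_notMem_tsupport fun hmem => hpF ((hF p).2 ⟨hp, ?_⟩)
      simpa using hTs hmem
  -- Within `1/8` of a pole its own bump equals one and all others vanish, so `ψ` is zero in a
  -- neighbourhood of every pole.
  let θ : ∀ p : ℂ, ContDiffBump p := fun p => ⟨1 / 8, 1 / 4, by norm_num, by norm_num⟩
  have hθφ : ∀ p ∈ F, IsTest (fun z => θ p z * φ z) := fun p _ => hφ.mul (θ p).contDiff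
  set ψ : ℂ → ℝ := fun z => φ z - ∑ p ∈ F, θ p z * φ z with hψdef
  have hsumt := IsTest.sum hθφ
  have hψ : IsTest ψ := hφ.sub hsumt
  have hθts : ∀ p, tsupport (fun z => θ p z * φ z) ⊆ Metric.ball p (1 / 2) := fun p =>
    (tsupport_mul_subset_left).trans (by
      rw [(θ p).tsupport_eq]
      exact Metric.closedBall_subset_ball (by norm_num))
  have hpart : ∀ p ∈ F, ∫ z, dbar (fun z => θ p z * φ z) z * f z
      = ((-(2 * Real.pi * φ p) : ℝ) : ℂ) := by
    intro p hp
    obtain ⟨h, hh, hfh⟩ := hf.2 p (hFΛ p hp)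
    have h1 := (hθφ p hp).integral_dbar_mul_inv p
    have h2 := (hθφ p hp).integral_dbar_mul_eq_zero Metric.isOpen_ball (hθts p) hh
    have hinv := locallyIntegrable_inv_sub p
    have hae : ∀ᵐ z : ℂ, dbar (fun z => θ p z * φ z) z * f z =
        dbar (fun z => θ p z * φ z) z * (z - p)⁻¹ + dbar (fun z => θ p z * φ z) z * h z := by
      filter_upwards [Measure.ae_ne volume p] with z hz
      by_cases hzt : z ∈ tsupport (fun z => θ p z * φ z)
      · rw [hfh z (hθts p hzt) hz, mul_add]
      · simp [dbar_eq_zero_of_notMem hzt]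
    have hi1 := (hθφ p hp).integrable_dbar_mul hinv
    -- Nothing is known about `h` outside the disc, so integrability is read off from the difference
    -- of the two other terms.
    have hi2 : Integrable (fun z => dbar (fun z => θ p z * φ z) z * h z) := by
      refine (((hθφ p hp).integrable_dbar_mul hloc).sub hi1).congr ?_
      filter_upwards [hae] with z hz
      simp only [Pi.sub_apply, hz, add_sub_cancel_left]
    rw [integral_congr_ae hae, integral_add hi1 hi2, h1, h2, add_zero,
      (θ p).one_of_mem_closedBall (by simp [θ]), one_mul]
  have hψts : tsupport ψ ⊆ Λᶜ := by
    intro z hz hzΛ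
    have hev : ψ =ᶠ[𝓝 z] 0 := by
      by_cases hzF : z ∈ F
      · filter_upwards [Metric.ball_mem_nhds z (show (0 : ℝ) < 1 / 8 by norm_num)] with w hw
        have hone : θ z w = 1 := (θ z).one_of_mem_closedBall (Metric.ball_subset_closedBall hw)
        simp only [hψdef, Pi.zero_apply]
        rw [Finset.sum_eq_single_of_mem z hzF, hone, one_mul, sub_self]
        intro q hq hqz
        have h0 : θ q w = 0 := by
          refine (θ q).zero_of_le_dist ?_
          by_contra! hlt
          exact hqz (eq_of_mem_lattice_of_dist_lt (hΛ (hFΛ q hq)) (hΛ hzΛ) hlt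
            (Metric.mem_ball.1 hw) (by simp [θ]; norm_num))
        rw [h0, zero_mul]
      · have hzt : z ∉ tsupport φ := fun h => hzF ((hF z).2 ⟨hzΛ, by simpa using hTs h⟩)
        filter_upwards [(isClosed_tsupport φ).isOpen_compl.mem_nhds hzt] with w hw
        simp [hψdef, image_eq_zero_of_notMem_tsupport hw]
    exact (notMem_tsupport_iff_eventuallyEq.2 hev) hz
  have h0 := hψ.integral_dbar_mul_eq_zero (isClosed_of_subset_lattice hΛ).isOpen_compl hψts hf.1
  have hdec : ∀ z, dbar φ z * f z = dbar ψ z * f z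
      + ∑ p ∈ F, dbar (fun z => θ p z * φ z) z * f z := fun z => by
    rw [hψdef, hφ.dbar_sub hsumt, IsTest.dbar_sum hθφ, ← Finset.sum_mul]
    ring
  simp_rw [hdec]
  rw [integral_add (hψ.integrable_dbar_mul hloc)
    (integrable_finsetSum _ fun p hp => (hθφ p hp).integrable_dbar_mul hloc), h0, zero_add,
    integral_finsetSum _ fun p hp => (hθφ p hp).integrable_dbar_mul hloc,
    Finset.sum_congr rfl hpart, hsum, Finset.mul_sum, ← Finset.sum_neg_distrib]
  push_cast
  rfl

/-! ### The cotangent field -/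

lemma aestronglyMeasurable_of_differentiableOn {Λ : Set ℂ} (hΛ : Λ ⊆ latticeZ2) {f : ℂ → ℂ}
    (hf : DifferentiableOn ℂ f Λᶜ) : AEStronglyMeasurable f volume := by
  have h := hf.continuousOn.aestronglyMeasurable (μ := volume)
    (isClosed_of_subset_lattice hΛ).measurableSet.compl
  rwa [Measure.restrict_eq_self_of_ae_mem] at h
  filter_upwards [ae_notMem_latticeZ2] with z hz using fun hz' => hz (hΛ hz')

/-- The function `π cot (π z)`. -/
def piCot (z : ℂ) : ℂ := Real.pi * Complex.cot (Real.pi * z)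

lemma piCot_eq_exp (z : ℂ) : piCot z = Real.pi *
    ((Complex.exp (2 * Real.pi * Complex.I * z) + 1) /
      (Complex.I * (1 - Complex.exp (2 * Real.pi * Complex.I * z)))) := by
  rw [piCot, Complex.cot_pi_eq_exp_ratio]

lemma piCot_add_int (z : ℂ) (n : ℤ) : piCot (z + n) = piCot z := by
  have : Complex.exp (2 * Real.pi * Complex.I * (z + n))
      = Complex.exp (2 * Real.pi * Complex.I * z) := by
    rw [show 2 * (Real.pi : ℂ) * Complex.I * (z + n)
      = 2 * Real.pi * Complex.I * z + n * (2 * Real.pi * Complex.I) by ring]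
    exact Complex.exp_periodic.int_mul n _
  rw [piCot_eq_exp, piCot_eq_exp, this]

lemma piCot_neg (z : ℂ) : piCot (-z) = -piCot z := by
  simp [piCot, Complex.cot, div_neg]

lemma sin_pi_mul_ne_zero_of_notMem {z : ℂ} (hz : z ∉ latticeZ) :
    Complex.sin (Real.pi * z) ≠ 0 := by
  intro h
  obtain ⟨k, hk⟩ := Complex.sin_eq_zero_iff.1 h
  refine hz ⟨k, ?_⟩
  have hpi : (Real.pi : ℂ) ≠ 0 := by exact_mod_cast Real.pi_ne_zero
  apply mul_left_cancel₀ hpi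
  rw [hk]; ring

lemma differentiableAt_piCot {z : ℂ} (hz : z ∉ latticeZ) : DifferentiableAt ℂ piCot z := by
  unfold piCot Complex.cot
  have := sin_pi_mul_ne_zero_of_notMem hz
  fun_prop (disch := assumption)

lemma notMem_latticeZ_of_im_ne_zero {z : ℂ} (hz : z.im ≠ 0) : z ∉ latticeZ := by
  rintro ⟨n, rfl⟩
  simp at hz

lemma notMem_latticeZ_of_norm_lt_one {z : ℂ} (h0 : z ≠ 0) (hz : ‖z‖ < 1) : z ∉ latticeZ := by
  intro h
  have h1 := one_le_dist_of_mem_lattice (latticeZ_subset h) (latticeZ_subset ⟨0, by simp⟩) h0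
  rw [dist_zero_right] at h1
  linarith

/-- Write `sin (π z) = z q(z)`, where `q` has no zero in the unit disc and `q 0 = π`. Then `N = π
cos (π z) - q` vanishes at the origin, and `π cot (π z) - 1 / z = (N / z) / q` extends
holomorphically. -/
lemma exists_piCot_eq_inv_add : ∃ h : ℂ → ℂ, DifferentiableOn ℂ h (Metric.ball 0 1) ∧
    ∀ z ∈ Metric.ball (0 : ℂ) 1, z ≠ 0 → piCot z = z⁻¹ + h z := by
  have hpi : (Real.pi : ℂ) ≠ 0 := by exact_mod_cast Real.pi_ne_zero
  have hball : Metric.ball (0 : ℂ) 1 ∈ 𝓝 (0 : ℂ) := Metric.ball_mem_nhds _ one_pos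
  set s : ℂ → ℂ := fun z => Complex.sin (Real.pi * z) with hs
  have hsd : HasDerivAt s Real.pi 0 := by
    have := ((hasDerivAt_id (0 : ℂ)).const_mul (Real.pi : ℂ)).csin
    simpa using this
  set q : ℂ → ℂ := dslope s 0 with hq
  have hqs : ∀ z, z * q z = s z := fun z => by
    have := sub_smul_dslope s 0 z
    simpa [hs] using this
  have hqd : DifferentiableOn ℂ q (Metric.ball 0 1) :=
    (Complex.differentiableOn_dslope hball).2 (by fun_prop)
  have hq0 : q 0 = Real.pi := by rw [hq, dslope_same, hsd.deriv]
  have hqne : ∀ z ∈ Metric.ball (0 : ℂ) 1, q z ≠ 0 := fun z hz h => by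
    by_cases h0 : z = 0
    · rw [h0, hq0] at h; exact hpi h
    · have := hqs z
      rw [h, mul_zero] at this
      exact sin_pi_mul_ne_zero_of_notMem
        (notMem_latticeZ_of_norm_lt_one h0 (by simpa using hz)) this.symm
  set N : ℂ → ℂ := fun z => Real.pi * Complex.cos (Real.pi * z) - q z with hN
  have hNd : DifferentiableOn ℂ N (Metric.ball 0 1) :=
    DifferentiableOn.sub (by fun_prop) hqd
  have hNs : ∀ z, z * dslope N 0 z = N z := fun z => by
    have := sub_smul_dslope N 0 z
    simpa [hN, hq0] using this
  refine ⟨fun z => dslope N 0 z / q z,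
    ((Complex.differentiableOn_dslope hball).2 hNd).div hqd hqne, fun z hz h0 => ?_⟩
  have h1 := hqs z
  have h2 := hNs z
  have h3 := hqne z hz
  have h4 : dslope N 0 z = N z / z := by rw [← h2]; field_simp
  beta_reduce
  rw [h4]
  simp only [piCot, Complex.cot]
  rw [show Complex.sin (Real.pi * z) = z * q z from h1.symm]
  simp only [hN]
  field_simp
  ring

/-- With `q = exp (2 π i z)` the sum equals `2 π q / (i (1 - q))`, and `‖q‖ ≤ 1/2` at this height.
The exponential approach to `∓ π i` is what makes the sum over rows converge. -/
lemma norm_piCot_add_le {z : ℂ} (hz : 1 / 4 ≤ z.im) :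
    ‖piCot z + Real.pi * Complex.I‖ ≤ 4 * Real.pi * Real.exp (-(2 * Real.pi * z.im)) := by
  set q := Complex.exp (2 * Real.pi * Complex.I * z) with hq
  have hqn : ‖q‖ = Real.exp (-(2 * Real.pi * z.im)) := by
    rw [hq, Complex.norm_exp]; simp
  have hpi := Real.pi_gt_three
  have hhalf : ‖q‖ ≤ 1 / 2 := by
    rw [hqn, Real.exp_neg]
    have : (2 : ℝ) ≤ Real.exp (2 * Real.pi * z.im) := by
      have := Real.add_one_le_exp (2 * Real.pi * z.im)
      nlinarith
    rw [one_div]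
    gcongr
  have h1q : 1 / 2 ≤ ‖1 - q‖ := by
    have := norm_sub_norm_le (1 : ℂ) q
    rw [norm_one] at this
    linarith
  have hne : 1 - q ≠ 0 := fun h => by rw [h, norm_zero] at h1q; linarith
  have : piCot z + Real.pi * Complex.I = Real.pi * (2 * q / (Complex.I * (1 - q))) := by
    rw [piCot_eq_exp, ← hq]
    have hI := Complex.I_ne_zero
    field_simp
    linear_combination (1 - q) * Complex.I_mul_I
  rw [this, norm_mul, norm_div, norm_mul, norm_mul, Complex.norm_I, one_mul, ← hqn,
    Complex.norm_real, Real.norm_of_nonneg Real.pi_pos.le, Complex.norm_ofNat]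
  have : 2 * ‖q‖ / ‖1 - q‖ ≤ 4 * ‖q‖ := by
    rw [div_le_iff₀ (by linarith)]
    nlinarith [norm_nonneg q]
  nlinarith

lemma norm_piCot_sub_le {z : ℂ} (hz : z.im ≤ -(1 / 4)) :
    ‖piCot z - Real.pi * Complex.I‖ ≤ 4 * Real.pi * Real.exp (2 * Real.pi * z.im) := by
  have h := norm_piCot_add_le (z := -z) (by rw [Complex.neg_im]; linarith)
  rw [piCot_neg, Complex.neg_im, ← norm_neg] at h
  have e1 : -(-piCot z + Real.pi * Complex.I) = piCot z - Real.pi * Complex.I := by ring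
  have e2 : -(2 * Real.pi * -z.im) = 2 * Real.pi * z.im := by ring
  rwa [e1, e2] at h

lemma norm_piCot_le_of_one_le_abs_im {z : ℂ} (hz : 1 ≤ |z.im|) : ‖piCot z‖ ≤ 5 * Real.pi := by
  have hI : ‖(Real.pi : ℂ) * Complex.I‖ = Real.pi := by
    rw [norm_mul, Complex.norm_I, mul_one, Complex.norm_real, Real.norm_of_nonneg Real.pi_pos.le]
  have hpi := Real.pi_pos
  rcases le_abs.1 hz with h | h
  · have h1 := norm_piCot_add_le (z := z) (by linarith)
    have h2 : Real.exp (-(2 * Real.pi * z.im)) ≤ 1 := Real.exp_le_one_iff.2 (by nlinarith)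
    have h3 := norm_sub_le (piCot z + Real.pi * Complex.I) (Real.pi * Complex.I)
    rw [add_sub_cancel_right, hI] at h3
    nlinarith
  · have h1 := norm_piCot_sub_le (z := z) (by linarith)
    have h2 : Real.exp (2 * Real.pi * z.im) ≤ 1 := Real.exp_le_one_iff.2 (by nlinarith)
    have h3 := norm_add_le (piCot z - Real.pi * Complex.I) (Real.pi * Complex.I)
    rw [sub_add_cancel, hI] at h3
    nlinarith

lemma hasSimplePoles_piCot : HasSimplePoles latticeZ piCot := by
  refine ⟨fun z hz => (differentiableAt_piCot hz).differentiableWithinAt, ?_⟩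
  rintro p ⟨n, rfl⟩
  obtain ⟨h, hh, heq⟩ := exists_piCot_eq_inv_add
  have hmem : ∀ z ∈ Metric.ball (n : ℂ) (1 / 2), z - n ∈ Metric.ball (0 : ℂ) 1 := fun z hz => by
    rw [mem_ball_zero_iff, ← dist_eq_norm]
    exact (Metric.mem_ball.1 hz).trans (by norm_num)
  refine ⟨fun z => h (z - n), hh.comp (by fun_prop) hmem, fun z hz hzn => ?_⟩
  have h1 := piCot_add_int (z - n) n
  rw [sub_add_cancel] at h1
  rw [h1, heq _ (hmem z hz) (sub_ne_zero.2 hzn)]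

lemma isCompact_rectangle_diff_ball (a : ℝ) : IsCompact
    {w : ℂ | |w.re| ≤ 1 / 2 ∧ |w.im| ≤ a ∧ 1 / 4 ≤ ‖w‖} := by
  refine Metric.isCompact_of_isClosed_isBounded ?_ ?_
  · have h1 : IsClosed {w : ℂ | |w.re| ≤ 1 / 2} := isClosed_le (by fun_prop) (by fun_prop)
    have h2 : IsClosed {w : ℂ | |w.im| ≤ a} := isClosed_le (by fun_prop) (by fun_prop)
    have h3 : IsClosed {w : ℂ | 1 / 4 ≤ ‖w‖} := isClosed_le (by fun_prop) (by fun_prop)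
    exact h1.inter (h2.inter h3)
  · refine (Metric.isBounded_closedBall (x := (0 : ℂ)) (r := 1 / 2 + a)).subset fun w hw => ?_
    rw [mem_closedBall_zero_iff]
    exact (Complex.norm_le_abs_re_add_abs_im w).trans (add_le_add hw.1 hw.2.1)

lemma notMem_latticeZ_of_abs_re_le {w : ℂ} (h : |w.re| ≤ 1 / 2) (h0 : w ≠ 0) : w ∉ latticeZ := by
  rintro ⟨n, rfl⟩
  have h1 : |(n : ℝ)| ≤ 1 / 2 := by simpa using h
  have h2 : n ≠ 0 := fun hn => h0 (by simp [hn])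
  have h3 : (1 : ℝ) ≤ |(n : ℝ)| := by exact_mod_cast Int.one_le_abs h2
  linarith

/-- By periodicity it suffices to consider `|Re z| ≤ 1/2`: compactness handles bounded height, and
the limits `∓ π i` handle the rest. -/
lemma hasPoleBounds_piCot : HasPoleBounds latticeZ piCot := by
  refine ⟨aestronglyMeasurable_of_differentiableOn latticeZ_subset hasSimplePoles_piCot.1, ?_⟩
  obtain ⟨h, hh, heq⟩ := exists_piCot_eq_inv_add
  obtain ⟨C₁, hC₁⟩ := (isCompact_closedBall (0 : ℂ) (1 / 2)).exists_bound_of_continuousOn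
    (hh.continuousOn.mono (Metric.closedBall_subset_ball (by norm_num)))
  have hcont : ContinuousOn piCot {w : ℂ | |w.re| ≤ 1 / 2 ∧ |w.im| ≤ 1 ∧ 1 / 4 ≤ ‖w‖} := by
    intro w hw
    refine (differentiableAt_piCot (notMem_latticeZ_of_abs_re_le hw.1 ?_)).continuousAt.continuousWithinAt
    rintro rfl
    have := hw.2.2
    norm_num at this
  obtain ⟨C₂, hC₂⟩ := (isCompact_rectangle_diff_ball 1).exists_bound_of_continuousOn hcont
  refine ⟨max (max C₁ C₂) (5 * Real.pi), by positivity, fun z hz => ⟨?_, fun hfar => ?_⟩⟩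
  · rintro p ⟨n, rfl⟩ hzp
    have hzn : z - n ≠ 0 := fun h0 => hz (by
      rw [sub_eq_zero.1 h0]; exact latticeZ_subset ⟨n, rfl⟩)
    rw [dist_eq_norm] at hzp
    have h1 := piCot_add_int (z - n) n
    rw [sub_add_cancel] at h1
    rw [h1, heq _ (by rw [mem_ball_zero_iff]; linarith) hzn, add_sub_cancel_left]
    refine (hC₁ _ ?_).trans ((le_max_left _ _).trans (le_max_left _ _))
    rw [mem_closedBall_zero_iff]; linarith
  · set n := round z.re with hn
    have h1 := piCot_add_int (z - n) n
    rw [sub_add_cancel] at h1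
    have hre : |(z - n).re| ≤ 1 / 2 := by
      simpa using abs_sub_round z.re
    by_cases him : |z.im| ≤ 1
    · rw [h1]
      refine (hC₂ (z - n) ⟨hre, by simpa using him, ?_⟩).trans
        ((le_max_right _ _).trans (le_max_left _ _))
      rw [← dist_eq_norm]
      exact hfar n ⟨n, rfl⟩
    · exact (norm_piCot_le_of_one_le_abs_im (not_le.1 him).le).trans (le_max_right _ _)

/-! ### The field of the square lattice -/

/-- The contribution of the two rows at heights `±k`. -/
def rowPair (k : ℕ) (z : ℂ) : ℂ := piCot (z - k * Complex.I) + piCot (z + k * Complex.I)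

/-- The row above contributes nearly `π i` and the row below nearly `-π i`; pairing them cancels
these constants, without which the series would diverge. -/
lemma norm_rowPair_le {k : ℕ} {z : ℂ} {a : ℝ} (hz : |z.im| ≤ a) (hk : a + 1 / 4 ≤ k) :
    ‖rowPair k z‖ ≤ 8 * Real.pi * Real.exp (2 * Real.pi * a) * Real.exp (-(2 * Real.pi)) ^ k := by
  obtain ⟨h1, h2⟩ := abs_le.1 hz
  have hpi := Real.pi_pos
  have b1 := norm_piCot_sub_le (z := z - k * Complex.I) (by simp; linarith)
  have b2 := norm_piCot_add_le (z := z + k * Complex.I) (by simp; linarith)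
  have hE : Real.exp (2 * Real.pi * a) * Real.exp (-(2 * Real.pi)) ^ k
      = Real.exp (2 * Real.pi * (a - k)) := by
    rw [← Real.exp_nat_mul, ← Real.exp_add]
    congr 1; ring
  have e1 : Real.exp (2 * Real.pi * (z - k * Complex.I).im) ≤ Real.exp (2 * Real.pi * (a - k)) := by
    gcongr
    simp
    linarith
  have e2 : Real.exp (-(2 * Real.pi * (z + k * Complex.I).im))
      ≤ Real.exp (2 * Real.pi * (a - k)) := by
    rw [← mul_neg]
    gcongr
    simp
    linarith
  rw [mul_assoc, hE]
  have h3 := norm_add_le (piCot (z - k * Complex.I) - Real.pi * Complex.I)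
    (piCot (z + k * Complex.I) + Real.pi * Complex.I)
  have h4 : piCot (z - k * Complex.I) - Real.pi * Complex.I
    + (piCot (z + k * Complex.I) + Real.pi * Complex.I) = rowPair k z := by rw [rowPair]; ring
  rw [h4] at h3
  nlinarith

lemma summable_rowPair_bound (a : ℝ) : Summable fun k : ℕ =>
    8 * Real.pi * Real.exp (2 * Real.pi * a) * Real.exp (-(2 * Real.pi)) ^ (k + 1) := by
  refine Summable.mul_left _ ((summable_nat_add_iff 1).2
    (summable_geometric_of_lt_one (Real.exp_pos _).le ?_))
  rw [Real.exp_lt_one_iff]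
  linarith [Real.pi_pos]

lemma summable_rowPair (z : ℂ) : Summable fun k : ℕ => rowPair (k + 1) z := by
  refine Summable.of_norm_bounded_eventually_nat (summable_rowPair_bound |z.im|) ?_
  filter_upwards [eventually_ge_atTop ⌈|z.im|⌉₊] with k hk
  refine norm_rowPair_le le_rfl ?_
  have := Nat.ceil_le.1 hk
  push_cast
  linarith

/-- The sum of the contributions of all rows other than the one on the real axis. -/
def otherRows (z : ℂ) : ℂ := ∑' k : ℕ, rowPair (k + 1) z

/-- A function with simple poles at the points of the square lattice, obtained by adding up
`π cot (π (z - k i))` symmetrically over `k`. -/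
def latCot (z : ℂ) : ℂ := piCot z + otherRows z

lemma differentiableOn_otherRows : DifferentiableOn ℂ otherRows {z | |z.im| < 3 / 4} := by
  refine Complex.differentiableOn_tsum_of_summable_norm (summable_rowPair_bound (3 / 4)) ?_
    (isOpen_lt (by fun_prop) (by fun_prop)) fun k z hz => norm_rowPair_le (le_of_lt hz) ?_
  · intro k z hz
    obtain ⟨h1, h2⟩ := abs_lt.1 (show |z.im| < 3 / 4 from hz)
    have hk : (0 : ℝ) ≤ k := k.cast_nonneg
    have d1 : DifferentiableAt ℂ piCot (z - (k + 1 : ℕ) * Complex.I) :=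
      differentiableAt_piCot (notMem_latticeZ_of_im_ne_zero (by simp; linarith))
    have d2 : DifferentiableAt ℂ piCot (z + (k + 1 : ℕ) * Complex.I) :=
      differentiableAt_piCot (notMem_latticeZ_of_im_ne_zero (by simp; linarith))
    exact ((d1.comp z (f := fun z : ℂ => z - (k + 1 : ℕ) * Complex.I) (by fun_prop)).add
      (d2.comp z (f := fun z : ℂ => z + (k + 1 : ℕ) * Complex.I)
        (by fun_prop))).differentiableWithinAt
  · have hk : (0 : ℝ) ≤ k := k.cast_nonneg
    push_cast
    linarith

lemma latCot_add_int (z : ℂ) (n : ℤ) : latCot (z + n) = latCot z := by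
  have : ∀ k : ℕ, rowPair k (z + n) = rowPair k z := fun k => by
    rw [rowPair, rowPair, ← piCot_add_int (z - k * Complex.I) n,
      ← piCot_add_int (z + k * Complex.I) n]
    ring_nf
  simp only [latCot, otherRows, this, piCot_add_int]

lemma tendsto_piCot_add (z : ℂ) :
    Tendsto (fun K : ℕ => piCot (z + K * Complex.I)) atTop (𝓝 (-(Real.pi * Complex.I))) := by
  rw [tendsto_iff_norm_sub_tendsto_zero]
  have hlim : Tendsto (fun K : ℕ => 4 * Real.pi * Real.exp (-(2 * Real.pi * (z.im + K)))) atTop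
      (𝓝 0) := by
    rw [show (0 : ℝ) = 4 * Real.pi * 0 by ring]
    refine (Real.tendsto_exp_neg_atTop_nhds_zero.comp ?_).const_mul _
    exact (tendsto_atTop_add_const_left _ _ tendsto_natCast_atTop_atTop).const_mul_atTop
      (by positivity)
  refine squeeze_zero' (Eventually.of_forall fun _ => norm_nonneg _) ?_ hlim
  filter_upwards [eventually_ge_atTop ⌈1 / 4 - z.im⌉₊] with K hK
  have := Nat.ceil_le.1 hK
  have h := norm_piCot_add_le (z := z + K * Complex.I) (by simp; linarith)
  simpa using h

lemma tendsto_piCot_sub (z : ℂ) :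
    Tendsto (fun K : ℕ => piCot (z - K * Complex.I)) atTop (𝓝 (Real.pi * Complex.I)) := by
  have h := (tendsto_piCot_add (-z)).neg
  rw [neg_neg] at h
  refine h.congr fun K => ?_
  rw [← piCot_neg]
  congr 1
  ring

/-- Shifting a symmetric partial sum by one row telescopes to the two extreme rows, whose limits are
`-π i` and `π i`. -/
lemma latCot_add_I (z : ℂ) : latCot (z + Complex.I) = latCot z - 2 * Real.pi * Complex.I := by
  set P : ℕ → ℂ → ℂ := fun K z => piCot z + ∑ k ∈ Finset.range K, rowPair (k + 1) z with hP
  have hlim : ∀ z, Tendsto (fun K => P K z) atTop (𝓝 (latCot z)) := fun z =>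
    ((summable_rowPair z).hasSum.tendsto_sum_nat).const_add _
  have htel : ∀ K : ℕ, P K (z + Complex.I) - P K z
      = piCot (z + Complex.I + K * Complex.I) - piCot (z - K * Complex.I) := by
    intro K
    induction K with
    | zero => simp [hP]
    | succ K ih =>
      have h1 : ∀ z, P (K + 1) z = P K z + rowPair (K + 1) z := fun z => by
        simp only [hP, Finset.sum_range_succ]; ring
      have e1 : z + Complex.I - ((K + 1 : ℕ) : ℂ) * Complex.I = z - K * Complex.I := by
        push_cast; ring
      have e2 : z + ((K + 1 : ℕ) : ℂ) * Complex.I = z + Complex.I + K * Complex.I := by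
        push_cast; ring
      rw [h1, h1, add_sub_add_comm, ih, rowPair, rowPair, e1, e2]
      ring
  have h1 := ((hlim (z + Complex.I)).sub (hlim z)).congr htel
  have h2 := tendsto_nhds_unique h1 ((tendsto_piCot_add (z + Complex.I)).sub (tendsto_piCot_sub z))
  linear_combination h2

lemma latCot_add_int_mul_I (z : ℂ) (n : ℤ) :
    latCot (z + n * Complex.I) = latCot z - 2 * Real.pi * Complex.I * n := by
  induction n using Int.induction_on with
  | zero => simp
  | succ n ih =>
    have := latCot_add_I (z + (n : ℤ) * Complex.I)
    push_cast at this ih ⊢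
    rw [show z + ((n : ℂ) + 1) * Complex.I = z + n * Complex.I + Complex.I by ring, this, ih]
    ring
  | pred n ih =>
    have := latCot_add_I (z + (-(n : ℤ) - 1 : ℤ) * Complex.I)
    push_cast at this ih ⊢
    rw [show z + (-(n : ℂ) - 1) * Complex.I + Complex.I = z + -n * Complex.I by ring, ih] at this
    linear_combination -this

lemma differentiableAt_latCot {z : ℂ} (hz : |z.im| < 3 / 4) (hz' : z ∉ latticeZ) :
    DifferentiableAt ℂ latCot z :=
  (differentiableAt_piCot hz').add (differentiableOn_otherRows.differentiableAt
    ((isOpen_lt (by fun_prop) (by fun_prop)).mem_nhds hz))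

/-- The series is controlled in the strip `|Im z| < 3/4`; quasi-periodicity carries holomorphy and
the pole structure to the whole plane. -/
lemma hasSimplePoles_latCot : HasSimplePoles latticeZ2 latCot := by
  constructor
  · intro z hz
    set n := round z.im with hn
    have him : |(z - n * Complex.I).im| < 3 / 4 := by
      have := abs_sub_round z.im
      simp only [Complex.sub_im, Complex.mul_im, Complex.intCast_re, Complex.I_im, mul_one,
        Complex.intCast_im, Complex.I_re, mul_zero, add_zero]
      exact this.trans_lt (by norm_num)
    have hnot : z - n * Complex.I ∉ latticeZ := by
      rintro ⟨m, hm⟩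
      exact hz ⟨m, n, by rw [← hm]; ring⟩
    have heq : latCot = fun w => latCot (w - n * Complex.I) - 2 * Real.pi * Complex.I * n := by
      funext w
      rw [← latCot_add_int_mul_I, sub_add_cancel]
    rw [heq]
    exact (((differentiableAt_latCot him hnot).comp z (f := fun w : ℂ => w - n * Complex.I)
      (by fun_prop)).sub_const _).differentiableWithinAt
  · rintro p ⟨a, b, rfl⟩
    obtain ⟨h, hh, heq⟩ := exists_piCot_eq_inv_add
    set p : ℂ := a + b * Complex.I with hp
    have hmem : ∀ z ∈ Metric.ball p (1 / 2), ‖z - p‖ < 1 / 2 := fun z hz => by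
      rw [← dist_eq_norm]; exact hz
    refine ⟨fun z => h (z - p) + otherRows (z - p) - 2 * Real.pi * Complex.I * b, ?_, ?_⟩
    · refine DifferentiableOn.sub_const (DifferentiableOn.add ?_ ?_) _
      · exact hh.comp (by fun_prop) fun z hz => by
          rw [mem_ball_zero_iff]; linarith [hmem z hz]
      · exact differentiableOn_otherRows.comp (by fun_prop) fun z hz =>
          (Complex.abs_im_le_norm _).trans_lt (by linarith [hmem z hz])
    · intro z hz hzp
      have h1 : latCot z = latCot (z - p) - 2 * Real.pi * Complex.I * b := by
        rw [← latCot_add_int_mul_I, ← latCot_add_int (z - p + b * Complex.I) a]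
        congr 1
        rw [hp]; ring
      rw [h1, latCot, heq (z - p) (by rw [mem_ball_zero_iff]; linarith [hmem z hz])
        (sub_ne_zero.2 hzp)]
      ring

/-- The doubly periodic function `latCot z + 2 π i Im z`. -/
def latField (z : ℂ) : ℂ := latCot z + 2 * Real.pi * Complex.I * z.im

lemma latField_sub (z : ℂ) (a b : ℤ) : latField (z - (a + b * Complex.I)) = latField z := by
  have h1 : latCot z = latCot (z - (a + b * Complex.I)) - 2 * Real.pi * Complex.I * b := by
    rw [← latCot_add_int_mul_I, ← latCot_add_int (z - (a + b * Complex.I) + b * Complex.I) a]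
    congr 1
    ring
  rw [latField, latField, h1]
  simp
  ring

lemma hasPoleBounds_latField : HasPoleBounds latticeZ2 latField := by
  have hm := aestronglyMeasurable_of_differentiableOn subset_rfl hasSimplePoles_latCot.1
  have hlin : Continuous fun z : ℂ => 2 * Real.pi * Complex.I * (z.im : ℂ) := by fun_prop
  refine ⟨hm.add hlin.aestronglyMeasurable, ?_⟩
  obtain ⟨h, hh, heq⟩ := exists_piCot_eq_inv_add
  have hoth : ContinuousOn otherRows (Metric.closedBall 0 (1 / 2)) :=
    differentiableOn_otherRows.continuousOn.mono fun z hz =>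
      (Complex.abs_im_le_norm _).trans_lt (by rw [mem_closedBall_zero_iff] at hz; linarith)
  obtain ⟨C₁, hC₁⟩ := (isCompact_closedBall (0 : ℂ) (1 / 2)).exists_bound_of_continuousOn
    (((hh.continuousOn.mono (Metric.closedBall_subset_ball (by norm_num))).add hoth).add
      hlin.continuousOn)
  have hcont : ContinuousOn latField {w : ℂ | |w.re| ≤ 1 / 2 ∧ |w.im| ≤ 1 / 2 ∧ 1 / 4 ≤ ‖w‖} := by
    refine ContinuousOn.add (fun w hw => ?_) hlin.continuousOn
    refine (differentiableAt_latCot (hw.2.1.trans_lt (by norm_num))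
      (notMem_latticeZ_of_abs_re_le hw.1 ?_)).continuousAt.continuousWithinAt
    rintro rfl
    have := hw.2.2
    norm_num at this
  obtain ⟨C₂, hC₂⟩ := (isCompact_rectangle_diff_ball (1 / 2)).exists_bound_of_continuousOn hcont
  refine ⟨max (max C₁ C₂) 0, le_max_right _ _, fun z hz => ⟨?_, fun hfar => ?_⟩⟩
  · rintro p ⟨a, b, rfl⟩ hzp
    rw [← latField_sub z a b]
    set p : ℂ := a + b * Complex.I with hp
    have hzn : z - p ≠ 0 := fun h0 => hz (by
      rw [sub_eq_zero.1 h0]; exact ⟨a, b, rfl⟩)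
    rw [dist_eq_norm] at hzp
    rw [latField, latCot, heq _ (by rw [mem_ball_zero_iff]; linarith) hzn]
    have := hC₁ (z - p) (by rw [mem_closedBall_zero_iff]; linarith)
    refine le_trans (le_of_eq ?_) (this.trans ((le_max_left _ _).trans (le_max_left _ _)))
    congr 1
    simp only [Pi.add_apply]
    ring
  · rw [← latField_sub z (round z.re) (round z.im)]
    refine (hC₂ _ ⟨?_, ?_, ?_⟩).trans ((le_max_right _ _).trans (le_max_left _ _))
    · simpa using abs_sub_round z.re
    · simpa using abs_sub_round z.im
    · rw [← dist_eq_norm]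
      exact hfar _ ⟨_, _, rfl⟩

/-! ### The divergence and curl equations -/

@[simp] lemma conjField_conjField (j : ℂ → ℂ) : conjField (conjField j) = j := by
  funext z
  simp [conjField]

lemma IsTest.integrable_fderiv_apply {φ : ℂ → ℝ} (hφ : IsTest φ) {j : ℂ → ℂ}
    (hj : LocallyIntegrable j volume) : Integrable (fun z => fderiv ℝ φ z (j z)) := by
  have h := hφ.integrable_dbar_mul (locallyIntegrable_conjField hj)
  refine h.re.neg.congr (Eventually.of_forall fun z => ?_)
  have := fderiv_conjField φ (conjField j) z
  rw [conjField_conjField] at this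
  simp [this]

lemma LocallyIntegrable.I_mul {j : ℂ → ℂ} (hj : LocallyIntegrable j volume) :
    LocallyIntegrable (fun z => Complex.I * j z) volume := by
  rw [locallyIntegrable_iff] at hj ⊢
  intro K hK
  exact Integrable.const_mul (hj K hK) _

lemma divEquation_and_curlFree {Λ : Set ℂ} {m : ℝ} {f : ℂ → ℂ}
    (hloc : LocallyIntegrable f volume)
    (h : ∀ φ, IsTest φ → ∫ z, dbar φ z * f z
      = ((-(2 * Real.pi * ((∑' p : Λ, φ p) - m * ∫ z, φ z)) : ℝ) : ℂ)) :
    DivEquation Λ m (conjField f) ∧ CurlFree (conjField f) := by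
  constructor
  · intro φ hφ
    have h1 := Complex.reCLM.integral_comp_comm (hφ.integrable_dbar_mul hloc)
    simp only [Complex.reCLM_apply] at h1
    simp_rw [fderiv_conjField]
    rw [integral_neg, h1, h φ hφ, Complex.ofReal_re, neg_neg]
  · intro φ hφ
    have h1 := Complex.imCLM.integral_comp_comm (hφ.integrable_dbar_mul hloc)
    simp only [Complex.imCLM_apply] at h1
    simp_rw [fderiv_I_mul_conjField]
    rw [integral_neg, h1, h φ hφ, Complex.ofReal_im, neg_zero]

lemma IsTest.exists_finset_points {φ : ℂ → ℝ} (hφ : IsTest φ) {Λ : Set ℂ} (hΛ : Λ ⊆ latticeZ2) :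
    ∃ F : Finset ℂ, (∀ p ∈ F, p ∈ Λ) ∧ ∀ p ∈ Λ, p ∉ F → φ p = 0 := by
  obtain ⟨T, hT, hTs⟩ := hφ.2.isBounded.subset_closedBall_lt 0 0
  obtain ⟨F, hF, -⟩ := RenormalizedEnergy.exists_finset_points hΛ hT.le
  refine ⟨F, fun p hp => ((hF p).1 hp).1, fun p hp hpF => ?_⟩
  refine image_eq_zero_of_notMem_tsupport fun hmem => hpF ((hF p).2 ⟨hp, ?_⟩)
  simpa using hTs hmem

lemma IsTest.tsum_diff {φ : ℂ → ℝ} (hφ : IsTest φ) {Λ Λ' : Set ℂ} (hΛ : Λ ⊆ latticeZ2)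
    (hΛ' : Λ' ⊆ Λ) :
    ∑' p : (Λ \ Λ' : Set ℂ), φ p = (∑' p : Λ, φ p) - ∑' p : Λ', φ p := by
  classical
  obtain ⟨F, hF, hF0⟩ := hφ.exists_finset_points hΛ
  rw [tsum_subtype_eq_sum hF hF0,
    tsum_subtype_eq_sum (Λ := Λ') (F := F.filter (· ∈ Λ'))
      (fun p hp => (Finset.mem_filter.1 hp).2)
      (fun p hp hpF => hF0 p (hΛ' hp) fun h => hpF (Finset.mem_filter.2 ⟨h, hp⟩)),
    tsum_subtype_eq_sum (Λ := Λ \ Λ') (F := F.filter (· ∉ Λ'))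
      (fun p hp => ⟨hF p (Finset.mem_filter.1 hp).1, (Finset.mem_filter.1 hp).2⟩)
      (fun p hp hpF => hF0 p hp.1 fun h => hpF (Finset.mem_filter.2 ⟨h, hp.2⟩)),
    ← Finset.sum_filter_add_sum_filter_not F (· ∈ Λ'), add_sub_cancel_left]

lemma DivEquation.sub {Λ Λ' : Set ℂ} {m m' : ℝ} {j k : ℂ → ℂ} (hΛ : Λ ⊆ latticeZ2)
    (hΛ' : Λ' ⊆ Λ) (hj : LocallyIntegrable j volume) (hk : LocallyIntegrable k volume)
    (h : DivEquation Λ m j) (h' : DivEquation Λ' m' k) :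
    DivEquation (Λ \ Λ') (m - m') (fun z => j z - k z) := by
  intro φ hφ
  simp_rw [map_sub]
  rw [integral_sub (hφ.integrable_fderiv_apply hj) (hφ.integrable_fderiv_apply hk), h φ hφ,
    h' φ hφ, hφ.tsum_diff hΛ hΛ']
  ring

lemma CurlFree.sub {j k : ℂ → ℂ} (hj : LocallyIntegrable j volume)
    (hk : LocallyIntegrable k volume) (h : CurlFree j) (h' : CurlFree k) :
    CurlFree (fun z => j z - k z) := by
  intro φ hφ
  simp_rw [mul_sub, map_sub]
  rw [integral_sub (hφ.integrable_fderiv_apply (LocallyIntegrable.I_mul hj))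
    (hφ.integrable_fderiv_apply (LocallyIntegrable.I_mul hk)), h φ hφ, h' φ hφ, sub_zero]

lemma conjField_sub (f g : ℂ → ℂ) :
    conjField (fun z => f z - g z) = fun z => conjField f z - conjField g z := by
  funext z
  simp [conjField]
  ring

lemma divEquation_and_curlFree_piCot :
    DivEquation latticeZ 0 (conjField piCot) ∧ CurlFree (conjField piCot) := by
  have hloc := hasPoleBounds_piCot.locallyIntegrable latticeZ_subset
  refine divEquation_and_curlFree hloc fun φ hφ => ?_
  rw [hasSimplePoles_piCot.integral_dbar_mul latticeZ_subset hloc hφ]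
  simp

lemma divEquation_and_curlFree_latField :
    DivEquation latticeZ2 1 (conjField latField) ∧ CurlFree (conjField latField) := by
  have hloc := hasPoleBounds_latField.locallyIntegrable subset_rfl
  refine divEquation_and_curlFree hloc fun φ hφ => ?_
  have hlin : LocallyIntegrable (fun z : ℂ => 2 * Real.pi * Complex.I * (z.im : ℂ)) volume :=
    Continuous.locallyIntegrable (by fun_prop)
  have hcot : LocallyIntegrable latCot volume := by
    refine (hloc.sub hlin).congr (Eventually.of_forall fun z => ?_)
    simp [latField]
  simp_rw [latField, mul_add]
  rw [integral_add (hφ.integrable_dbar_mul hcot) (hφ.integrable_dbar_mul hlin),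
    hasSimplePoles_latCot.integral_dbar_mul subset_rfl hcot hφ, hφ.integral_dbar_mul_im]
  push_cast
  ring

/-! ### The half-plane field -/

/-- The function `π cot (π z)` in the half-plane `Re z > 1/2`, extended by zero. -/
def halfCot : ℂ → ℂ := {z : ℂ | 1 / 2 < z.re}.indicator piCot

lemma measurableSet_half : MeasurableSet {z : ℂ | 1 / 2 < z.re} :=
  (isOpen_lt continuous_const Complex.continuous_re).measurableSet

lemma mem_latticeN_of_half_lt {n : ℤ} (h : (0 : ℝ) < n) : (n : ℂ) ∈ latticeN := by
  have h0 : 0 < n := by exact_mod_cast h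
  refine ⟨n.toNat, by omega, ?_⟩
  have : ((n.toNat : ℤ) : ℂ) = (n : ℂ) := by rw [Int.toNat_of_nonneg h0.le]
  exact_mod_cast this.symm

/-- The line `Re z = 1/2` stays at distance `1/2` from the integers, so the cut meets no disc of
radius `1/4` around a pole. -/
lemma hasPoleBounds_halfCot : HasPoleBounds latticeN halfCot := by
  obtain ⟨hm, C, hC, h⟩ := hasPoleBounds_piCot
  refine ⟨hm.indicator measurableSet_half, C, hC, fun z hz => ⟨fun p hp hzp => ?_, fun hfar => ?_⟩⟩
  · have hmem : z ∈ {z : ℂ | 1 / 2 < z.re} := by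
      obtain ⟨n, hn, rfl⟩ := hp
      have h1 := (Complex.abs_re_le_norm (z - n)).trans_lt (by rwa [← dist_eq_norm])
      rw [Complex.sub_re, Complex.natCast_re, abs_lt] at h1
      have h2 : (1 : ℝ) ≤ n := by exact_mod_cast hn
      show 1 / 2 < z.re
      linarith
    rw [halfCot, Set.indicator_of_mem hmem]
    exact (h z hz).1 p (latticeN_subset hp) hzp
  · by_cases hmem : z ∈ {z : ℂ | 1 / 2 < z.re}
    · rw [halfCot, Set.indicator_of_mem hmem]
      refine (h z hz).2 fun q hq => ?_
      by_contra! hlt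
      obtain ⟨n, rfl⟩ := hq
      refine absurd hlt (not_lt.2 (hfar n (mem_latticeN_of_half_lt ?_)))
      have h1 := (Complex.abs_re_le_norm (z - n)).trans_lt (by rwa [← dist_eq_norm])
      rw [Complex.sub_re, Complex.intCast_re, abs_lt] at h1
      have h2 : 1 / 2 < z.re := hmem
      linarith
    · rw [halfCot, Set.indicator_of_notMem hmem, norm_zero]
      exact hC

/-- By symmetry, the horizontal component of the cotangent field vanishes on `Re z = 1/2`. -/
lemma abs_re_piCot_le (z : ℂ) :
    |(piCot z).re| ≤ |z.re - 1 / 2| * (2 * Real.pi ^ 2 + 4 * ‖piCot z‖) := by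
  have hpi := Real.pi_pos
  by_cases hz : |z.re - 1 / 2| ≤ 1 / 4
  · set a := Real.pi * z.re with ha
    set b := Real.pi * z.im with hb
    have hsin : 1 / 2 ≤ Real.sin a := by
      have h1 : Real.sin a = Real.cos (Real.pi * |z.re - 1 / 2|) := by
        rw [← Real.cos_abs (Real.pi * |z.re - 1 / 2|), abs_mul, abs_abs, ← abs_mul, Real.cos_abs,
          ← Real.cos_sub_pi_div_two]
        congr 1
        rw [ha]; ring
      rw [h1]
      refine Real.cos_pi_div_three.symm.le.trans ?_
      refine Real.cos_le_cos_of_nonneg_of_le_pi (by positivity) (by linarith) ?_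
      nlinarith
    have hcos : |Real.cos a| ≤ Real.pi * |z.re - 1 / 2| := by
      have h1 : Real.cos a = -Real.sin (Real.pi * (z.re - 1 / 2)) := by
        rw [← Real.cos_add_pi_div_two]
        congr 1
        rw [ha]; ring
      rw [h1, abs_neg]
      refine Real.abs_sin_le_abs.trans ?_
      rw [abs_mul, abs_of_pos hpi]
    have hzw : (Real.pi : ℂ) * z = (a : ℂ) + (b : ℂ) * Complex.I := by
      conv_lhs => rw [← Complex.re_add_im z]
      rw [ha, hb]; push_cast; ring
    have hre : (piCot z).re = Real.pi * (Real.sin a * Real.cos a /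
        (Real.sin a ^ 2 * Real.cosh b ^ 2 + Real.cos a ^ 2 * Real.sinh b ^ 2)) := by
      rw [piCot, Complex.re_ofReal_mul, Complex.cot, hzw, Complex.sin_add_mul_I,
        Complex.cos_add_mul_I, Complex.div_re, ← add_div]
      have e1 : (Complex.cos a * Complex.cosh b - Complex.sin a * Complex.sinh b * Complex.I)
          = ⟨Real.cos a * Real.cosh b, -(Real.sin a * Real.sinh b)⟩ := by
        rw [← Complex.ofReal_cos, ← Complex.ofReal_cosh, ← Complex.ofReal_sin,
          ← Complex.ofReal_sinh]
        generalize Real.cos a = c, Real.sin a = s, Real.cosh b = C, Real.sinh b = S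
        apply Complex.ext <;> simp
      have e2 : (Complex.sin a * Complex.cosh b + Complex.cos a * Complex.sinh b * Complex.I)
          = ⟨Real.sin a * Real.cosh b, Real.cos a * Real.sinh b⟩ := by
        rw [← Complex.ofReal_cos, ← Complex.ofReal_cosh, ← Complex.ofReal_sin,
          ← Complex.ofReal_sinh]
        generalize Real.cos a = c, Real.sin a = s, Real.cosh b = C, Real.sinh b = S
        apply Complex.ext <;> simp
      rw [e1, e2, Complex.normSq_mk]
      congr 2
      · linear_combination Real.sin a * Real.cos a * Real.cosh_sq b
      · ring
    have hden : Real.sin a / 2 ≤ Real.sin a ^ 2 * Real.cosh b ^ 2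
        + Real.cos a ^ 2 * Real.sinh b ^ 2 := by
      have := Real.one_le_cosh b
      have h1 : 1 ≤ Real.cosh b ^ 2 := one_le_pow₀ this
      nlinarith [sq_nonneg (Real.cos a), sq_nonneg (Real.sinh b),
        mul_nonneg (sq_nonneg (Real.cos a)) (sq_nonneg (Real.sinh b))]
    have hspos : 0 < Real.sin a := by linarith
    rw [hre, abs_mul, abs_of_pos hpi, abs_div, abs_mul, abs_of_pos hspos,
      abs_of_pos (lt_of_lt_of_le (by positivity) hden)]
    have h2 : Real.sin a * |Real.cos a| / (Real.sin a ^ 2 * Real.cosh b ^ 2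
        + Real.cos a ^ 2 * Real.sinh b ^ 2) ≤ 2 * |Real.cos a| := by
      rw [div_le_iff₀ (lt_of_lt_of_le (by positivity) hden)]
      nlinarith [abs_nonneg (Real.cos a)]
    have h3 : 0 ≤ |z.re - 1 / 2| * ‖piCot z‖ := by positivity
    nlinarith
  -- Away from the line `4 |Re z - 1/2| > 1`, so the bound by the norm suffices.
  · push Not at hz
    have h1 := Complex.abs_re_le_norm (piCot z)
    have h2 : 0 ≤ |z.re - 1 / 2| * Real.pi ^ 2 := by positivity
    nlinarith [norm_nonneg (piCot z)]

lemma exists_mul_deriv_smoothTransition_le :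
    ∃ D : ℝ, ∀ t, |t| * |deriv Real.smoothTransition t| ≤ D := by
  have hc : Continuous (fun t : ℝ => |t| * |deriv Real.smoothTransition t|) :=
    continuous_abs.mul ((Real.smoothTransition.contDiff (n := 1)).continuous_deriv le_rfl).abs
  obtain ⟨D, hD⟩ := (isCompact_Icc (a := (0 : ℝ)) (b := 1)).exists_bound_of_continuousOn
    hc.continuousOn
  have hD0 : 0 ≤ D := (norm_nonneg _).trans (hD 0 (by simp))
  refine ⟨D, fun t => ?_⟩
  by_cases ht : t ∈ Set.Icc (0 : ℝ) 1
  · exact (le_abs_self _).trans (hD t ht)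
  · have : deriv Real.smoothTransition t = 0 := by
      rw [Set.mem_Icc, not_and_or, not_le, not_le] at ht
      rcases ht with ht | ht
      · have : Real.smoothTransition =ᶠ[𝓝 t] fun _ => 0 := by
          filter_upwards [Iio_mem_nhds ht] with s hs
          exact Real.smoothTransition.zero_of_nonpos (le_of_lt hs)
        rw [this.deriv_eq, deriv_const]
      · have : Real.smoothTransition =ᶠ[𝓝 t] fun _ => 1 := by
          filter_upwards [Ioi_mem_nhds ht] with s hs
          exact Real.smoothTransition.one_of_one_le (le_of_lt hs)
        rw [this.deriv_eq, deriv_const]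
    rw [this, abs_zero, mul_zero]
    exact hD0

/-- The full cotangent field is tested with `θ n * φ`, where `θ n` steepens to the indicator of the
half-plane. The term with the gradient of `θ n` involves only the horizontal component, whose linear
vanishing on `Re z = 1/2` offsets the slope `n + 1`; dominated convergence then removes it. -/
lemma divEquation_halfCot : DivEquation latticeN 0 (conjField halfCot) := by
  intro φ hφ
  have hloc := hasPoleBounds_piCot.locallyIntegrable latticeZ_subset
  have hlocj := locallyIntegrable_conjField hloc
  obtain ⟨D, hD⟩ := exists_mul_deriv_smoothTransition_le
  set τ := Real.smoothTransition with hτ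
  have hτs : ∀ t, HasDerivAt τ (deriv τ t) t := fun t =>
    ((Real.smoothTransition.contDiff (n := 1)).differentiable one_ne_zero t).hasDerivAt
  set θ : ℕ → ℂ → ℝ := fun n z => τ ((n + 1) * (z.re - 1 / 2)) with hθ
  have hθs : ∀ n, ContDiff ℝ (⊤ : ℕ∞) (θ n) := fun n =>
    Real.smoothTransition.contDiff.comp
      (contDiff_const.mul (Complex.reCLM.contDiff.sub contDiff_const))
  have hθ' : ∀ n z, HasFDerivAt (θ n)
      ((deriv τ ((n + 1) * (z.re - 1 / 2)) * (n + 1)) • Complex.reCLM) z := fun n z => by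
    have h1 : HasFDerivAt (fun z : ℂ => ((n : ℝ) + 1) * (z.re - 1 / 2))
        (((n : ℝ) + 1) • Complex.reCLM) z :=
      (Complex.reCLM.hasFDerivAt.sub_const _).const_mul _
    have := (hτs _).comp_hasFDerivAt z h1
    rwa [smul_smul] at this
  have hfd : ∀ n z w, fderiv ℝ (fun z => θ n z * φ z) z w
      = θ n z * fderiv ℝ φ z w
        + φ z * (deriv τ ((n + 1) * (z.re - 1 / 2)) * (n + 1)) * w.re := fun n z w => by
    rw [((hθ' n z).fun_mul (hφ.differentiable z).hasFDerivAt).fderiv]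
    simp
    ring
  -- The transition layer has width `1 / (n + 1) ≤ 1/2`, so `θ n` is already one at every positive
  -- integer and zero at the others.
  have hval : ∀ n : ℕ, 1 ≤ n → ∫ z, fderiv ℝ (fun z => θ n z * φ z) z (conjField piCot z)
      = 2 * Real.pi * ∑' p : latticeN, φ p := by
    intro n hn
    rw [divEquation_and_curlFree_piCot.1 _ (hφ.mul (hθs n))]
    obtain ⟨F, hF, hF0⟩ := hφ.exists_finset_points (latticeN_subset.trans latticeZ_subset)
    have hn' : (1 : ℝ) ≤ n := by exact_mod_cast hn
    rw [tsum_subtype_eq_sum hF hF0,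
      tsum_subtype_eq_sum (Λ := latticeZ) (φ := fun z => θ n z * φ z) (F := F)
        fun p hp => latticeN_subset (hF p hp)]
    · rw [zero_mul, sub_zero]
      congr 1
      refine Finset.sum_congr rfl fun p hp => ?_
      obtain ⟨k, hk, rfl⟩ := hF p hp
      have hk' : (1 : ℝ) ≤ k := by exact_mod_cast hk
      have : θ n k = 1 := Real.smoothTransition.one_of_one_le (by
        rw [Complex.natCast_re]; nlinarith)
      rw [this, one_mul]
    · rintro p ⟨k, rfl⟩ hp
      by_cases hk : (0 : ℝ) < k
      · rw [hF0 _ (mem_latticeN_of_half_lt hk) hp, mul_zero]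
      · have : θ n k = 0 := Real.smoothTransition.zero_of_nonpos (by
          rw [Complex.intCast_re]; nlinarith)
        rw [this, zero_mul]
  have hlim : Tendsto (fun n : ℕ => ∫ z, fderiv ℝ (fun z => θ n z * φ z) z (conjField piCot z))
      atTop (𝓝 (∫ z, fderiv ℝ φ z (conjField halfCot z))) := by
    have hne : ∀ᵐ z : ℂ, z.re ≠ 1 / 2 := by
      rw [ae_iff]
      simp only [ne_eq, not_not]
      have h1 : {z : ℂ | z.re = 1 / 2} = (Complex.measurableEquivRealProd) ⁻¹'
          ({(1 / 2 : ℝ)} ×ˢ Set.univ) := by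
        ext z; simp [Complex.measurableEquivRealProd_apply]
      rw [h1, Complex.volume_preserving_equiv_real_prod.measure_preimage_equiv,
        Measure.volume_eq_prod, Measure.prod_prod]
      simp
    refine tendsto_integral_of_dominated_convergence
      (fun z => |fderiv ℝ φ z (conjField piCot z)|
        + |φ z| * (D * (2 * Real.pi ^ 2 + 4 * ‖piCot z‖))) ?_ ?_ ?_ ?_
    · exact fun n => ((hφ.mul (hθs n)).integrable_fderiv_apply hlocj).aestronglyMeasurable
    · refine (hφ.integrable_fderiv_apply hlocj).abs.add ?_
      have h1 : LocallyIntegrable (fun z => D * (2 * Real.pi ^ 2 + 4 * ‖piCot z‖)) volume := by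
        rw [locallyIntegrable_iff] at hloc ⊢
        intro K hK
        exact ((integrableOn_const hK.measure_lt_top.ne).add
          ((Integrable.norm (hloc K hK)).const_mul 4)).const_mul D
      exact h1.integrable_smul_left_of_hasCompactSupport hφ.1.continuous.abs
        (hφ.2.comp_left abs_zero)
    · intro n
      refine Eventually.of_forall fun z => ?_
      rw [hfd]
      refine (norm_add_le _ _).trans (add_le_add ?_ ?_)
      · rw [norm_mul, Real.norm_of_nonneg (Real.smoothTransition.nonneg _)]
        exact mul_le_of_le_one_left (norm_nonneg _) (Real.smoothTransition.le_one _)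
      · have h1 : |(conjField piCot z).re| = |(piCot z).re| := by simp [conjField]
        have h2 := abs_re_piCot_le z
        have h3 := hD ((n + 1) * (z.re - 1 / 2))
        have hn0 : (0 : ℝ) ≤ n + 1 := by positivity
        rw [abs_mul, abs_of_nonneg hn0] at h3
        rw [Real.norm_eq_abs, abs_mul, abs_mul, abs_mul, h1, abs_of_nonneg hn0, mul_assoc]
        refine mul_le_mul_of_nonneg_left ?_ (abs_nonneg _)
        set d := |deriv τ ((n + 1) * (z.re - 1 / 2))| with hd
        calc d * ((n : ℝ) + 1) * |(piCot z).re|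
            ≤ d * ((n : ℝ) + 1) * (|z.re - 1 / 2| * (2 * Real.pi ^ 2 + 4 * ‖piCot z‖)) := by
              gcongr
          _ = ((n + 1) * |z.re - 1 / 2| * d) * (2 * Real.pi ^ 2 + 4 * ‖piCot z‖) := by ring
          _ ≤ D * (2 * Real.pi ^ 2 + 4 * ‖piCot z‖) := by gcongr
    · filter_upwards [hne] with z hz
      rcases lt_or_gt_of_ne hz with hlt | hgt
      · have h0 : conjField halfCot z = 0 := by
          rw [conjField, halfCot, Set.indicator_of_notMem
            (show z ∉ {z : ℂ | 1 / 2 < z.re} from not_lt.2 hlt.le)]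
          simp
        rw [h0, map_zero]
        refine tendsto_const_nhds.congr fun n => ?_
        have hneg : ((n : ℝ) + 1) * (z.re - 1 / 2) < 0 :=
          mul_neg_of_pos_of_neg (by positivity) (by linarith)
        have h1 : deriv τ ((n + 1) * (z.re - 1 / 2)) = 0 := by
          have : τ =ᶠ[𝓝 (((n : ℝ) + 1) * (z.re - 1 / 2))] fun _ => 0 := by
            filter_upwards [Iio_mem_nhds hneg] with s hs
            exact Real.smoothTransition.zero_of_nonpos (le_of_lt hs)
          rw [this.deriv_eq, deriv_const]
        rw [hfd, h1, show θ n z = 0 from Real.smoothTransition.zero_of_nonpos hneg.le]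
        ring
      · have h0 : conjField halfCot z = conjField piCot z := by
          rw [conjField, halfCot, Set.indicator_of_mem
            (show z ∈ {z : ℂ | 1 / 2 < z.re} from hgt), conjField]
        rw [h0]
        refine tendsto_const_nhds.congr' ?_
        have hev : ∀ᶠ n : ℕ in atTop, 1 < ((n : ℝ) + 1) * (z.re - 1 / 2) :=
          ((tendsto_atTop_add_const_right _ _ tendsto_natCast_atTop_atTop).atTop_mul_const
            (by linarith)).eventually_gt_atTop 1
        filter_upwards [hev] with n hn
        have h1 : deriv τ ((n + 1) * (z.re - 1 / 2)) = 0 := by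
          have : τ =ᶠ[𝓝 (((n : ℝ) + 1) * (z.re - 1 / 2))] fun _ => 1 := by
            filter_upwards [Ioi_mem_nhds hn] with s hs
            exact Real.smoothTransition.one_of_one_le (le_of_lt hs)
          rw [this.deriv_eq, deriv_const]
        rw [hfd, h1, show θ n z = 1 from Real.smoothTransition.one_of_one_le hn.le]
        ring
  rw [zero_mul, sub_zero]
  refine tendsto_nhds_unique hlim (tendsto_const_nhds.congr' ?_)
  filter_upwards [eventually_ge_atTop 1] with n hn
  exact (hval n hn).symm

/-! ### Radial logarithmic test functions -/

lemma exists_smooth_plateau {a b c d : ℝ} (hab : a < b) (hcd : c < d) :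
    ∃ β : ℝ → ℝ, ContDiff ℝ (⊤ : ℕ∞) β ∧ (∀ s, 0 ≤ β s ∧ β s ≤ 1) ∧
      (∀ s, s ≤ a → β s = 0) ∧ (∀ s, d ≤ s → β s = 0) ∧ ∀ s, b ≤ s → s ≤ c → β s = 1 := by
  have hab' : 0 < b - a := sub_pos.2 hab
  have hcd' : 0 < d - c := sub_pos.2 hcd
  refine ⟨fun s => Real.smoothTransition ((s - a) / (b - a)) *
    Real.smoothTransition ((d - s) / (d - c)), ?_, fun s => ⟨?_, ?_⟩, fun s hs => ?_,
    fun s hs => ?_, fun s h1 h2 => ?_⟩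
  · exact (Real.smoothTransition.contDiff.comp ((contDiff_id.sub contDiff_const).div_const _)).mul
      (Real.smoothTransition.contDiff.comp ((contDiff_const.sub contDiff_id).div_const _))
  · exact mul_nonneg (Real.smoothTransition.nonneg _) (Real.smoothTransition.nonneg _)
  · exact mul_le_one₀ (Real.smoothTransition.le_one _) (Real.smoothTransition.nonneg _)
      (Real.smoothTransition.le_one _)
  · simp only
    rw [Real.smoothTransition.zero_of_nonpos, zero_mul]
    exact div_nonpos_of_nonpos_of_nonneg (by linarith) hab'.le
  · simp only
    rw [Real.smoothTransition.zero_of_nonpos (x := (d - s) / (d - c)), mul_zero]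
    exact div_nonpos_of_nonpos_of_nonneg (by linarith) hcd'.le
  · simp only
    rw [Real.smoothTransition.one_of_one_le, Real.smoothTransition.one_of_one_le, one_mul]
    · rw [one_le_div hcd']; linarith
    · rw [one_le_div hab']; linarith

/-- A radial test function behaving like `log (ρ / ‖z - p‖)` in the annulus `η < ‖z - p‖ < ρ` and
constant inside; its gradient is `-β (z - p) / ‖z - p‖²`. -/
lemma exists_radial_test (p : ℂ) {η ρ : ℝ} (hη : 0 < η) (hηρ : 4 * η ≤ ρ) (hρ : ρ ≤ 1) :
    ∃ φ β : ℂ → ℝ, IsTest φ ∧ (∀ z, 0 ≤ β z ∧ β z ≤ 1) ∧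
      (∀ z, β z ≠ 0 → η ≤ dist z p ∧ dist z p < ρ) ∧
      (∀ z w, fderiv ℝ φ z w = -(β z * (‖z - p‖ ^ 2)⁻¹ * inner ℝ (z - p) w)) ∧
      Real.log (ρ / (4 * η)) ≤ φ p ∧ (∀ z, 0 ≤ φ z) ∧ (∀ z, ρ ≤ dist z p → φ z = 0) ∧
      ∀ z, z ≠ p → φ z ≤ (Metric.ball p ρ).indicator (fun z => ‖z - p‖⁻¹) z := by
  have hρ0 : 0 < ρ := by linarith
  obtain ⟨β, hβs, hβ01, hβa, hβd, hβ1⟩ := exists_smooth_plateau (a := η ^ 2) (b := 4 * η ^ 2)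
    (c := ρ ^ 2 / 4) (d := ρ ^ 2) (by nlinarith) (by nlinarith)
  -- The profile is built in `s = ‖z - p‖²`, which is smooth at the centre; `u` is smooth because
  -- `β` vanishes for `s ≤ η²`. The test function is the integral of `u` from `‖z - p‖²` to `ρ²`.
  set u : ℝ → ℝ := fun s => β s / (2 * s) with hu
  have hus : ContDiff ℝ (⊤ : ℕ∞) u := by
    rw [contDiff_iff_contDiffAt]
    intro s
    by_cases hs : s < η ^ 2
    · have : u =ᶠ[𝓝 s] fun _ => 0 := by
        filter_upwards [Iio_mem_nhds hs] with t ht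
        simp only [hu]
        rw [hβa t (le_of_lt ht), zero_div]
      exact contDiffAt_const.congr_of_eventuallyEq this
    · have hs0 : 2 * s ≠ 0 := by
        have : 0 < η ^ 2 := by positivity
        intro h; apply hs; linarith
      exact hβs.contDiffAt.div (contDiffAt_const.mul contDiffAt_id) hs0
  have huc : Continuous u := hus.continuous
  have hu0 : ∀ s, 0 ≤ s → 0 ≤ u s := fun s hs => div_nonneg (hβ01 s).1 (by linarith)
  set g : ℝ → ℝ := fun t => ∫ s in t..ρ ^ 2, u s with hg
  have hgd : ∀ t, HasDerivAt g (-u t) t := fun t =>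
    intervalIntegral.integral_hasDerivAt_left (huc.intervalIntegrable _ _)
      (huc.stronglyMeasurableAtFilter _ _) huc.continuousAt
  have hgs : ContDiff ℝ (⊤ : ℕ∞) g := by
    rw [contDiff_infty_iff_deriv]
    refine ⟨fun t => (hgd t).differentiableAt, ?_⟩
    have : deriv g = fun t => -u t := funext fun t => (hgd t).deriv
    rw [this]
    exact hus.neg
  have hg0 : ∀ t, ρ ^ 2 ≤ t → g t = 0 := fun t ht => by
    simp only [hg]
    rw [intervalIntegral.integral_symm, neg_eq_zero]
    refine intervalIntegral.integral_zero_ae (Eventually.of_forall fun s hs => ?_)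
    rw [Set.uIoc_of_le ht] at hs
    simp only [hu]
    rw [hβd s hs.1.le, zero_div]
  have hgnn : ∀ t, 0 ≤ t → 0 ≤ g t := fun t ht => by
    rcases le_total t (ρ ^ 2) with h | h
    · exact intervalIntegral.integral_nonneg h fun s hs => hu0 s (ht.trans hs.1)
    · rw [hg0 t h]
  have hφd : ∀ z w, fderiv ℝ (fun z : ℂ => g (‖z - p‖ ^ 2)) z w
      = -(β (‖z - p‖ ^ 2) * (‖z - p‖ ^ 2)⁻¹ * inner ℝ (z - p) w) := fun z w => by
    have h1 : HasFDerivAt (fun z : ℂ => ‖z - p‖ ^ 2)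
        (2 • (innerSL ℝ (z - p)).comp (ContinuousLinearMap.id ℝ ℂ)) z :=
      ((hasFDerivAt_id z).sub_const p).norm_sq
    have h2 : HasFDerivAt (fun z : ℂ => g (‖z - p‖ ^ 2)) _ z := (hgd _).comp_hasFDerivAt z h1
    rw [h2.fderiv]
    simp [hu]
    by_cases h0 : ‖z - p‖ = 0
    · simp [h0]
    · field_simp
      ring
  refine ⟨fun z => g (‖z - p‖ ^ 2), fun z => β (‖z - p‖ ^ 2), ⟨?_, ?_⟩, fun z => hβ01 _, ?_,
    hφd, ?_, fun z => hgnn _ (sq_nonneg _), ?_, ?_⟩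
  · exact hgs.comp ((contDiff_id.sub contDiff_const).norm_sq ℝ)
  · refine HasCompactSupport.intro (isCompact_closedBall p ρ) fun z hz => hg0 _ ?_
    rw [Metric.mem_closedBall, not_le, dist_eq_norm] at hz
    gcongr
  · intro z hz
    rw [dist_eq_norm]
    constructor
    · by_contra! h
      exact hz (hβa _ (by gcongr))
    · by_contra! h
      exact hz (hβd _ (by gcongr))
  · have h4 : 4 * η ^ 2 ≤ ρ ^ 2 / 4 := by nlinarith
    have hlow : ∫ s in (4 * η ^ 2)..(ρ ^ 2 / 4), u s ≤ g (‖p - p‖ ^ 2) := by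
      simp only [sub_self, norm_zero, ne_eq, OfNat.ofNat_ne_zero, not_false_eq_true, zero_pow, hg]
      refine intervalIntegral.integral_mono_interval (by positivity) h4 (by nlinarith) ?_
        (huc.intervalIntegrable _ _)
      filter_upwards [ae_restrict_mem measurableSet_Ioc] with s hs using hu0 s hs.1.le
    refine le_trans (le_of_eq ?_) hlow
    have h5 : ∫ s in (4 * η ^ 2)..(ρ ^ 2 / 4), u s
        = ∫ s in (4 * η ^ 2)..(ρ ^ 2 / 4), (1 / 2) * s⁻¹ := by
      refine intervalIntegral.integral_congr fun s hs => ?_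
      rw [Set.uIcc_of_le h4] at hs
      simp only [hu]
      rw [hβ1 s hs.1 hs.2]
      have : 0 < s := lt_of_lt_of_le (by positivity) hs.1
      field_simp
    rw [h5, intervalIntegral.integral_const_mul,
      integral_inv_of_pos (by positivity) (by positivity),
      show ρ ^ 2 / 4 / (4 * η ^ 2) = (ρ / (4 * η)) ^ 2 by field_simp, Real.log_pow]
    push_cast
    ring
  · intro z hz
    rw [dist_eq_norm] at hz
    exact hg0 _ (by gcongr)
  · intro z hz
    have hr : 0 < ‖z - p‖ := norm_pos_iff.2 (sub_ne_zero.2 hz)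
    by_cases hzb : z ∈ Metric.ball p ρ
    · rw [Set.indicator_of_mem hzb]
      rw [Metric.mem_ball, dist_eq_norm] at hzb
      have hle : ‖z - p‖ ^ 2 ≤ ρ ^ 2 := by gcongr
      have h1 : g (‖z - p‖ ^ 2) ≤ ∫ s in (‖z - p‖ ^ 2)..(ρ ^ 2), (1 / 2) * s⁻¹ := by
        refine intervalIntegral.integral_mono_on hle (huc.intervalIntegrable _ _) ?_ ?_
        · refine (intervalIntegral.intervalIntegrable_inv (fun s hs => ?_)
            continuousOn_id).const_mul _
          rw [Set.uIcc_of_le hle] at hs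
          exact (lt_of_lt_of_le (by positivity) hs.1).ne'
        · intro s hs
          have hs0 : 0 < s := lt_of_lt_of_le (by positivity) hs.1
          simp only [hu]
          rw [show (1 : ℝ) / 2 * s⁻¹ = 1 / (2 * s) by field_simp]
          have := (hβ01 s).2
          gcongr
      refine h1.trans ?_
      rw [intervalIntegral.integral_const_mul, integral_inv_of_pos (by positivity) (by positivity),
        ← div_pow, Real.log_pow]
      have h2 : Real.log (ρ / ‖z - p‖) ≤ ‖z - p‖⁻¹ := by
        refine (Real.log_le_sub_one_of_pos (by positivity)).trans ?_
        rw [div_eq_mul_inv]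
        have : 0 < ‖z - p‖⁻¹ := by positivity
        nlinarith
      push_cast
      linarith
    · rw [Set.indicator_of_notMem hzb]
      rw [Metric.mem_ball, dist_eq_norm, not_lt] at hzb
      exact (hg0 _ (by gcongr)).le

/-- The integrand is `-Re (dbar φ / (z - p))`, so this is the fundamental-solution identity at `p`.
-/
lemma integral_radial_weight {p : ℂ} {φ β : ℂ → ℝ} (hφ : IsTest φ)
    (hd : ∀ z w, fderiv ℝ φ z w = -(β z * (‖z - p‖ ^ 2)⁻¹ * inner ℝ (z - p) w)) :
    Integrable (fun z => β z * (‖z - p‖ ^ 2)⁻¹) ∧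
      ∫ z, β z * (‖z - p‖ ^ 2)⁻¹ = 2 * Real.pi * φ p := by
  have hinv := locallyIntegrable_inv_sub p
  have hi := hφ.integrable_dbar_mul hinv
  have heq : ∀ z, (dbar φ z * (z - p)⁻¹).re = -(β z * (‖z - p‖ ^ 2)⁻¹) := fun z => by
    have h1 := fderiv_conjField φ (fun z => (z - p)⁻¹) z
    have h2 : conjField (fun z => (z - p)⁻¹) z = (-(‖z - p‖ ^ 2)⁻¹ : ℝ) • (z - p) := by
      rw [conjField, map_inv₀, Complex.inv_def, Complex.conj_conj, Complex.normSq_conj,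
        Complex.normSq_eq_norm_sq, Complex.real_smul]
      push_cast
      ring
    rw [h2, hd, inner_smul_right, real_inner_self_eq_norm_sq] at h1
    have h3 : (dbar φ z * (z - p)⁻¹).re
        = β z * (‖z - p‖ ^ 2)⁻¹ * (-(‖z - p‖ ^ 2)⁻¹ * ‖z - p‖ ^ 2) := by linarith
    rw [h3]
    by_cases h0 : ‖z - p‖ = 0
    · simp [h0]
    · field_simp
  have h4 := Complex.reCLM.integral_comp_comm hi
  simp only [Complex.reCLM_apply, heq] at h4
  rw [hφ.integral_dbar_mul_inv, Complex.ofReal_re, integral_neg, neg_inj] at h4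
  refine ⟨?_, h4⟩
  refine hi.re.neg.congr (Eventually.of_forall fun z => ?_)
  have := heq z
  simp only [Pi.neg_apply]
  change -(dbar φ z * (z - p)⁻¹).re = _
  rw [this, neg_neg]

/-! ### The lower bound for the energy -/

/-- The square `‖x v - c w‖²` is not discarded: `t² ≥ 2 x t - x²` keeps a term linear in `‖v‖`,
which is the origin of the `L¹` control. -/
lemma mul_norm_sq_ge {x c : ℝ} (hx : 0 < x) (hc : 0 ≤ c) (v w : ℂ) :
    2 * c * inner ℝ w v - c ^ 2 / x * ‖w‖ ^ 2 + (2 * x * ‖v‖ - 2 * c * ‖w‖ - x)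
      ≤ x * ‖v‖ ^ 2 := by
  set y : ℂ := x • v - c • w with hy
  have h1 : ‖y‖ ^ 2 = x ^ 2 * ‖v‖ ^ 2 - 2 * (x * c * inner ℝ w v) + c ^ 2 * ‖w‖ ^ 2 := by
    rw [hy, norm_sub_sq_real, norm_smul, norm_smul, inner_smul_left, inner_smul_right,
      real_inner_comm w v, mul_pow, mul_pow]
    simp
    ring
  have h2 : x * ‖v‖ - c * ‖w‖ ≤ ‖y‖ := by
    have := norm_sub_norm_le (x • v) (c • w)
    rwa [norm_smul, norm_smul, Real.norm_of_nonneg hx.le, Real.norm_of_nonneg hc] at this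
  have h3 : 0 ≤ (‖y‖ - x) ^ 2 := sq_nonneg _
  have h4 : x * (2 * c * inner ℝ w v - c ^ 2 / x * ‖w‖ ^ 2 + (2 * x * ‖v‖ - 2 * c * ‖w‖ - x))
      ≤ x * (x * ‖v‖ ^ 2) := by
    have h5 : x * (c ^ 2 / x * ‖w‖ ^ 2) = c ^ 2 * ‖w‖ ^ 2 := by field_simp
    nlinarith
  exact le_of_mul_le_mul_left h4 hx

/-- The square is completed with `w = ∇φ` for the truncated logarithm `φ`. The divergence equation
evaluates the cross term, giving `4 π c φ(p)` up to the background, and the quadratic term takes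
back `2 π c φ(p)`. The radius `χ p / (8 L)` keeps `χ` comparable to `c = χ p` on the disc. -/
lemma exists_local_lower_bound {Λ : Set ℂ} (hΛ : Λ ⊆ latticeZ2) {m : ℝ} {j : ℂ → ℂ}
    (hj : LocallyIntegrable j volume) (hdiv : DivEquation Λ m j) {L R : ℝ} (hL : 1 ≤ L)
    {χ : ℂ → ℝ} (hχ : IsCutoff L R χ) {p : ℂ} (hp : p ∈ Λ) (hχp : 0 < χ p) {η : ℝ} (hη : 0 < η)
    (hηρ : 4 * η ≤ χ p / (8 * L)) :
    ∃ G : ℂ → ℝ, Integrable G ∧ (∀ z, χ p / (8 * L) ≤ dist z p → G z = 0) ∧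
      (∀ z, dist z p < η → G z ≤ 0) ∧
      (∀ z, z ≠ p → dist z p < χ p / (8 * L) →
        2 * (χ z * ‖j z‖) - χ z + G z ≤ χ z * ‖j z‖ ^ 2) ∧
      -(2 * Real.pi * χ p * Real.log η) - Real.pi * L * (65 + 4 * |m|) ≤ ∫ z, G z := by
  set c := χ p with hc
  set ρ := c / (8 * L) with hρ
  have hpi := Real.pi_pos
  have hcL : c ≤ L := hχ.le p
  have hLρ : 8 * L * ρ = c := by rw [hρ]; field_simp
  have hρ0 : 0 < ρ := by positivity
  have hρ8 : ρ ≤ 1 / 8 := by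
    rw [hρ, div_le_div_iff₀ (by positivity) (by norm_num)]
    linarith
  obtain ⟨φ, β, hφ, hβ01, hβ, hd, hφp, hφ0, hφout, hφle⟩ :=
    exists_radial_test p hη hηρ (by linarith)
  obtain ⟨hwi, hwint⟩ := integral_radial_weight hφ hd
  have hBi : Integrable ((Metric.ball p ρ).indicator fun z => ‖z - p‖⁻¹) :=
    (integrableOn_inv_norm_ball p ρ).integrable_indicator measurableSet_ball
  have hBint : ∫ z, (Metric.ball p ρ).indicator (fun z => ‖z - p‖⁻¹) z = 2 * Real.pi * ρ := by
    rw [integral_indicator measurableSet_ball, integral_inv_norm_ball p hρ0.le]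
  have hfi := hφ.integrable_fderiv_apply hj
  -- The last term absorbs two errors of size `2 L / r`: replacing `c² / χ z` by `c`, and the term
  -- `2 c ‖w‖`.
  refine ⟨fun z => 2 * c * fderiv ℝ φ z (j z) - c * (β z * (‖z - p‖ ^ 2)⁻¹)
    - 4 * L * (Metric.ball p ρ).indicator (fun z => ‖z - p‖⁻¹) z, ?_, ?_, ?_, ?_, ?_⟩
  · exact ((hfi.const_mul _).sub (hwi.const_mul _)).sub (hBi.const_mul _)
  · intro z hz
    have h0 : β z = 0 := by
      by_contra h
      exact absurd (hβ z h).2 (not_lt.2 hz)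
    have h1 : z ∉ Metric.ball p ρ := not_lt.2 hz
    simp only [hd, h0, Set.indicator_of_notMem h1]
    ring
  · intro z hz
    have h0 : β z = 0 := by
      by_contra h
      exact absurd (hβ z h).1 (not_le.2 hz)
    have h1 : 0 ≤ (Metric.ball p ρ).indicator (fun z => ‖z - p‖⁻¹) z :=
      Set.indicator_nonneg (fun _ _ => by positivity) _
    have h2 : 0 ≤ 4 * L * (Metric.ball p ρ).indicator (fun z => ‖z - p‖⁻¹) z := by positivity
    simp only [hd, h0]
    linarith
  · intro z hzp hz
    have hzb : z ∈ Metric.ball p ρ := hz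
    simp only [Set.indicator_of_mem hzb]
    have hr : 0 < ‖z - p‖ := norm_pos_iff.2 (sub_ne_zero.2 hzp)
    have hl := hχ.sub_le p z
    rw [dist_comm, dist_eq_norm] at hl
    rw [dist_eq_norm] at hz
    have hdz := hd z (j z)
    have hb0 := (hβ01 z).1
    have hb1 := (hβ01 z).2
    set b := β z
    set r := ‖z - p‖ with hrdef
    set x := χ z
    have hLr : L * r ≤ c / 8 := by nlinarith
    have hx : 0 < x := by
      have : c - x ≤ L * r := hl
      linarith
    set w : ℂ := (-(b * (r ^ 2)⁻¹)) • (z - p) with hw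
    have hwn : ‖w‖ = b * r⁻¹ := by
      rw [hw, norm_smul, norm_neg, Real.norm_of_nonneg (by positivity), ← hrdef]
      field_simp
    have hin : inner ℝ w (j z) = fderiv ℝ φ z (j z) := by
      rw [hdz, hw, inner_smul_left]
      simp
    have key := mul_norm_sq_ge hx hχp.le (j z) w
    rw [hin, hwn] at key
    have hri : 0 < r⁻¹ := by positivity
    have h1 : c ^ 2 / x ≤ c + 2 * L * r := by
      rw [div_le_iff₀ hx]
      have h2 : c - L * r ≤ x := by
        have : c - x ≤ L * r := hl
        linarith
      have h3 : 0 ≤ L * r := by positivity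
      nlinarith [mul_le_mul_of_nonneg_left h2 (show 0 ≤ c + 2 * L * r by positivity)]
    have h2 : c ^ 2 / x * (b * r⁻¹) ^ 2 ≤ c * (b * (r ^ 2)⁻¹) + 2 * L * r⁻¹ := by
      calc c ^ 2 / x * (b * r⁻¹) ^ 2 ≤ (c + 2 * L * r) * (b * r⁻¹) ^ 2 := by gcongr
        _ = (c + 2 * L * r) * (b * b * (r ^ 2)⁻¹) := by rw [mul_pow, inv_pow]; ring
        _ ≤ (c + 2 * L * r) * (1 * b * (r ^ 2)⁻¹) := by gcongr
        _ = c * (b * (r ^ 2)⁻¹) + 2 * L * (b * r⁻¹) := by field_simp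
        _ ≤ c * (b * (r ^ 2)⁻¹) + 2 * L * (1 * r⁻¹) := by gcongr
        _ = _ := by ring
    have h3 : 2 * c * (b * r⁻¹) ≤ 2 * L * (1 * r⁻¹) := by gcongr
    linarith
  · have hsub : Integrable fun z => 2 * c * fderiv ℝ φ z (j z) - c * (β z * (‖z - p‖ ^ 2)⁻¹) :=
      (hfi.const_mul _).sub (hwi.const_mul _)
    rw [integral_sub hsub (hBi.const_mul _), integral_sub (hfi.const_mul _) (hwi.const_mul _), integral_const_mul, integral_const_mul,
      integral_const_mul, hwint, hBint, hdiv φ hφ]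
    have hts : ∑' q : Λ, φ q = φ p := by
      rw [tsum_subtype_eq_sum (Λ := Λ) (φ := φ) (F := {p}) (by simpa using hp),
        Finset.sum_singleton]
      intro q hq hqp
      refine hφout q ?_
      have := one_le_dist_of_mem_lattice (hΛ hq) (hΛ hp) (by simpa using hqp)
      linarith
    rw [hts]
    have hI0 : 0 ≤ ∫ z, φ z := integral_nonneg hφ0
    have hI1 : ∫ z, φ z ≤ 1 := by
      have : ∫ z, φ z ≤ 2 * Real.pi * ρ := by
        rw [← hBint]
        refine integral_mono_ae (hφ.1.continuous.integrable_of_hasCompactSupport hφ.2) hBi ?_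
        filter_upwards [Measure.ae_ne volume p] with z hz using hφle z hz
      have h4 := Real.pi_lt_four
      nlinarith
    have hmI : m * ∫ z, φ z ≤ |m| := by
      calc m * ∫ z, φ z ≤ |m| * ∫ z, φ z := by
            gcongr; exact le_abs_self m
        _ ≤ |m| * 1 := by gcongr
        _ = |m| := mul_one _
    have hlog : -(c * Real.log η) - 32 * L ≤ c * φ p := by
      have h1 : Real.log (ρ / (4 * η)) = Real.log (c / (32 * L)) - Real.log η := by
        rw [← Real.log_div (by positivity) hη.ne']
        congr 1
        rw [hρ]; field_simp; norm_num
      -- The disc shrinks with `c`, but the loss `c log c` stays bounded as `c → 0`; hence the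
      -- constant is uniform over the charges.
      have h2 : -(32 * L) ≤ c * Real.log (c / (32 * L)) := by
        have hy : 0 < c / (32 * L) := by positivity
        have h3 := Real.one_sub_inv_le_log_of_pos hy
        rw [inv_div] at h3
        have h4 : c * (1 - 32 * L / c) = c - 32 * L := by field_simp
        nlinarith [mul_le_mul_of_nonneg_left h3 hχp.le]
      have h5 := mul_le_mul_of_nonneg_left hφp hχp.le
      rw [h1, mul_sub] at h5
      linarith
    have e1 : 4 * L * (2 * Real.pi * ρ) = Real.pi * c := by
      rw [← hLρ]; ring
    have e2 : c * (m * ∫ z, φ z) ≤ L * |m| := by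
      calc c * (m * ∫ z, φ z) ≤ c * |m| := by gcongr
        _ ≤ L * |m| := by gcongr
    have e3 : Real.pi * c ≤ Real.pi * L := by gcongr
    have e4 := mul_le_mul_of_nonneg_left hlog hpi.le
    have e5 := mul_le_mul_of_nonneg_left e2 hpi.le
    rw [e1]
    linarith

lemma measurableSet_compl_biUnion_ball (Λ : Set ℂ) (η : ℝ) :
    MeasurableSet (⋃ p ∈ Λ, Metric.ball p η)ᶜ :=
  ((isOpen_biUnion fun _ _ => Metric.isOpen_ball).measurableSet).compl

lemma L2LocOff.integrableOn_cutoff {Λ : Set ℂ} {j : ℂ → ℂ} (hj2 : L2LocOff Λ j)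
    {L R : ℝ} {χ : ℂ → ℝ} (hχ : IsCutoff L R χ) {η : ℝ} (hη : 0 < η) :
    IntegrableOn (fun z => χ z * ‖j z‖ ^ 2) (⋃ p ∈ Λ, Metric.ball p η)ᶜ := by
  set S : Set ℂ := (⋃ p ∈ Λ, Metric.ball p η)ᶜ with hS
  have hSc : IsClosed S := (isOpen_biUnion fun _ _ => Metric.isOpen_ball).isClosed_compl
  set K : Set ℂ := S ∩ Metric.closedBall 0 R with hK
  have hKc : IsCompact K := (isCompact_closedBall _ _).inter_left hSc
  have hKΛ : Disjoint K Λ := Set.disjoint_left.2 fun z hz hzΛ =>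
    hz.1 (Set.mem_biUnion hzΛ (Metric.mem_ball_self hη))
  have h1 : IntegrableOn (fun z => ‖j z‖ ^ 2) K := (hj2 K hKc hKΛ).integrable_norm_pow two_ne_zero
  have h2 : IntegrableOn (fun z => χ z * ‖j z‖ ^ 2) K := by
    refine Integrable.bdd_mul (c := L) h1 hχ.continuous.aestronglyMeasurable ?_
    exact Eventually.of_forall fun z => by
      rw [Real.norm_of_nonneg (hχ.nonneg z)]
      exact hχ.le z
  refine h2.of_forall_sdiff_eq_zero hSc.measurableSet fun z hz => ?_
  rw [hχ.eq_zero z, zero_mul]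
  intro hzR
  exact hz.2 ⟨hz.1, Metric.ball_subset_closedBall hzR⟩

lemma IsCutoff.hasCompactSupport {L R : ℝ} {χ : ℂ → ℝ} (hχ : IsCutoff L R χ) :
    HasCompactSupport χ :=
  HasCompactSupport.intro (isCompact_closedBall 0 R) fun z hz =>
    hχ.eq_zero z fun h => hz (Metric.ball_subset_closedBall h)

lemma IsCutoff.integral_le {L R : ℝ} {χ : ℂ → ℝ} (hχ : IsCutoff L R χ) (hR : 0 ≤ R) :
    ∫ z, χ z ≤ L * Real.pi * R ^ 2 := by
  have h1 : ∫ z, χ z ≤ ∫ z, (Metric.ball (0 : ℂ) R).indicator (fun _ => L) z := by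
    refine integral_mono (hχ.continuous.integrable_of_hasCompactSupport hχ.hasCompactSupport)
      ((integrableOn_const measure_ball_lt_top.ne).integrable_indicator measurableSet_ball)
      fun z => ?_
    by_cases hz : z ∈ Metric.ball (0 : ℂ) R
    · rw [Set.indicator_of_mem hz]; exact hχ.le z
    · rw [Set.indicator_of_notMem hz, hχ.eq_zero z hz]
  refine h1.trans (le_of_eq ?_)
  rw [integral_indicator measurableSet_ball, setIntegral_const, Measure.real,
    Complex.volume_ball, smul_eq_mul, ENNReal.toReal_mul, ENNReal.toReal_pow,
    ENNReal.toReal_ofReal hR]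
  simp
  ring

lemma LocallyIntegrable.integrable_cutoff_mul_norm {j : ℂ → ℂ} (hj : LocallyIntegrable j volume)
    {L R : ℝ} {χ : ℂ → ℝ} (hχ : IsCutoff L R χ) : Integrable (fun z => χ z * ‖j z‖) := by
  have h : LocallyIntegrable (fun z => ‖j z‖) volume := by
    rw [locallyIntegrable_iff] at hj ⊢
    intro K hK
    exact Integrable.norm (hj K hK)
  exact h.integrable_smul_left_of_hasCompactSupport hχ.continuous hχ.hasCompactSupport

/-- The local bounds live on disjoint discs and can be added; elsewhere `|j|² ≥ 2 |j| - 1`. Their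
logarithms cancel the compensating term, and the errors are `O(R²)`. -/
theorem exists_le_truncatedEnergy {Λ : Set ℂ} (hΛ : Λ ⊆ latticeZ2) {m : ℝ} {j : ℂ → ℂ}
    (hj : j ∈ fields Λ m) {L : ℝ} (hL : 1 ≤ L) :
    ∃ K : ℝ, ∀ R : ℝ, 1 < R → ∀ χ : ℂ → ℝ, IsCutoff L R χ → ∀ᶠ η in 𝓝[>] (0 : ℝ),
      (∫ z in (⋃ p ∈ Λ, Metric.ball p η)ᶜ, χ z * ‖j z‖) - K * R ^ 2
        ≤ truncatedEnergy Λ j χ η := by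
  classical
  obtain ⟨hloc, hj2, hdiv⟩ := hj
  set K₁ : ℝ := Real.pi * L * (65 + 4 * |m|) with hK₁
  have hpi := Real.pi_pos
  have hK₁0 : 0 ≤ K₁ := by positivity
  refine ⟨L * Real.pi / 2 + 9 * K₁ / 2, fun R hR χ hχ => ?_⟩
  obtain ⟨F₀, hF₀, hcard₀⟩ := exists_finset_points hΛ (R := R) (by linarith)
  set F := F₀.filter (fun p => 0 < χ p) with hFdef
  have hFΛ : ∀ p ∈ F, p ∈ Λ := fun p hp => ((hF₀ p).1 (Finset.mem_filter.1 hp).1).1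
  have hFpos : ∀ p ∈ F, 0 < χ p := fun p hp => (Finset.mem_filter.1 hp).2
  have hcard : (F.card : ℝ) ≤ 9 * R ^ 2 := by
    have h1 : (F.card : ℝ) ≤ F₀.card := by exact_mod_cast Finset.card_filter_le _ _
    nlinarith
  have hts : ∑' p : Λ, χ p = ∑ p ∈ F, χ p := by
    refine tsum_subtype_eq_sum hFΛ fun p hp hpF => ?_
    by_contra h0
    refine hpF (Finset.mem_filter.2 ⟨(hF₀ p).2 ⟨hp, ?_⟩, lt_of_le_of_ne (hχ.nonneg p) (Ne.symm h0)⟩)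
    by_contra! hlt
    exact h0 (hχ.eq_zero p (by simpa using hlt.le))
  -- How small `η` must be depends on the least positive value of `χ` on the charges; `K` does not.
  have hev : ∀ᶠ η in 𝓝[>] (0 : ℝ), ∀ p ∈ F, 4 * η ≤ χ p / (8 * L) := by
    rw [Finset.eventually_all]
    intro p hp
    have hpos : 0 < χ p / (8 * L) / 4 := by have := hFpos p hp; positivity
    filter_upwards [Ioo_mem_nhdsGT hpos] with η hη
    linarith [hη.2]
  filter_upwards [hev, Ioo_mem_nhdsGT (show (0 : ℝ) < 1 / 4 by norm_num)] with η hηF hη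
  have hη0 := hη.1
  have hρ8 : ∀ p, χ p / (8 * L) ≤ 1 / 8 := fun p => by
    rw [div_le_div_iff₀ (by positivity) (by norm_num)]
    linarith [hχ.le p]
  have hex : ∀ p ∈ F, ∃ G : ℂ → ℝ, _ := fun p hp =>
    exists_local_lower_bound hΛ hloc hdiv hL hχ (hFΛ p hp) (hFpos p hp) hη0 (hηF p hp)
  choose! G hGi hGout hGin hGle hGint using hex
  set S : Set ℂ := (⋃ p ∈ Λ, Metric.ball p η)ᶜ with hS
  have hSm : MeasurableSet S := measurableSet_compl_biUnion_ball Λ η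
  have hsingle : ∀ z, ∀ p ∈ F, dist z p < χ p / (8 * L) → ∑ q ∈ F, G q z = G p z := by
    intro z p hp hz
    refine Finset.sum_eq_single_of_mem p hp fun q hq hqp => hGout q hq z ?_
    by_contra! hlt
    exact hqp (eq_of_mem_lattice_of_dist_lt (hΛ (hFΛ q hq)) (hΛ (hFΛ p hp)) hlt hz
      (by linarith [hρ8 p, hρ8 q]))
  -- Removing the discs of radius `η` can only increase the integral, since `G p ≤ 0` on them.
  have hGS : ∀ p ∈ F, ∫ z, G p z ≤ ∫ z in S, G p z := by
    intro p hp
    rw [← integral_indicator hSm]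
    refine integral_mono (hGi p hp) ((hGi p hp).indicator hSm) fun z => ?_
    by_cases hz : z ∈ S
    · rw [Set.indicator_of_mem hz]
    · rw [Set.indicator_of_notMem hz]
      rw [hS, Set.notMem_compl_iff, Set.mem_iUnion₂] at hz
      obtain ⟨q, hq, hzq⟩ := hz
      by_cases hzp : dist z p < χ p / (8 * L)
      · have := eq_of_mem_lattice_of_dist_lt (hΛ hq) (hΛ (hFΛ p hp)) (Metric.mem_ball.1 hzq) hzp
          (by linarith [hρ8 p, hη.2])
        exact hGin p hp z (this ▸ hzq)
      · exact (hGout p hp z (not_lt.1 hzp)).le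
  have hi1 := LocallyIntegrable.integrable_cutoff_mul_norm hloc hχ
  have hi2 := hχ.continuous.integrable_of_hasCompactSupport (μ := volume) hχ.hasCompactSupport
  have hi3 : Integrable (fun z => ∑ p ∈ F, G p z) := integrable_finsetSum _ hGi
  have hmain : ∫ z in S, (2 * (χ z * ‖j z‖) - χ z + ∑ p ∈ F, G p z)
      ≤ ∫ z in S, χ z * ‖j z‖ ^ 2 := by
    refine setIntegral_mono_on (((hi1.const_mul 2).sub hi2).add hi3).integrableOn
      (hj2.integrableOn_cutoff hχ hη0) hSm fun z hz => ?_
    by_cases hzp : ∃ p ∈ F, dist z p < χ p / (8 * L)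
    · obtain ⟨p, hp, hzp⟩ := hzp
      rw [hsingle z p hp hzp]
      refine hGle p hp z ?_ hzp
      rintro rfl
      exact hz (Set.mem_biUnion (hFΛ z hp) (Metric.mem_ball_self hη0))
    · push Not at hzp
      rw [Finset.sum_eq_zero fun p hp => hGout p hp z (hzp p hp)]
      nlinarith [mul_nonneg (hχ.nonneg z) (sq_nonneg (‖j z‖ - 1))]
  have hi4 : Integrable (fun z => 2 * (χ z * ‖j z‖) - χ z) := (hi1.const_mul 2).sub hi2
  rw [integral_add hi4.integrableOn hi3.integrableOn,
    integral_sub (hi1.const_mul 2).integrableOn hi2.integrableOn, integral_const_mul,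
    integral_finsetSum _ fun p hp => (hGi p hp).integrableOn] at hmain
  have hχS : ∫ z in S, χ z ≤ L * Real.pi * R ^ 2 :=
    (setIntegral_le_integral hi2 (Eventually.of_forall hχ.nonneg)).trans
      (hχ.integral_le (by linarith))
  have hsum : ∑ p ∈ F, (-(2 * Real.pi * χ p * Real.log η) - K₁) ≤ ∑ p ∈ F, ∫ z in S, G p z :=
    Finset.sum_le_sum fun p hp => (hGint p hp).trans (hGS p hp)
  rw [Finset.sum_sub_distrib, Finset.sum_neg_distrib, ← Finset.sum_mul, ← Finset.mul_sum,
    Finset.sum_const, nsmul_eq_mul] at hsum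
  have hcK : (F.card : ℝ) * K₁ ≤ 9 * R ^ 2 * K₁ := by gcongr
  rw [truncatedEnergy, hts]
  linarith

/-! ### Finite energy bounds the growth of the field -/

lemma eventually_integral_le_of_fieldEnergy_lt_top {Λ : Set ℂ} (hΛ : Λ ⊆ latticeZ2) {m : ℝ}
    {j : ℂ → ℂ} (hj : j ∈ fields Λ m) {χ : ℝ → ℂ → ℝ} (hχ : IsCutoffFamily χ)
    (hfin : fieldEnergy χ Λ j < ⊤) :
    ∃ K : ℝ, 0 ≤ K ∧ ∀ᶠ R : ℝ in atTop, Integrable (fun z => χ R z * ‖j z‖) ∧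
      (∀ z, 0 ≤ χ R z) ∧ (∀ z ∈ Metric.ball (0 : ℂ) (R - 1), χ R z = 1) ∧
      ∫ z, χ R z * ‖j z‖ ≤ K * R ^ 2 := by
  obtain ⟨L, hL, hcut⟩ := hχ.exists_isCutoff
  obtain ⟨K, hK⟩ := exists_le_truncatedEnergy hΛ hj hL
  obtain ⟨M, hM, -⟩ := EReal.lt_iff_exists_real_btwn.1 hfin
  have hlim : ∀ᶠ R : ℝ in atTop,
      localizedEnergy Λ j (χ R) / ((Real.pi * R ^ 2 : ℝ) : EReal) < (M : EReal) :=
    eventually_lt_of_limsup_lt hM (by isBoundedDefault)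
  refine ⟨max (M * Real.pi + K) 0, le_max_right _ _, ?_⟩
  filter_upwards [hlim, eventually_gt_atTop 1] with R hR hR1
  have hc := hcut R hR1
  have hint := LocallyIntegrable.integrable_cutoff_mul_norm hj.1 hc
  refine ⟨hint, hc.nonneg, hc.eq_one, ?_⟩
  have hpos : (0 : ℝ) < Real.pi * R ^ 2 := by have := Real.pi_pos; positivity
  rw [EReal.div_lt_iff (by exact_mod_cast hpos) (EReal.coe_ne_top _), ← EReal.coe_mul] at hR
  have h1 : ∀ᶠ η in 𝓝[>] (0 : ℝ),
      ((truncatedEnergy Λ j (χ R) η : ℝ) : EReal) < ((M * (Real.pi * R ^ 2) : ℝ) : EReal) :=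
    eventually_lt_of_limsup_lt hR (by isBoundedDefault)
  have h2 : ∀ᶠ η in 𝓝[>] (0 : ℝ), ∫ z in (⋃ p ∈ Λ, Metric.ball p η)ᶜ, χ R z * ‖j z‖
      ≤ (M * Real.pi + K) * R ^ 2 := by
    filter_upwards [h1, hK R hR1 (χ R) hc] with η hη1 hη2
    rw [EReal.coe_lt_coe_iff] at hη1
    linarith
  -- The bound does not depend on `η`, so the holes can be closed by dominated convergence.
  have h3 : Tendsto (fun η : ℝ => ∫ z, (⋃ p ∈ Λ, Metric.ball p η)ᶜ.indicator
      (fun z => χ R z * ‖j z‖) z) (𝓝[>] 0) (𝓝 (∫ z, χ R z * ‖j z‖)) := by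
    refine tendsto_integral_filter_of_dominated_convergence (fun z => χ R z * ‖j z‖) ?_ ?_ hint ?_
    · exact Eventually.of_forall fun η =>
        hint.aestronglyMeasurable.indicator (measurableSet_compl_biUnion_ball Λ η)
    · refine Eventually.of_forall fun η => Eventually.of_forall fun z => ?_
      have h0 : 0 ≤ χ R z * ‖j z‖ := mul_nonneg (hc.nonneg z) (norm_nonneg _)
      refine (norm_indicator_le_norm_self _ _).trans ?_
      rw [Real.norm_of_nonneg h0]
    · filter_upwards [ae_notMem_latticeZ2] with z hz
      obtain ⟨δ, hδ, hball⟩ := Metric.isOpen_iff.1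
        (isClosed_of_subset_lattice hΛ).isOpen_compl z fun h => hz (hΛ h)
      refine tendsto_const_nhds.congr' ?_
      filter_upwards [Ioo_mem_nhdsGT hδ] with η hη
      rw [Set.indicator_of_mem]
      rw [Set.mem_compl_iff, Set.mem_iUnion₂]
      rintro ⟨p, hp, hzp⟩
      refine hball (Metric.mem_ball.2 ?_) hp
      rw [dist_comm]
      exact (Metric.mem_ball.1 hzp).trans hη.2
  have h4 : ∫ z, χ R z * ‖j z‖ ≤ (M * Real.pi + K) * R ^ 2 := by
    refine le_of_tendsto h3 ?_
    filter_upwards [h2] with η hη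
    rwa [integral_indicator (measurableSet_compl_biUnion_ball Λ η)]
  refine h4.trans ?_
  gcongr
  exact le_max_left _ _

lemma eventually_setIntegral_norm_le {Λ : Set ℂ} (hΛ : Λ ⊆ latticeZ2) {m : ℝ}
    {j : ℂ → ℂ} (hj : j ∈ fields Λ m) {χ : ℝ → ℂ → ℝ} (hχ : IsCutoffFamily χ)
    (hfin : fieldEnergy χ Λ j < ⊤) :
    ∃ K : ℝ, 0 ≤ K ∧ ∀ᶠ R : ℝ in atTop,
      ∫ z in Metric.closedBall (0 : ℂ) R, ‖j z‖ ≤ K * R ^ 2 := by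
  obtain ⟨K, hK, h⟩ := eventually_integral_le_of_fieldEnergy_lt_top hΛ hj hχ hfin
  refine ⟨9 * K, by positivity, ?_⟩
  have hshift : Tendsto (fun R : ℝ => R + 2) atTop atTop :=
    tendsto_atTop_add_const_right _ _ tendsto_id
  filter_upwards [hshift.eventually h,
    eventually_ge_atTop 1] with R hR hR1
  obtain ⟨hi, h0, h1, hle⟩ := hR
  have h2 : ∫ z in Metric.closedBall (0 : ℂ) R, ‖j z‖
      = ∫ z in Metric.closedBall (0 : ℂ) R, χ (R + 2) z * ‖j z‖ := by
    refine setIntegral_congr_fun Metric.isClosed_closedBall.measurableSet fun z hz => ?_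
    rw [h1 z, one_mul]
    rw [mem_closedBall_zero_iff] at hz
    rw [mem_ball_zero_iff]
    linarith
  rw [h2]
  refine (setIntegral_le_integral hi
    (Eventually.of_forall fun z => mul_nonneg (h0 z) (norm_nonneg _))).trans (hle.trans ?_)
  nlinarith [mul_le_mul_of_nonneg_left (show (R + 2) ^ 2 ≤ 9 * R ^ 2 by nlinarith) hK]

/-! ### Testing with a truncation of `1 / z` -/

/-- A fixed radial bump function. -/
def unitBump : ContDiffBump (0 : ℂ) := ⟨1, 2, one_pos, one_lt_two⟩

/-- An even cut-off supported in the annulus `1 ≤ ‖z‖ ≤ 2 R`. -/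
def annulusBump (R : ℝ) (z : ℂ) : ℝ := unitBump ((R⁻¹ : ℝ) • z) - unitBump z

lemma unitBump_eq_one {z : ℂ} (hz : ‖z‖ ≤ 1) : unitBump z = 1 :=
  unitBump.one_of_mem_closedBall (by simpa [unitBump] using hz)

lemma unitBump_eq_zero {z : ℂ} (hz : 2 ≤ ‖z‖) : unitBump z = 0 :=
  unitBump.zero_of_le_dist (by simpa [unitBump] using hz)

lemma norm_inv_smul {R : ℝ} (hR : 0 < R) (z : ℂ) : ‖(R⁻¹ : ℝ) • z‖ = ‖z‖ / R := by
  rw [norm_smul, Real.norm_of_nonneg (by positivity)]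
  field_simp

lemma annulusBump_eq_zero_of_le {R : ℝ} (hR : 1 ≤ R) {z : ℂ} (hz : ‖z‖ ≤ 1) :
    annulusBump R z = 0 := by
  have hR0 : 0 < R := by linarith
  rw [annulusBump, unitBump_eq_one hz, unitBump_eq_one, sub_self]
  rw [norm_inv_smul hR0, div_le_one hR0]
  linarith

lemma annulusBump_eq_zero_of_ge {R : ℝ} (hR : 1 ≤ R) {z : ℂ} (hz : 2 * R ≤ ‖z‖) :
    annulusBump R z = 0 := by
  have hR0 : 0 < R := by linarith
  rw [annulusBump, unitBump_eq_zero (z := z) (by linarith), unitBump_eq_zero, sub_self]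
  rw [norm_inv_smul hR0, le_div_iff₀ hR0]
  exact hz

lemma annulusBump_neg (R : ℝ) (z : ℂ) : annulusBump R (-z) = annulusBump R z := by
  rw [annulusBump, annulusBump, smul_neg, unitBump.neg, unitBump.neg]

lemma contDiff_annulusBump (R : ℝ) : ContDiff ℝ (⊤ : ℕ∞) (annulusBump R) := by
  have h1 : ContDiff ℝ (⊤ : ℕ∞) fun z : ℂ => (R⁻¹ : ℝ) • z := contDiff_id.const_smul _
  have h2 : ContDiff ℝ (⊤ : ℕ∞) (unitBump : ℂ → ℝ) := unitBump.contDiff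
  exact (h2.comp h1).sub h2

lemma exists_norm_fderiv_unitBump_le : ∃ C : ℝ, 0 ≤ C ∧ ∀ z, ‖fderiv ℝ unitBump z‖ ≤ C ∧
    (‖z‖ < 1 → fderiv ℝ unitBump z = 0) ∧ (2 < ‖z‖ → fderiv ℝ unitBump z = 0) := by
  have hc : Continuous (fderiv ℝ unitBump) :=
    (unitBump.contDiff (n := 1)).continuous_fderiv one_ne_zero
  obtain ⟨C, hC⟩ := (isCompact_closedBall (0 : ℂ) 2).exists_bound_of_continuousOn hc.continuousOn
  have hC0 : 0 ≤ C := (norm_nonneg _).trans (hC 0 (by simp))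
  have h2 : ∀ z : ℂ, 2 < ‖z‖ → fderiv ℝ unitBump z = 0 := fun z hz => by
    have : (unitBump : ℂ → ℝ) =ᶠ[𝓝 z] fun _ => 0 := by
      filter_upwards [(isOpen_lt continuous_const continuous_norm).mem_nhds hz] with w hw
      exact unitBump_eq_zero (le_of_lt hw)
    rw [this.fderiv_eq, fderiv_fun_const]; rfl
  have h1 : ∀ z : ℂ, ‖z‖ < 1 → fderiv ℝ unitBump z = 0 := fun z hz => by
    have : (unitBump : ℂ → ℝ) =ᶠ[𝓝 z] fun _ => 1 := by
      filter_upwards [(isOpen_lt continuous_norm continuous_const).mem_nhds hz] with w hw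
      exact unitBump_eq_one (le_of_lt hw)
    rw [this.fderiv_eq, fderiv_fun_const]; rfl
  refine ⟨C, hC0, fun z => ⟨?_, h1 z, h2 z⟩⟩
  by_cases hz : ‖z‖ ≤ 2
  · exact hC z (by simpa using hz)
  · rw [h2 z (not_le.1 hz), norm_zero]; exact hC0

/-- At the outer edge both the gradient and `1 / ‖z‖` are of order `1 / R`. The product `C / R²`
matches the growth `K R²` of the `L¹` norm; the inner edge does not depend on `R`. -/
lemma exists_norm_fderiv_annulusBump_le : ∃ C : ℝ, 0 ≤ C ∧ ∀ R : ℝ, 1 ≤ R → ∀ z : ℂ,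
    ‖fderiv ℝ (annulusBump R) z‖ * ‖z‖⁻¹
      ≤ (Metric.closedBall (0 : ℂ) (2 * R)).indicator (fun _ => C / R ^ 2) z
        + (Metric.closedBall (0 : ℂ) 2).indicator (fun _ => C) z := by
  obtain ⟨C, hC, h⟩ := exists_norm_fderiv_unitBump_le
  refine ⟨C, hC, fun R hR z => ?_⟩
  have hR0 : 0 < R := by linarith
  have hd : fderiv ℝ (annulusBump R) z
      = (R⁻¹ : ℝ) • fderiv ℝ unitBump ((R⁻¹ : ℝ) • z) - fderiv ℝ unitBump z := by
    have hu : Differentiable ℝ unitBump := (unitBump.contDiff (n := 1)).differentiable one_ne_zero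
    have hs : DifferentiableAt ℝ (fun z : ℂ => unitBump ((R⁻¹ : ℝ) • z)) z :=
      (hu _).comp z (show DifferentiableAt ℝ (fun z : ℂ => (R⁻¹ : ℝ) • z) z by fun_prop)
    unfold annulusBump
    rw [fderiv_fun_sub hs (hu z), fderiv_comp_smul]
  have hb1 : ‖(R⁻¹ : ℝ) • fderiv ℝ unitBump ((R⁻¹ : ℝ) • z)‖ * ‖z‖⁻¹
      ≤ (Metric.closedBall (0 : ℂ) (2 * R)).indicator (fun _ => C / R ^ 2) z := by
    obtain ⟨hn, h1, h2⟩ := h ((R⁻¹ : ℝ) • z)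
    rw [norm_inv_smul hR0] at h1 h2
    have hI : 0 ≤ (Metric.closedBall (0 : ℂ) (2 * R)).indicator (fun _ => C / R ^ 2) z :=
      Set.indicator_nonneg (fun _ _ => by positivity) _
    by_cases hz1 : ‖z‖ < R
    · rw [h1 (by rwa [div_lt_one hR0])]
      simpa using hI
    · push Not at hz1
      by_cases hz2 : ‖z‖ ≤ 2 * R
      · rw [Set.indicator_of_mem (by simpa using hz2), norm_smul,
          Real.norm_of_nonneg (by positivity)]
        calc R⁻¹ * ‖fderiv ℝ unitBump ((R⁻¹ : ℝ) • z)‖ * ‖z‖⁻¹ ≤ R⁻¹ * C * R⁻¹ := by gcongr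
          _ = C / R ^ 2 := by field_simp
      · rw [h2 (by rw [lt_div_iff₀ hR0]; linarith)]
        simpa using hI
  have hb2 : ‖fderiv ℝ unitBump z‖ * ‖z‖⁻¹
      ≤ (Metric.closedBall (0 : ℂ) 2).indicator (fun _ => C) z := by
    obtain ⟨hn, h1, h2⟩ := h z
    have hI : 0 ≤ (Metric.closedBall (0 : ℂ) 2).indicator (fun _ => C) z :=
      Set.indicator_nonneg (fun _ _ => hC) _
    by_cases hz1 : ‖z‖ < 1
    · rw [h1 hz1]; simpa using hI
    · push Not at hz1
      by_cases hz2 : ‖z‖ ≤ 2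
      · rw [Set.indicator_of_mem (by simpa using hz2)]
        have : ‖z‖⁻¹ ≤ 1 := inv_le_one_of_one_le₀ hz1
        calc ‖fderiv ℝ unitBump z‖ * ‖z‖⁻¹ ≤ C * 1 := by gcongr
          _ = C := mul_one _
      · rw [h2 (not_le.1 hz2)]; simpa using hI
  rw [hd]
  calc _ ≤ (‖(R⁻¹ : ℝ) • fderiv ℝ unitBump ((R⁻¹ : ℝ) • z)‖ + ‖fderiv ℝ unitBump z‖) * ‖z‖⁻¹ := by
        gcongr; exact norm_sub_le _ _
    _ ≤ _ := by rw [add_mul]; exact add_le_add hb1 hb2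

/-- The real-linear form `ℓ` applied to the truncation of `1 / z`. -/
def invTest (R : ℝ) (ℓ : ℂ →L[ℝ] ℝ) (z : ℂ) : ℝ := annulusBump R z * ℓ z⁻¹

lemma hasFDerivAt_inv_real {z : ℂ} (hz : z ≠ 0) : HasFDerivAt (fun z : ℂ => z⁻¹)
    ((ContinuousLinearMap.toSpanSingleton ℂ (-(z ^ 2)⁻¹)).restrictScalars ℝ) z :=
  ((hasDerivAt_inv hz).hasFDerivAt).restrictScalars ℝ

lemma isTest_invTest {R : ℝ} (hR : 1 ≤ R) (ℓ : ℂ →L[ℝ] ℝ) : IsTest (invTest R ℓ) := by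
  constructor
  · rw [contDiff_iff_contDiffAt]
    intro z
    by_cases hz : z = 0
    · have : invTest R ℓ =ᶠ[𝓝 z] fun _ => 0 := by
        rw [hz]
        filter_upwards [Metric.ball_mem_nhds (0 : ℂ) one_pos] with w hw
        rw [mem_ball_zero_iff] at hw
        rw [invTest, annulusBump_eq_zero_of_le hR hw.le, zero_mul]
      exact contDiffAt_const.congr_of_eventuallyEq this
    · have hinv : ContDiffAt ℝ (⊤ : ℕ∞) (fun z : ℂ => z⁻¹) z :=
        (contDiffAt_inv ℂ hz).restrict_scalars ℝ
      exact (contDiff_annulusBump R).contDiffAt.mul (ℓ.contDiff.contDiffAt.comp z hinv)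
  · refine HasCompactSupport.intro (isCompact_closedBall 0 (2 * R)) fun z hz => ?_
    rw [mem_closedBall_zero_iff, not_le] at hz
    rw [invTest, annulusBump_eq_zero_of_ge hR hz.le, zero_mul]

lemma fderiv_invTest (R : ℝ) (ℓ : ℂ →L[ℝ] ℝ) {z : ℂ} (hz : z ≠ 0) (w : ℂ) :
    fderiv ℝ (invTest R ℓ) z w
      = annulusBump R z * ℓ (-(z ^ 2)⁻¹ * w) + fderiv ℝ (annulusBump R) z w * ℓ z⁻¹ := by
  have h1 := ((contDiff_annulusBump R).differentiable (by simp) z).hasFDerivAt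
  have h2 : HasFDerivAt (fun z : ℂ => ℓ z⁻¹) _ z :=
    ℓ.hasFDerivAt.comp z (hasFDerivAt_inv_real hz)
  have h3 : HasFDerivAt (invTest R ℓ) _ z := h1.fun_mul h2
  rw [h3.fderiv]
  simp [mul_comm]

lemma invTest_neg (R : ℝ) (ℓ : ℂ →L[ℝ] ℝ) (z : ℂ) : invTest R ℓ (-z) = -invTest R ℓ z := by
  rw [invTest, invTest, annulusBump_neg, inv_neg, map_neg, mul_neg]

/-- The derivative of `1 / z` is complex linear and `Im (i u) = Re u`, so the terms without a
derivative of the bump cancel. -/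
lemma abs_fderiv_invTest_sub_le (R : ℝ) (v : ℂ) {z : ℂ} (hz : z ≠ 0) :
    |fderiv ℝ (invTest R Complex.reCLM) z v
      - fderiv ℝ (invTest R Complex.imCLM) z (Complex.I * v)|
      ≤ 2 * (‖fderiv ℝ (annulusBump R) z‖ * ‖z‖⁻¹) * ‖v‖ := by
  rw [fderiv_invTest R _ hz, fderiv_invTest R _ hz]
  have h1 : Complex.imCLM (-(z ^ 2)⁻¹ * (Complex.I * v)) = Complex.reCLM (-(z ^ 2)⁻¹ * v) := by
    simp only [Complex.imCLM_apply, Complex.reCLM_apply]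
    rw [mul_left_comm, Complex.I_mul_im]
  have h2 : ∀ w : ℂ, |fderiv ℝ (annulusBump R) z w| ≤ ‖fderiv ℝ (annulusBump R) z‖ * ‖w‖ :=
    fun w => (fderiv ℝ (annulusBump R) z).le_opNorm w
  have h3 : |Complex.reCLM z⁻¹| ≤ ‖z‖⁻¹ := by
    rw [← norm_inv]; exact Complex.abs_re_le_norm _
  have h4 : |Complex.imCLM z⁻¹| ≤ ‖z‖⁻¹ := by
    rw [← norm_inv]; exact Complex.abs_im_le_norm _
  rw [h1, add_sub_add_left_eq_sub]
  refine (abs_sub _ _).trans ?_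
  rw [abs_mul, abs_mul]
  have h5 := h2 v
  have h6 := h2 (Complex.I * v)
  rw [norm_mul, Complex.norm_I, one_mul] at h6
  calc _ ≤ ‖fderiv ℝ (annulusBump R) z‖ * ‖v‖ * ‖z‖⁻¹
        + ‖fderiv ℝ (annulusBump R) z‖ * ‖v‖ * ‖z‖⁻¹ := by gcongr
    _ = _ := by ring

/-- The bump equals one at `2, …, N` and is nonnegative at the other positive integers; the
subtracted `1` is the term `n = 1`, where it vanishes. -/
lemma le_tsum_invTest (N : ℕ) (hN : 1 ≤ N) :
    ∑ i ∈ Finset.range N, 1 / ((i : ℝ) + 1) - 1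
      ≤ ∑' p : latticeN, invTest N Complex.reCLM p := by
  classical
  have hN1 : (1 : ℝ) ≤ N := by exact_mod_cast hN
  have hval : ∀ n : ℕ, invTest N Complex.reCLM (n + 1 : ℕ)
      = annulusBump N (n + 1 : ℕ) * (1 / ((n : ℝ) + 1)) := fun n => by
    rw [invTest, Complex.reCLM_apply, ← Complex.ofReal_natCast, ← Complex.ofReal_inv,
      Complex.ofReal_re, one_div]
    push_cast; rfl
  have hinj : Function.Injective fun i : ℕ => ((i + 1 : ℕ) : ℂ) := fun a b hab => by
    have : a + 1 = b + 1 := Nat.cast_injective hab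
    omega
  rw [tsum_subtype_eq_sum (φ := invTest N Complex.reCLM)
    (F := (Finset.range (2 * N)).image fun i : ℕ => ((i + 1 : ℕ) : ℂ)),
    Finset.sum_image hinj.injOn]
  · have hnn : ∀ i : ℕ, 0 ≤ invTest N Complex.reCLM (i + 1 : ℕ) := fun i => by
      rw [hval]
      refine mul_nonneg ?_ (by positivity)
      by_cases hi : i = 0
      · rw [annulusBump_eq_zero_of_le hN1 (by simp [hi])]
      · have h1 : (1 : ℝ) ≤ i := by exact_mod_cast Nat.one_le_iff_ne_zero.2 hi
        rw [annulusBump, unitBump_eq_zero (z := ((i + 1 : ℕ) : ℂ)), sub_zero]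
        · exact unitBump.nonneg
        · rw [Complex.norm_natCast]; push_cast; linarith
    refine le_trans ?_ (Finset.sum_le_sum_of_subset_of_nonneg
      (Finset.range_mono (show N ≤ 2 * N by omega)) fun i _ _ => hnn i)
    have hone : (1 : ℝ) = ∑ i ∈ Finset.range N, if i = 0 then (1 : ℝ) else 0 := by
      rw [Finset.sum_ite_eq' (Finset.range N) 0 (fun _ => (1 : ℝ)), if_pos (by simp; omega)]
    suffices h : ∑ i ∈ Finset.range N, 1 / ((i : ℝ) + 1) ≤ ∑ i ∈ Finset.range N,
        (invTest N Complex.reCLM (i + 1 : ℕ) + if i = 0 then (1 : ℝ) else 0) by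
      rw [Finset.sum_add_distrib, ← hone] at h
      linarith
    refine Finset.sum_le_sum fun i hi => ?_
    by_cases hi0 : i = 0
    · have := hnn i
      simp only [hi0, if_true] at this ⊢
      simpa using this
    · rw [if_neg hi0, add_zero, hval]
      have h1 : (1 : ℝ) ≤ i := by exact_mod_cast Nat.one_le_iff_ne_zero.2 hi0
      have h2 : ((i + 1 : ℕ) : ℝ) ≤ N := by exact_mod_cast Finset.mem_range.1 hi
      rw [annulusBump, unitBump_eq_zero (z := ((i + 1 : ℕ) : ℂ)), unitBump_eq_one, sub_zero,
        one_mul]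
      · rw [norm_inv_smul (by linarith), Complex.norm_natCast, div_le_one (by linarith)]
        exact h2
      · rw [Complex.norm_natCast]; push_cast; linarith
  · intro p hp
    obtain ⟨i, -, rfl⟩ := Finset.mem_image.1 hp
    exact ⟨i + 1, by omega, rfl⟩
  · rintro p ⟨n, hn, rfl⟩ hp
    have h1 : 2 * N ≤ n := by
      by_contra! hlt
      exact hp (Finset.mem_image.2 ⟨n - 1, Finset.mem_range.2 (by omega), by
        rw [Nat.sub_add_cancel hn]⟩)
    have h2 : 2 * (N : ℝ) ≤ n := by exact_mod_cast h1
    rw [invTest, annulusBump_eq_zero_of_ge hN1 (by rwa [Complex.norm_natCast]), zero_mul]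

/-- If, against odd test functions, the charge `∑ δ_p - m` acts as `± ∑_{n ≥ 1} δ_n`, then every
curl-free field has infinite energy. -/
theorem fieldEnergy_eq_top {Λ : Set ℂ} (hΛ : Λ ⊆ latticeZ2) {m : ℝ}
    (hodd : ∀ φ, IsTest φ → (∀ z, φ (-z) = -φ z) →
      |(∑' p : Λ, φ p) - m * ∫ z, φ z| = |∑' p : latticeN, φ p|)
    {j : ℂ → ℂ} (hj : j ∈ gradientFields Λ m) {χ : ℝ → ℂ → ℝ} (hχ : IsCutoffFamily χ) :
    fieldEnergy χ Λ j = ⊤ := by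
  by_contra hne
  obtain ⟨hjf, hcurl⟩ := hj
  obtain ⟨K, hK, hbound⟩ :=
    eventually_setIntegral_norm_le hΛ hjf hχ (lt_top_iff_ne_top.2 hne)
  obtain ⟨C, hC, hCb⟩ := exists_norm_fderiv_annulusBump_le
  have hnorm : ∀ r : ℝ, IntegrableOn (fun z => ‖j z‖) (Metric.closedBall 0 r) := fun r =>
    Integrable.norm (locallyIntegrable_iff.1 hjf.1 _ (isCompact_closedBall 0 r))
  set J₂ := ∫ z in Metric.closedBall (0 : ℂ) 2, ‖j z‖ with hJ₂
  -- The curl equation allows subtracting the pairing with the imaginary part at no cost. The two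
  -- constants come from the outer edge, through the `L¹` bound at radius `2 R`, and from the inner
  -- edge.
  have hmain : ∀ᶠ R : ℝ in atTop, 2 * Real.pi * |∑' p : latticeN, invTest R Complex.reCLM p|
      ≤ 8 * C * K + 2 * C * J₂ := by
    filter_upwards [(tendsto_id.const_mul_atTop two_pos).eventually hbound, eventually_ge_atTop 1]
      with R hR hR1
    simp only [id] at hR
    have hφ := isTest_invTest hR1 Complex.reCLM
    have hψ := isTest_invTest hR1 Complex.imCLM
    have hi1 := hφ.integrable_fderiv_apply hjf.1
    have hi2 := hψ.integrable_fderiv_apply (LocallyIntegrable.I_mul hjf.1)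
    have heq : ∫ z, (fderiv ℝ (invTest R Complex.reCLM) z (j z)
        - fderiv ℝ (invTest R Complex.imCLM) z (Complex.I * j z))
        = 2 * Real.pi * ((∑' p : Λ, invTest R Complex.reCLM p)
          - m * ∫ z, invTest R Complex.reCLM z) := by
      rw [integral_sub hi1 hi2, hjf.2.2 _ hφ, hcurl _ hψ, sub_zero]
    rw [← hodd _ hφ (invTest_neg R _), ← abs_of_pos Real.two_pi_pos, ← abs_mul, ← heq]
    set B : ℂ → ℝ := fun z =>
      2 * (C / R ^ 2) * (Metric.closedBall (0 : ℂ) (2 * R)).indicator (fun z => ‖j z‖) z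
      + 2 * C * (Metric.closedBall (0 : ℂ) 2).indicator (fun z => ‖j z‖) z with hB
    have hb1 := ((hnorm (2 * R)).integrable_indicator
      Metric.isClosed_closedBall.measurableSet).const_mul (2 * (C / R ^ 2))
    have hb2 := ((hnorm 2).integrable_indicator
      Metric.isClosed_closedBall.measurableSet).const_mul (2 * C)
    have hle : |∫ z, (fderiv ℝ (invTest R Complex.reCLM) z (j z)
        - fderiv ℝ (invTest R Complex.imCLM) z (Complex.I * j z))| ≤ ∫ z, B z := by
      have hBi : Integrable B := hb1.add hb2
      rw [← Real.norm_eq_abs]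
      refine norm_integral_le_of_norm_le hBi ?_
      filter_upwards [Measure.ae_ne volume (0 : ℂ)] with z hz
      refine (abs_fderiv_invTest_sub_le R (j z) hz).trans ?_
      have h1 := mul_le_mul_of_nonneg_right (hCb R hR1 z) (norm_nonneg (j z))
      have h2 : B z = 2 * ((Metric.closedBall (0 : ℂ) (2 * R)).indicator (fun _ => C / R ^ 2) z
          + (Metric.closedBall (0 : ℂ) 2).indicator (fun _ => C) z) * ‖j z‖ := by
        simp only [hB, Set.indicator]
        split_ifs <;> ring
      change _ ≤ B z
      rw [h2]
      linarith
    refine hle.trans ?_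
    have hBint := integral_add hb1 hb2
    change ∫ z, B z = _ at hBint
    rw [hBint, integral_const_mul, integral_const_mul,
      integral_indicator Metric.isClosed_closedBall.measurableSet,
      integral_indicator Metric.isClosed_closedBall.measurableSet, ← hJ₂]
    have hR0 : 0 < R := by linarith
    have : 2 * (C / R ^ 2) * ∫ z in Metric.closedBall (0 : ℂ) (2 * R), ‖j z‖
        ≤ 2 * (C / R ^ 2) * (K * (2 * R) ^ 2) := by gcongr
    have h3 : 2 * (C / R ^ 2) * (K * (2 * R) ^ 2) = 8 * C * K := by
      field_simp
      ring
    linarith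
  have hdiv : Tendsto (fun N : ℕ => ∑ i ∈ Finset.range N, 1 / ((i : ℝ) + 1)) atTop atTop :=
    Real.tendsto_sum_range_one_div_nat_succ_atTop
  obtain ⟨N, h1, h2, h3⟩ := ((tendsto_natCast_atTop_atTop.eventually hmain).and
    ((hdiv.eventually_gt_atTop (8 * C * K + 2 * C * J₂ + 1)).and
      (eventually_ge_atTop 1))).exists
  have h4 := le_tsum_invTest N h3
  have h5 := le_abs_self (∑' p : latticeN, invTest N Complex.reCLM p)
  have h6 := Real.pi_gt_three
  nlinarith [abs_nonneg (∑' p : latticeN, invTest N Complex.reCLM p)]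

/-! ### Membership and energies of the explicit fields -/

lemma conjField_mem_fields {Λ : Set ℂ} (hΛ : Λ ⊆ latticeZ2) {m : ℝ} {f : ℂ → ℂ}
    (hf : HasPoleBounds Λ f) (h : DivEquation Λ m (conjField f)) : conjField f ∈ fields Λ m :=
  ⟨locallyIntegrable_conjField (hf.locallyIntegrable hΛ), (hf.l2LocOff hΛ).conjField, h⟩

lemma Wtilde_lt_top {Λ : Set ℂ} (hΛ : Λ ⊆ latticeZ2) {m : ℝ} {f : ℂ → ℂ}
    (hf : HasPoleBounds Λ f) (h : DivEquation Λ m (conjField f)) {χ : ℝ → ℂ → ℝ}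
    (hχ : IsCutoffFamily χ) : Wtilde χ m Λ < ⊤ :=
  (iInf₂_le _ (conjField_mem_fields hΛ hf h)).trans_lt (hf.fieldEnergy_lt_top hΛ hχ)

lemma W_lt_top {Λ : Set ℂ} (hΛ : Λ ⊆ latticeZ2) {m : ℝ} {f : ℂ → ℂ}
    (hf : HasPoleBounds Λ f) (h : DivEquation Λ m (conjField f)) (hc : CurlFree (conjField f))
    {χ : ℝ → ℂ → ℝ} (hχ : IsCutoffFamily χ) : W χ m Λ < ⊤ :=
  (iInf₂_le _ ⟨conjField_mem_fields hΛ hf h, hc⟩).trans_lt (hf.fieldEnergy_lt_top hΛ hχ)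

lemma divEquation_latField_sub {Λ : Set ℂ} (hΛ : Λ ⊆ latticeZ2) {f : ℂ → ℂ}
    (hf : HasPoleBounds Λ f) (h : DivEquation Λ 0 (conjField f)) :
    DivEquation (latticeZ2 \ Λ) 1 (conjField fun z => latField z - f z) := by
  rw [conjField_sub]
  simpa using DivEquation.sub subset_rfl hΛ
    (locallyIntegrable_conjField (hasPoleBounds_latField.locallyIntegrable subset_rfl))
    (locallyIntegrable_conjField (hf.locallyIntegrable hΛ))
    divEquation_and_curlFree_latField.1 h

lemma curlFree_latField_sub_piCot : CurlFree (conjField fun z => latField z - piCot z) := by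
  rw [conjField_sub]
  exact CurlFree.sub
    (locallyIntegrable_conjField (hasPoleBounds_latField.locallyIntegrable subset_rfl))
    (locallyIntegrable_conjField (hasPoleBounds_piCot.locallyIntegrable latticeZ_subset))
    divEquation_and_curlFree_latField.2 divEquation_and_curlFree_piCot.2

/-! ### Gradient fields of half-lines -/

lemma latticeN_subset_latticeZ2 : latticeN ⊆ latticeZ2 := latticeN_subset.trans latticeZ_subset

/-- Reflection preserves the lattice. Reindexing and negating a `tsum` need no summability, so none
is assumed. -/
lemma tsum_latticeZ2_of_odd {φ : ℂ → ℝ} (h : ∀ z, φ (-z) = -φ z) :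
    ∑' p : latticeZ2, φ p = 0 := by
  have hmem : ∀ z : ℂ, -z ∈ latticeZ2 ↔ z ∈ latticeZ2 := by
    have : ∀ z : ℂ, z ∈ latticeZ2 → -z ∈ latticeZ2 := by
      rintro z ⟨a, b, rfl⟩
      exact ⟨-a, -b, by push_cast; ring⟩
    exact fun z => ⟨fun hz => by simpa using this _ hz, this z⟩
  have h1 : ∑' z, latticeZ2.indicator φ (-z) = ∑' z, latticeZ2.indicator φ z :=
    (Equiv.neg ℂ).tsum_eq (latticeZ2.indicator φ)
  have h2 : ∀ z, latticeZ2.indicator φ (-z) = -latticeZ2.indicator φ z := fun z => by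
    by_cases hz : z ∈ latticeZ2
    · rw [Set.indicator_of_mem ((hmem z).2 hz), Set.indicator_of_mem hz, h]
    · rw [Set.indicator_of_notMem fun h => hz ((hmem z).1 h), Set.indicator_of_notMem hz, neg_zero]
  simp_rw [h2, tsum_neg] at h1
  rw [tsum_subtype]
  linarith

lemma integral_of_odd {φ : ℂ → ℝ} (h : ∀ z, φ (-z) = -φ z) : ∫ z, φ z = 0 := by
  have h1 := integral_neg_eq_self φ volume
  simp_rw [h, integral_neg] at h1
  linarith

lemma W_latticeN_eq_top {χ : ℝ → ℂ → ℝ} (hχ : IsCutoffFamily χ) : W χ 0 latticeN = ⊤ :=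
  iInf₂_eq_top.2 fun _ hj =>
    fieldEnergy_eq_top latticeN_subset_latticeZ2 (fun φ _ _ => by simp) hj hχ

/-- On odd test functions `ℤ²` and the background contribute zero, leaving minus the charge of `ℕ`;
the absolute value in `fieldEnergy_eq_top` absorbs the sign. -/
lemma W_diff_latticeN_eq_top {χ : ℝ → ℂ → ℝ} (hχ : IsCutoffFamily χ) :
    W χ 1 (latticeZ2 \ latticeN) = ⊤ := by
  refine iInf₂_eq_top.2 fun _ hj => fieldEnergy_eq_top Set.sdiff_subset (fun φ hφ hodd => ?_) hj hχ
  rw [hφ.tsum_diff subset_rfl latticeN_subset_latticeZ2, tsum_latticeZ2_of_odd hodd,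
    integral_of_odd hodd, mul_zero, sub_zero, zero_sub, abs_neg]

end RenormalizedEnergy

end

open RenormalizedEnergy

theorem theorem1 (χ : ℝ → ℂ → ℝ) (hχ : RenormalizedEnergy.IsCutoffFamily χ) :
    (RenormalizedEnergy.Wtilde χ 0 RenormalizedEnergy.latticeZ < ⊤ ∧
      RenormalizedEnergy.Wtilde χ 0 RenormalizedEnergy.latticeN < ⊤ ∧
      RenormalizedEnergy.Wtilde χ 1
        (RenormalizedEnergy.latticeZ2 \ RenormalizedEnergy.latticeZ) < ⊤ ∧
      RenormalizedEnergy.Wtilde χ 1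
        (RenormalizedEnergy.latticeZ2 \ RenormalizedEnergy.latticeN) < ⊤) ∧
    (RenormalizedEnergy.W χ 0 RenormalizedEnergy.latticeZ < ⊤ ∧
      RenormalizedEnergy.W χ 1 RenormalizedEnergy.latticeZ2 < ⊤ ∧
      RenormalizedEnergy.W χ 1
        (RenormalizedEnergy.latticeZ2 \ RenormalizedEnergy.latticeZ) < ⊤) ∧
    (RenormalizedEnergy.W χ 0 RenormalizedEnergy.latticeN = ⊤ ∧
      RenormalizedEnergy.W χ 1
        (RenormalizedEnergy.latticeZ2 \ RenormalizedEnergy.latticeN) = ⊤) ∧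
    (RenormalizedEnergy.Wtilde χ 0 RenormalizedEnergy.latticeN
      ≠ RenormalizedEnergy.W χ 0 RenormalizedEnergy.latticeN) := by
  have hN := latticeN_subset_latticeZ2
  have hcotN := hasPoleBounds_halfCot
  have hcotZ := hasPoleBounds_piCot
  have hlat := hasPoleBounds_latField
  obtain ⟨hdZ, hcZ⟩ := divEquation_and_curlFree_piCot
  obtain ⟨hdL, hcL⟩ := divEquation_and_curlFree_latField
  have hZ := latticeZ_subset
  have hNlt : Wtilde χ 0 latticeN < ⊤ := Wtilde_lt_top hN hcotN divEquation_halfCot hχ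
  have hbZ := HasPoleBounds.sub hZ subset_rfl hlat hcotZ
  have hbN := HasPoleBounds.sub hN subset_rfl hlat hcotN
  refine ⟨⟨Wtilde_lt_top hZ hcotZ hdZ hχ, hNlt, ?_, ?_⟩, ⟨W_lt_top hZ hcotZ hdZ hcZ hχ,
    W_lt_top subset_rfl hlat hdL hcL hχ, ?_⟩, ⟨W_latticeN_eq_top hχ, W_diff_latticeN_eq_top hχ⟩, ?_⟩
  · exact Wtilde_lt_top Set.sdiff_subset hbZ (divEquation_latField_sub hZ hcotZ hdZ) hχ
  · exact Wtilde_lt_top Set.sdiff_subset hbN (divEquation_latField_sub hN hcotN divEquation_halfCot) hχ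
  · exact W_lt_top Set.sdiff_subset hbZ (divEquation_latField_sub hZ hcotZ hdZ)
      curlFree_latField_sub_piCot hχ
  · rw [W_latticeN_eq_top hχ]
    exact hNlt.ne
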